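/- A finite ringed space is a pair $(X,\mathcal O)$ consisting of a finite topological space $X$ (not necessarily $T_0$) and a sheaf $\mathcal O$ of commutative rings with unit on $X$. For $x\in X$ let $U_x$ be the smallest open subset containing $x$, so that the stalk is $\mathcal O_x=\mathcal O(U_x)$. A finite ringed space $(X,\mathcal O)$ is called affine if 1. $\mathcal O(X)\to\prod_{x\in X}\mathcal O_x$ is faithfully flat; 2. the natural map $\mathcal O_x\otimes_{\mathcal O(X)}\mathcal O_y\to\mathcal O(U_x\cap U_y)$ is an isomorphism for all $x,y\in X$; 3. $\mathcal O(U_x\cap U_y)\to\prod_{z\in U_x\cap U_y}\mathcal O_z$ is faithfully flat for all $x,y\in X$. It is called schematic if it has an open covering $\{U_i\}$ such that each $(U_i,\mathcal O|_{U_i})$ is affine. An $\mathcal O$-module $\mathcal M$ is quasi-coherent if every point has an open neighbourhood $U$ with an exact sequence $\mathcal O|_U^{I}\to\mathcal O|_U^{J}\to\mathcal M|_U\to 0$ for some sets $I,J$. **Theorem.** Let $X$ be a schematic finite space. The following are equivalent: (a) $X$ is affine; (b) the functor $\mathcal M\mapsto\Gamma(X,\mathcal M)$ from quasi-coherent $\mathcal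 O_X$-modules to $\mathcal O(X)$-modules is exact, that is, it takes short exact sequences $0\to\mathcal M'\to\mathcal M\to\mathcal M''\to0$ of $\mathcal O_X$-modules with quasi-coherent terms to short exact sequences; (c) $H^1(X,\mathcal M)=0$ for every quasi-coherent $\mathcal O_X$-module $\mathcal M$; (d) every quasi-coherent $\mathcal O_X$-module $\mathcal M$ is acyclic, that is, $H^n(X,\mathcal M)=0$ for all $n>0$. -/

import Mathlib

open CategoryTheory TopologicalSpace Opposite TensorProduct

universe u

noncomputable section

namespace FiniteRingedSpace

/-! ### Rings of sections -/

/-- For a commutative square of commutative rings `h ∘ f = k ∘ g`, with `f : A → B`, `g : A → C`,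
`h : B → D`, `k : C → D`, the canonical map `B ⊗_A C → D`, `b ⊗ c ↦ h b * k c`, is bijective. -/
def TensorMapBijective {A B C D : Type u} [CommRing A] [CommRing B] [CommRing C] [CommRing D]
    (f : A →+* B) (g : A →+* C) (h : B →+* D) (k : C →+* D) (w : h.comp f = k.comp g) : Prop :=
  letI : Algebra A B := f.toAlgebra
  letI : Algebra A C := g.toAlgebra
  letI : Algebra A D := (h.comp f).toAlgebra
  Function.Bijective (Algebra.TensorProduct.productMap
    (⟨h, fun _ => rfl⟩ : B →ₐ[A] D) (⟨k, fun a => (RingHom.congr_fun w a).symm⟩ : C →ₐ[A] D))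

variable (X : AlgebraicGeometry.RingedSpace.{u, u})

/-- The restriction homomorphism `𝒪(V) → 𝒪(U)` for open sets `U ⊆ V`. -/
def res {U V : Opens X} (h : U ≤ V) : X.presheaf.obj (op V) →+* X.presheaf.obj (op U) :=
  (X.presheaf.map (homOfLE h).op).hom

lemma res_comp_res {U V W : Opens X} (h : U ≤ V) (h' : V ≤ W) :
    (res X h).comp (res X h') = res X (h.trans h') := by
  have : X.presheaf.map (homOfLE (h.trans h')).op =
      X.presheaf.map (homOfLE h').op ≫ X.presheaf.map (homOfLE h).op := by
    rw [← Functor.map_comp]; rfl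
  simp only [res, this, CommRingCat.hom_comp]

section Finite

variable [Finite X]

/-- The smallest open subset `U_x` containing the point `x` of a finite ringed space. Since it is
the smallest neighbourhood of `x`, the stalk `𝒪_x` is `𝒪(U_x)`. -/
def minOpen (x : X) : Opens X := ⟨nhdsKer {x}, isOpen_nhdsKer⟩

variable {X} in
lemma mem_minOpen (x : X) : x ∈ minOpen X x :=
  subset_nhdsKer (Set.mem_singleton x)

variable {X} in
lemma minOpen_le {x : X} {U : Opens X} (hx : x ∈ U) : minOpen X x ≤ U :=
  nhdsKer_minimal (Set.singleton_subset_iff.2 hx) U.isOpen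

/-- The stalk `𝒪_x = 𝒪(U_x)`. -/
abbrev stalkRing (x : X) : Type u := X.presheaf.obj (op (minOpen X x))

/-- The canonical homomorphism `𝒪(U) → ∏_{z ∈ U} 𝒪_z`. -/
def toProdStalks (U : Opens X) :
    X.presheaf.obj (op U) →+* ((z : U) → stalkRing X z.1) :=
  RingHom.pi fun z => res X (minOpen_le z.2)

/-! ### Affine and schematic finite spaces -/

/-- The open subspace `(U, 𝒪|_U)` of the finite ringed space `X` is an affine finite space.
For `x ∈ U`, the smallest open neighbourhood of `x` in `U` is the one in `X`, and sections of
`𝒪|_U` over an open subset of `U` are sections of `𝒪`. -/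
structure IsAffineOpen (U : Opens X) : Prop where
  /-- `𝒪(U) → ∏_{x ∈ U} 𝒪_x` is faithfully flat. -/
  faithfullyFlat : (toProdStalks X U).FaithfullyFlat
  /-- `𝒪_x ⊗_{𝒪(U)} 𝒪_y → 𝒪(U_x ∩ U_y)` is an isomorphism. -/
  tensor : ∀ (x y : X) (hx : x ∈ U) (hy : y ∈ U),
    TensorMapBijective (res X (minOpen_le hx)) (res X (minOpen_le hy))
      (res X (inf_le_left : minOpen X x ⊓ minOpen X y ≤ minOpen X x))
      (res X (inf_le_right : minOpen X x ⊓ minOpen X y ≤ minOpen X y))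
      (by rw [res_comp_res, res_comp_res])
  /-- `𝒪(U_x ∩ U_y) → ∏_{z ∈ U_x ∩ U_y} 𝒪_z` is faithfully flat. -/
  faithfullyFlat_inf : ∀ x ∈ U, ∀ y ∈ U,
    (toProdStalks X (minOpen X x ⊓ minOpen X y)).FaithfullyFlat

/-- `X` is an affine finite space. -/
def IsAffine : Prop := IsAffineOpen X ⊤

/-- `X` is a schematic finite space: it has an open covering by affine finite spaces. -/
def IsSchematic : Prop :=
  ∃ (ι : Type u) (U : ι → Opens X), (∀ x : X, ∃ i, x ∈ U i) ∧ ∀ i, IsAffineOpen X (U i)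

end Finite

/-! ### Quasi-coherent modules, global sections and cohomology -/

/-- The structure sheaf, as a sheaf of (not necessarily commutative) rings. -/
abbrev ringSheaf : TopCat.Sheaf RingCat.{u} X :=
  (sheafCompose _ (forget₂ CommRingCat RingCat.{u})).obj X.sheaf

/-- The category of `𝒪_X`-modules. -/
abbrev ModX := SheafOfModules.{u} (ringSheaf X)

/-- The category of quasi-coherent `𝒪_X`-modules, a full subcategory of `ModX X`. -/
abbrev QcMod := (SheafOfModules.isQuasicoherent (ringSheaf X)).FullSubcategory

/-- The inclusion of quasi-coherent `𝒪_X`-modules into `𝒪_X`-modules. -/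
abbrev QcMod.incl : QcMod X ⥤ ModX X := (SheafOfModules.isQuasicoherent (ringSheaf X)).ι

/-- The functor `ℳ ↦ Γ(X, ℳ)` from quasi-coherent `𝒪_X`-modules to `𝒪(X)`-modules. -/
abbrev globalSections : QcMod X ⥤ ModuleCat.{u} (X.presheaf.obj (op ⊤)) :=
  QcMod.incl X ⋙ SheafOfModules.evaluation (ringSheaf X) (op ⊤)

instance : (globalSections X).PreservesZeroMorphisms := ⟨fun _ _ => rfl⟩

/-- `Γ` is exact: short exact sequences of quasi-coherent modules go to short exact sequences. -/
def GlobalSectionsExact : Prop :=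
  ∀ S : ShortComplex (QcMod X),
    (S.map (QcMod.incl X)).ShortExact → (S.map (globalSections X)).ShortExact

variable {X} in
/-- The cohomology group `H^n(X, ℳ)` of (the underlying abelian sheaf of) an `𝒪_X`-module. -/
abbrev H (M : ModX X) (n : ℕ) : Type u :=
  Sheaf.H ((SheafOfModules.toSheaf (ringSheaf X)).obj M) n

end FiniteRingedSpace

end

/-! On a finite space a sheaf of modules amounts to its stalks `M_x = Γ(U_x, M)` together with the
specialization maps `M_x → M_y` for `y ∈ U_x` (`StalkMod`). On a schematic space it is
quasi-coherent exactly when every `M_x ⊗ 𝒪_y → M_y` is an isomorphism (`StalkMod.QC`; see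
`qc_ofSheaf` and `QC.isQuasicoherent`). The maps `𝒪_x → 𝒪_y` are flat, so kernels and cokernels of
quasi-coherent modules are again quasi-coherent. So is the truncation `T_V M = j_* j^* M` for an
open `j : V → X`, because sections over `V ∩ U_x` commute with base change to `𝒪_y`
(`isBC_restrict`).

Affine implies acyclic. By faithfully flat descent `Γ(V, -)` is exact on quasi-coherent modules for
`V` affine (`surjective_sec_map`). The higher cohomology is killed by induction on the number of
points of `V` (`IsAffineOpen.vanishOn`). If `V = U_z`, sections are a stalk. Otherwise `M` embeds on
`V` in the product of the `T_{U_z} M`, `z ∈ V`. These are acyclic on `V`: the intersections `U_y ∩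
U_z` are affine with fewer points than `V`, and stalks are exact on `U_z`. The cokernel is
quasi-coherent, and dimension shifting concludes. Cohomology is handled through Godement modules,
which are flasque.

Acyclicity contains the vanishing of `H¹`, and the long exact sequence then makes `Γ` exact.

Exactness of `Γ` implies affine. The heart is `QC.eq_zero`: a quasi-coherent module without global
sections is zero. A counterexample of minimal support can be replaced by a subquotient all of whose
stalks are zero or simple. For `y` in the support with `U_y` minimal, every specialization map from
the support to `M_y` is then bijective, so a nonzero element of `M_y` spreads to a global section, a
contradiction. Applied to the kernel and cokernel of `Γ(X, M) ⊗ 𝒪 → M`, this shows `Γ(X, M) ⊗ 𝒪_x =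
M_x` for all quasi-coherent `M` (`isBC_germ_top`). The three axioms follow by suitable choices of
modules: truncations of `𝒪` for the tensor condition, pullbacks of ideals for faithful flatness over
`𝒪(X)`, and pullbacks of quotients of `𝒪(U_x ∩ U_y)` for the last axiom. -/

noncomputable section

namespace FiniteRingedSpace
open Limits

/-! ### Sheaves of modules evaluated at an object with only the trivial cover -/

section Reflective

universe v₁ v₂ v₃ u₁ u₂ u₃ w w'

/-- A functor out of a reflective subcategory preserves colimits as soon as its composition with
the reflector does. -/
lemma preservesColimitsOfShape_of_reflector {C : Type u₁} [Category.{v₁} C] {D : Type u₂}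
    [Category.{v₂} D] {E : Type u₃} [Category.{v₃} E] {L : C ⥤ D} {R : D ⥤ C} (adj : L ⊣ R)
    [IsIso adj.counit] (H : D ⥤ E) (K : Type w) [Category.{w'} K] [HasColimitsOfShape K C]
    [PreservesColimitsOfShape K (L ⋙ H)] : PreservesColimitsOfShape K H where
  preservesColimit {F} := by
    have : PreservesColimitsOfShape K L := adj.leftAdjoint_preservesColimits.1
    -- Every diagram in the reflective subcategory is the reflection of a diagram of the ambient
    -- category.
    let e : (F ⋙ R) ⋙ L ≅ F :=
      Functor.isoWhiskerLeft F (asIso adj.counit)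
    have : PreservesColimit ((F ⋙ R) ⋙ L) H :=
      preservesColimit_of_preserves_colimit_cocone
        (isColimitOfPreserves L (colimit.isColimit (F ⋙ R)))
        (isColimitOfPreserves (L ⋙ H) (colimit.isColimit (F ⋙ R)))
    exact preservesColimit_of_iso_diagram H e

end Reflective

section Site

universe v' u' w w'

variable {C : Type u'} [Category.{v'} C] (J : GrothendieckTopology C)

/-- An object of a site is local if its only covering sieve is the maximal one. -/
def IsLocalObject (c : C) : Prop := ∀ S ∈ J c, S = ⊤

variable {J}

/-- The sieve of arrows along which a section lifts is covering, hence contains the identity of `c`.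
-/
lemma IsLocalObject.surjective {c : C} (hc : IsLocalObject J c) {F G : Cᵒᵖ ⥤ AddCommGrpCat.{u}}
    (f : F ⟶ G) (hf : Presheaf.IsLocallySurjective J f) : Function.Surjective (f.app (op c)) := by
  intro s
  have h := hc _ (hf.imageSieve_mem s)
  have : Presheaf.imageSieve f s (𝟙 c) := by rw [h]; trivial
  obtain ⟨t, ht⟩ := this
  exact ⟨t, by simpa using ht⟩

lemma IsLocalObject.injective {c : C} (hc : IsLocalObject J c) {F G : Cᵒᵖ ⥤ AddCommGrpCat.{u}}
    (f : F ⟶ G) (hf : Presheaf.IsLocallyInjective J f) : Function.Injective (f.app (op c)) := by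
  intro s t hst
  have h := hc _ (Presheaf.equalizerSieve_mem J f s t hst)
  have : Presheaf.equalizerSieve s t (𝟙 c) := by rw [h]; trivial
  simpa using this

variable [HasSheafify J AddCommGrpCat.{u}] [J.WEqualsLocallyBijective AddCommGrpCat.{u}]

lemma IsLocalObject.isIso_toSheafify {c : C} (hc : IsLocalObject J c)
    (F : Cᵒᵖ ⥤ AddCommGrpCat.{u}) : IsIso ((toSheafify J F).app (op c)) := by
  rw [ConcreteCategory.isIso_iff_bijective]
  exact ⟨hc.injective _ inferInstance, hc.surjective _ inferInstance⟩

variable {R : Sheaf J RingCat.{u}}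

/-- The abelian sheaf underlying the sheafification of a presheaf of modules is the sheafification
of the underlying abelian presheaf, and the latter functor preserves colimits. -/
instance (K : Type w) [Category.{w'} K] [HasColimitsOfShape K AddCommGrpCat.{u}]
    [HasColimitsOfShape K (PresheafOfModules.{u} R.obj)]
    [PreservesColimitsOfShape K (PresheafOfModules.toPresheaf.{u} R.obj)] :
    PreservesColimitsOfShape K (SheafOfModules.toSheaf.{u} R) := by
  have : PreservesColimitsOfShape K
      (PresheafOfModules.sheafification (𝟙 R.obj) ⋙ SheafOfModules.toSheaf.{u} R) :=
    inferInstanceAs (PreservesColimitsOfShape K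
      (PresheafOfModules.toPresheaf _ ⋙ presheafToSheaf J AddCommGrpCat.{u}))
  exact preservesColimitsOfShape_of_reflector
    (PresheafOfModules.sheafificationAdjunction (𝟙 R.obj)) _ K

/-- Sheafification changes nothing at `c`, so evaluation composed with the reflector from presheaves
of modules is presheaf evaluation, which preserves the colimits. -/
lemma IsLocalObject.preservesColimitsOfShape_evaluation {c : C} (hc : IsLocalObject J c)
    (K : Type w) [Category.{w'} K] [HasColimitsOfShape K AddCommGrpCat.{u}]
    [HasColimitsOfShape K (PresheafOfModules.{u} R.obj)]
    [PreservesColimitsOfShape K (PresheafOfModules.toPresheaf.{u} R.obj)] :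
    PreservesColimitsOfShape K (SheafOfModules.evaluation.{u} R (op c)) := by
  let ev := (CategoryTheory.evaluation Cᵒᵖ AddCommGrpCat.{u}).obj (op c)
  let α : 𝟭 _ ⋙ ev ⟶ (presheafToSheaf J AddCommGrpCat.{u} ⋙ sheafToPresheaf J _) ⋙ ev :=
    Functor.whiskerRight (toSheafification J AddCommGrpCat.{u}) ev
  have hα : IsIso α := by
    rw [NatTrans.isIso_iff_isIso_app]
    exact fun F => hc.isIso_toSheafify F
  let e : PresheafOfModules.toPresheaf R.obj ⋙ ev ≅
      PresheafOfModules.sheafification (𝟙 R.obj) ⋙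
        SheafOfModules.evaluation.{u} R (op c) ⋙ forget₂ _ AddCommGrpCat.{u} :=
    Functor.isoWhiskerLeft (PresheafOfModules.toPresheaf R.obj) (asIso α)
  have h₁ : PreservesColimitsOfShape K (PresheafOfModules.sheafification (𝟙 R.obj) ⋙
        SheafOfModules.evaluation.{u} R (op c) ⋙ forget₂ _ AddCommGrpCat.{u}) :=
    preservesColimitsOfShape_of_natIso e
  have h₂ : PreservesColimitsOfShape K
      (SheafOfModules.evaluation.{u} R (op c) ⋙ forget₂ _ AddCommGrpCat.{u}) :=
    preservesColimitsOfShape_of_reflector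
      (PresheafOfModules.sheafificationAdjunction (𝟙 R.obj)) _ K
  exact preservesColimitsOfShape_of_reflects_of_preserves _ (forget₂ _ AddCommGrpCat.{u})

/-- At a local object, an epimorphism of sheaves of modules is surjective. -/
lemma IsLocalObject.surjective_of_epi {c : C} (hc : IsLocalObject J c)
    {M N : SheafOfModules.{u} R} (f : M ⟶ N) [Epi f] :
    Function.Surjective (f.val.app (op c)) := by
  have : Epi ((SheafOfModules.toSheaf R).map f) := inferInstance
  exact hc.surjective ((SheafOfModules.toSheaf R).map f).hom
    ((Sheaf.isLocallySurjective_iff_epi' _ _).2 this)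

/-- The value at `c` of a section of a sheaf of modules. -/
abbrev sectionAt {M : SheafOfModules.{u} R} (s : M.sections) (c : C) : M.val.obj (op c) :=
  s.val (op c)

open SheafOfModules

/-- The tautological sections of a free sheaf of modules generate its module of sections
over a local object. -/
lemma IsLocalObject.span_freeSection {c : C} (hc : IsLocalObject J c) (I : Type u) :
    Submodule.span (R.obj.obj (op c)) (Set.range fun i : I =>
      sectionAt (freeSection (R := R) i) c) = ⊤ := by
  have := hc.preservesColimitsOfShape_evaluation (R := R) (Discrete I)
  have hcol := isColimitOfPreserves (SheafOfModules.evaluation.{u} R (op c))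
    (isColimitFreeCofan (R := R) I)
  set P := Submodule.span (R.obj.obj (op c)) (Set.range fun i : I =>
      sectionAt (freeSection (R := R) i) c) with hP
  -- The sections at `c` of a free sheaf are a coproduct of copies of `R(c)`, so a map out of them
  -- is determined on the tautological sections, which the quotient map kills.
  have : ModuleCat.ofHom P.mkQ = ModuleCat.ofHom 0 := by
    refine hcol.hom_ext fun ⟨i⟩ => ?_
    ext : 1
    refine LinearMap.ext_ring ?_
    exact (Submodule.Quotient.mk_eq_zero P).2 (Submodule.subset_span ⟨i, rfl⟩)
  rw [eq_top_iff]
  intro x _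
  exact (Submodule.Quotient.mk_eq_zero P).1 (congr($(ModuleCat.hom_ext_iff.1 this) x))

lemma linearIndependent_freeSection (c : C) (I : Type u) :
    LinearIndependent (R.obj.obj (op c)) (fun i : I =>
      sectionAt (freeSection (R := R) i) c) := by
  classical
  rw [linearIndependent_iff]
  intro l hl
  ext j
  -- The family equal to `1` at `j` and `0` elsewhere defines the `j`-th coordinate, a morphism from
  -- the free sheaf to the unit.
  let s : I → (unit R).sections := fun i => if i = j then unitHomEquiv _ (𝟙 _) else
    unitHomEquiv _ 0
  have h := congr((((freeHomEquiv _).symm s).val.app (op c)).hom $hl)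
  have h' (i : I) : (((freeHomEquiv _).symm s).val.app (op c)) (sectionAt (freeSection (R := R) i) c)
      = (if i = j then (1 : R.obj.obj (op c)) else 0) := by
    change sectionAt (sectionsMap ((freeHomEquiv _).symm s) (freeSection i)) c = _
    rw [sectionsMap_freeHomEquiv_symm_freeSection]
    simp only [s]
    split_ifs <;> rfl
  rw [Finsupp.linearCombination_apply, Finsupp.sum, map_sum] at h
  simp only [map_smul] at h
  erw [Finset.sum_congr rfl (fun i _ => congrArg (l i • ·) (h' i)), map_zero] at h
  change ∑ x ∈ l.support, l x * (if x = j then (1 : R.obj.obj (op c)) else 0) = 0 at h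
  simpa [Finset.sum_ite_eq] using h

/-- The tautological basis of the sections over a local object of a free sheaf of modules. -/
def IsLocalObject.freeBasis {c : C} (hc : IsLocalObject J c) (I : Type u) :
    Module.Basis I (R.obj.obj (op c)) ((free (R := R) I).val.obj (op c)) :=
  .mk (linearIndependent_freeSection c I) (hc.span_freeSection I).ge

lemma IsLocalObject.freeBasis_apply {c : C} (hc : IsLocalObject J c) (I : Type u) (i : I) :
    hc.freeBasis (R := R) I i = sectionAt (freeSection (R := R) i) c :=
  Module.Basis.mk_apply _ _ _

omit [HasSheafify J AddCommGrpCat.{u}] [J.WEqualsLocallyBijective AddCommGrpCat.{u}] in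
lemma epi_of_surjective_of_local {M N : SheafOfModules.{u} R} (f : M ⟶ N)
    (hcov : ∀ c : C, ∃ T : Presieve c, Sieve.generate T ∈ J c ∧ ∀ ⦃d : C⦄ (g : d ⟶ c), T g →
      Function.Surjective (f.val.app (op d))) : Epi f := by
  have : Sheaf.IsLocallySurjective ((SheafOfModules.toSheaf R).map f) := by
    refine ⟨fun {c} s => ?_⟩
    obtain ⟨T, hT, h⟩ := hcov c
    refine J.superset_covering ((Sieve.generate_le_iff _ _).2 fun d g hg => ?_) hT
    obtain ⟨t, ht⟩ := h g hg (N.val.map g.op s)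
    exact ⟨t, ht⟩
  exact (SheafOfModules.toSheaf R).epi_of_epi_map inferInstance

end Site
end FiniteRingedSpace

end

/-! ### Base change of modules along ring homomorphisms -/

noncomputable section

namespace FiniteRingedSpace

section BaseChange

variable {R S T : Type u} [CommRing R] [CommRing S] [CommRing T]
variable {M N P M' N' : Type*} [AddCommGroup M] [AddCommGroup N] [AddCommGroup P]
  [AddCommGroup M'] [AddCommGroup N']

lemma isScalarTower_compHom (f : R →+* S) [Module S N] :
    letI := f.toAlgebra
    letI := Module.compHom N f
    IsScalarTower R S N :=
  letI := f.toAlgebra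
  letI := Module.compHom N f
  ⟨fun r s n => mul_smul (f r) s n⟩

/-- A semilinear map regarded as a linear map to the restriction of scalars. -/
def toRestrict {f : R →+* S} [Module R M] [Module S N] (g : M →ₛₗ[f] N) :
    letI := Module.compHom N f
    M →ₗ[R] N :=
  letI := Module.compHom N f
  { toFun := g, map_add' := g.map_add, map_smul' := g.map_smulₛₗ }

/-- A semilinear map `g : M → N` along `f : R → S` is a base change if it identifies `N`
with `S ⊗ M`. -/
def IsBC {f : R →+* S} [Module R M] [Module S N] (g : M →ₛₗ[f] N) : Prop :=
  letI := f.toAlgebra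
  letI := Module.compHom N f
  haveI := isScalarTower_compHom (N := N) f
  IsBaseChange S (toRestrict g)

/-- `IsBC` carries no algebra instances, so that many ring maps between the same rings can coexist;
this translates it to `IsBaseChange` for any compatible instances. -/
lemma isBC_iff {f : R →+* S} [Module R M] [Module S N] (g : M →ₛₗ[f] N) [Algebra R S]
    [Module R N] [IsScalarTower R S N] (hf : ∀ r, algebraMap R S r = f r) (g' : M →ₗ[R] N)
    (hg : ∀ m, g' m = g m) : IsBC g ↔ IsBaseChange S g' := by
  have h2 : ‹Module R N› = Module.compHom N f :=
    Module.ext' _ _ fun r n => by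
      rw [← algebraMap_smul S r n, hf]; rfl
  have h1 : ‹Algebra R S› = f.toAlgebra := Algebra.algebra_ext _ _ hf
  subst h1 h2
  let := f.toAlgebra
  let := Module.compHom N f
  have h3 : g' = toRestrict g := LinearMap.ext hg
  subst h3
  rfl

/-- Extension of scalars along a ring homomorphism. -/
def Extend (f : R →+* S) (M : Type u) [AddCommGroup M] [Module R M] : Type u :=
  @TensorProduct R _ S M _ _ f.toAlgebra.toModule _

section

variable {M : Type u} [AddCommGroup M] [Module R M]

instance (f : R →+* S) : AddCommGroup (Extend f M) :=
  letI := f.toAlgebra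
  (TensorProduct.addCommGroup : AddCommGroup (S ⊗[R] M))

instance (f : R →+* S) : Module S (Extend f M) :=
  letI := f.toAlgebra
  (TensorProduct.leftModule : Module S (S ⊗[R] M))

variable (M) in
/-- The canonical map to the extension of scalars. -/
def Extend.mk (f : R →+* S) : M →ₛₗ[f] Extend f M :=
  letI := f.toAlgebra
  { toFun := fun m => (TensorProduct.mk R S M 1 m : S ⊗[R] M)
    map_add' := (TensorProduct.mk R S M 1).map_add
    map_smul' := fun r m => by
      refine ((TensorProduct.mk R S M 1).map_smul r m).trans ?_
      exact (algebraMap_smul S r ((1 : S) ⊗ₜ[R] m)).symm }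

lemma Extend.isBC (f : R →+* S) : IsBC (Extend.mk M f) := by
  let := f.toAlgebra
  exact (isBC_iff (N := S ⊗[R] M) (Extend.mk M f) (fun _ => rfl) (TensorProduct.mk R S M 1)
    fun _ => rfl).2 (TensorProduct.isBaseChange R M S)

end

variable [Module R M] [Module R M'] [Module S N] [Module S N'] [Module T P]

/-- Transitivity of extension of scalars with cancellation: once `M → N` is a base change, `M → P`
and `N → P` are base changes together. Most transports of quasi-coherence below rest on this. -/
lemma IsBC.comp_iff {f : R →+* S} {k : S →+* T} {l : R →+* T} (hl : l = k.comp f)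
    {g : M →ₛₗ[f] N} (hg : IsBC g) {h : N →ₛₗ[k] P} {m : M →ₛₗ[l] P} (hm : ∀ x, m x = h (g x)) :
    IsBC m ↔ IsBC h := by
  subst hl
  let := f.toAlgebra
  let := k.toAlgebra
  let := (k.comp f).toAlgebra
  have : IsScalarTower R S T := .of_algebraMap_eq fun _ => rfl
  let := Module.compHom N f
  let := Module.compHom P k
  let := Module.compHom P (k.comp f)
  have := isScalarTower_compHom (N := N) f
  have := isScalarTower_compHom (N := P) k
  have := isScalarTower_compHom (N := P) (k.comp f)
  have : IsScalarTower R S P := .of_algebraMap_smul fun r x => rfl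
  have hg : IsBaseChange S (toRestrict g) := hg
  refine Iff.trans ?_ (hg.comp_iff (T := T) (h := toRestrict h))
  refine isBC_iff _ (fun _ => rfl) _ fun x => (hm x).symm

lemma IsBC.span_range {f : R →+* S} {g : M →ₛₗ[f] N} (hg : IsBC g) :
    Submodule.span S (Set.range g) = ⊤ := by
  let := f.toAlgebra
  let := Module.compHom N f
  have := isScalarTower_compHom (N := N) f
  have hg : IsBaseChange S (toRestrict g) := hg
  rw [eq_top_iff]
  intro n _
  induction n using hg.inductionOn with
  | zero => exact zero_mem _
  | tmul m => exact Submodule.subset_span ⟨m, rfl⟩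
  | smul s n h => exact Submodule.smul_mem _ s (h trivial)
  | add x y hx hy => exact add_mem (hx trivial) (hy trivial)

lemma IsBC.hom_ext {f : R →+* S} {g : M →ₛₗ[f] N} (hg : IsBC g) {k : S →+* T}
    {φ ψ : N →ₛₗ[k] P} (h : ∀ m, φ (g m) = ψ (g m)) : φ = ψ :=
  LinearMap.ext_on hg.span_range (by rintro _ ⟨m, rfl⟩; exact h m)

lemma IsBC.exists_lift {f : R →+* S} {g : M →ₛₗ[f] N} (hg : IsBC g) (l : M →ₛₗ[f] N') :
    ∃ φ : N →ₗ[S] N', ∀ m, φ (g m) = l m := by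
  let := f.toAlgebra
  let := Module.compHom N f
  let := Module.compHom N' f
  have := isScalarTower_compHom (N := N) f
  have := isScalarTower_compHom (N := N') f
  have hg : IsBaseChange S (toRestrict g) := hg
  exact ⟨hg.lift (toRestrict l), fun m => hg.lift_eq (toRestrict l) m⟩

lemma IsBC.exists_semilinear_lift {f : R →+* S} {g : M →ₛₗ[f] N} (hg : IsBC g) {k : S →+* T}
    {l : R →+* T} (hl : l = k.comp f) (m : M →ₛₗ[l] P) :
    ∃ φ : N →ₛₗ[k] P, ∀ x, φ (g x) = m x := by
  subst hl
  let := Module.compHom P k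
  obtain ⟨φ, hφ⟩ := hg.exists_lift (N' := P)
    { toFun := m, map_add' := m.map_add, map_smul' := m.map_smulₛₗ }
  exact ⟨{ toFun := φ, map_add' := φ.map_add, map_smul' := φ.map_smul }, hφ⟩

lemma IsBC.bijective_of_bc {f : R →+* S} {g : M →ₛₗ[f] N} (hg : IsBC g) {l : M →ₛₗ[f] N'}
    (hl : IsBC l) {φ : N →ₗ[S] N'} (hφ : ∀ m, φ (g m) = l m) : Function.Bijective φ := by
  obtain ⟨ψ, hψ⟩ := hl.exists_lift g
  have h1 : ψ.comp φ = LinearMap.id := hg.hom_ext fun m => by simp [hφ, hψ]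
  have h2 : φ.comp ψ = LinearMap.id := hl.hom_ext fun m => by simp [hφ, hψ]
  exact ⟨Function.LeftInverse.injective fun x => congr($h1 x),
    Function.RightInverse.surjective fun x => congr($h2 x)⟩

lemma IsBC.of_bijective {f : R →+* S} {g : M →ₛₗ[f] N} (hg : IsBC g) {l : M →ₛₗ[f] N'}
    {φ : N →ₗ[S] N'} (hφ : ∀ m, φ (g m) = l m) (hb : Function.Bijective φ) : IsBC l := by
  let := f.toAlgebra
  let := Module.compHom N f
  let := Module.compHom N' f
  have := isScalarTower_compHom (N := N) f
  have := isScalarTower_compHom (N := N') f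
  have hg : IsBaseChange S (toRestrict g) := hg
  refine IsBaseChange.of_equiv (hg.equiv.trans (LinearEquiv.ofBijective φ hb)) fun m => ?_
  simp [hg.equiv_tmul]
  exact hφ m

/-- An isomorphism of modules over an isomorphism of rings is a base change. -/
lemma isBC_of_bijective {f : R →+* S} {g : M →ₛₗ[f] N} (hf : Function.Bijective f)
    (hg : Function.Bijective g) : IsBC g := by
  let := f.toAlgebra
  let := Module.compHom N f
  have := isScalarTower_compHom (N := N) f
  refine IsBaseChange.of_equiv (LinearEquiv.ofBijective
    (LinearMap.liftBaseChange S (toRestrict g)) (And.intro ?_ ?_)) fun m => ?_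
  rotate_right
  · exact (LinearMap.liftBaseChange_tmul S _ _ _).trans (one_smul _ _)
  · have : ∀ x : S ⊗[R] M, ∃ m : M, x = 1 ⊗ₜ m := by
      intro x
      induction x with
      | zero => exact ⟨0, by simp⟩
      | tmul s m =>
        obtain ⟨r, rfl⟩ := hf.2 s
        refine ⟨r • m, ?_⟩
        rw [TensorProduct.tmul_smul, TensorProduct.smul_tmul', Algebra.smul_def, mul_one]
        rfl
      | add x y hx hy =>
        obtain ⟨a, rfl⟩ := hx
        obtain ⟨b, rfl⟩ := hy
        exact ⟨a + b, by rw [TensorProduct.tmul_add]⟩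
    rw [injective_iff_map_eq_zero]
    intro x hx
    obtain ⟨m, rfl⟩ := this x
    have : g m = 0 := by simpa using! hx
    rw [(map_eq_zero_iff g hg.1).1 this, TensorProduct.tmul_zero]
  · intro n
    obtain ⟨m, rfl⟩ := hg.2 n
    exact ⟨1 ⊗ₜ m, by simp; rfl⟩

lemma IsBC.pi {ι : Type*} [Finite ι] {f : R →+* S} {M N : ι → Type*} [∀ i, AddCommGroup (M i)]
    [∀ i, AddCommGroup (N i)] [∀ i, Module R (M i)] [∀ i, Module S (N i)]
    {g : ∀ i, M i →ₛₗ[f] N i} (hg : ∀ i, IsBC (g i))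
    {h : (∀ i, M i) →ₛₗ[f] (∀ i, N i)} (hh : ∀ m i, h m i = g i (m i)) : IsBC h := by
  let := f.toAlgebra
  let (i : ι) := Module.compHom (N i) f
  have (i : ι) := isScalarTower_compHom (N := N i) f
  refine (isBC_iff h (fun _ => rfl) _ fun m => ?_).2
    (IsBaseChange.pi (S := S) (fun i => toRestrict (g i)) hg)
  ext i
  exact (hh m i).symm

end BaseChange

section Exact

variable {R S : Type u} [CommRing R] [CommRing S] {f : R →+* S}
variable {M₁ M₂ M₃ N₁ N₂ N₃ : Type*} [AddCommGroup M₁] [AddCommGroup M₂] [AddCommGroup M₃]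
  [AddCommGroup N₁] [AddCommGroup N₂] [AddCommGroup N₃] [Module R M₁] [Module R M₂] [Module R M₃]
  [Module S N₁] [Module S N₂] [Module S N₃]
  {h₁ : M₁ →ₛₗ[f] N₁} {h₂ : M₂ →ₛₗ[f] N₂} {h₃ : M₃ →ₛₗ[f] N₃}
  {φ : M₁ →ₗ[R] M₂} {ψ : M₂ →ₗ[R] M₃} {φ' : N₁ →ₗ[S] N₂} {ψ' : N₂ →ₗ[S] N₃}

lemma IsBC.of_right_exact (comm₁ : ∀ x, h₂ (φ x) = φ' (h₁ x)) (comm₂ : ∀ x, h₃ (ψ x) = ψ' (h₂ x))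
    (isb₁ : IsBC h₁) (isb₂ : IsBC h₂) (exact₁ : Function.Exact φ ψ)
    (surj₁ : Function.Surjective ψ) (exact₂ : Function.Exact φ' ψ')
    (surj₂ : Function.Surjective ψ') : IsBC h₃ := by
  let := f.toAlgebra
  let := Module.compHom N₁ f
  let := Module.compHom N₂ f
  let := Module.compHom N₃ f
  have := isScalarTower_compHom (N := N₁) f
  have := isScalarTower_compHom (N := N₂) f
  have := isScalarTower_compHom (N := N₃) f
  exact IsBaseChange.of_right_exact S (toRestrict h₁) (toRestrict h₂) (toRestrict h₃)
    (LinearMap.ext comm₁) (LinearMap.ext comm₂) isb₁ isb₂ exact₁ surj₁ exact₂ surj₂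

/-- Tensoring with a flat algebra preserves kernels, so the kernel of a base-changed map is the base
change of the kernel. -/
lemma IsBC.of_left_exact (hf : f.Flat) (comm₁ : ∀ x, h₂ (φ x) = φ' (h₁ x))
    (comm₂ : ∀ x, h₃ (ψ x) = ψ' (h₂ x)) (isb₂ : IsBC h₂) (isb₃ : IsBC h₃)
    (exact₁ : Function.Exact φ ψ) (inj₁ : Function.Injective φ) (exact₂ : Function.Exact φ' ψ')
    (inj₂ : Function.Injective φ') : IsBC h₁ := by
  let := f.toAlgebra
  have : Module.Flat R S := hf
  let := Module.compHom N₁ f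
  let := Module.compHom N₂ f
  let := Module.compHom N₃ f
  have := isScalarTower_compHom (N := N₁) f
  have := isScalarTower_compHom (N := N₂) f
  have := isScalarTower_compHom (N := N₃) f
  exact IsBaseChange.of_left_exact S (toRestrict h₁) (toRestrict h₂) (toRestrict h₃)
    (LinearMap.ext comm₁) (LinearMap.ext comm₂) isb₂ isb₃ exact₁ inj₁ exact₂ inj₂

/-- Flat base change preserves injectivity. -/
lemma IsBC.injective_of_flat (hf : f.Flat) (comm : ∀ x, h₂ (φ x) = φ' (h₁ x))
    (isb₁ : IsBC h₁) (isb₂ : IsBC h₂) (inj : Function.Injective φ) : Function.Injective φ' := by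
  let := f.toAlgebra
  have : Module.Flat R S := hf
  let := Module.compHom N₁ f
  let := Module.compHom N₂ f
  have := isScalarTower_compHom (N := N₁) f
  have := isScalarTower_compHom (N := N₂) f
  have isb₁ : IsBaseChange S (toRestrict h₁) := isb₁
  have isb₂ : IsBaseChange S (toRestrict h₂) := isb₂
  have key : φ'.comp isb₁.equiv.toLinearMap = isb₂.equiv.toLinearMap.comp (φ.baseChange S) := by
    ext m
    simpa [IsBaseChange.equiv_tmul] using! (comm m).symm
  have h1 : Function.Injective (φ'.comp isb₁.equiv.toLinearMap) := by
    rw [key]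
    exact isb₂.equiv.injective.comp (Module.Flat.lTensor_preserves_injective_linearMap φ inj)
  intro x y hxy
  have := @h1 (isb₁.equiv.symm x) (isb₁.equiv.symm y) (by simpa using hxy)
  simpa using this

end Exact

section Pushout

variable {A B C D : Type u} [CommRing A] [CommRing B] [CommRing C] [CommRing D]
    {f : A →+* B} {g : A →+* C} {h : B →+* D} {k : C →+* D} {w : h.comp f = k.comp g}

lemma tensorMapBijective_iff_isPushout :
    TensorMapBijective f g h k w ↔
      (letI := f.toAlgebra; letI := g.toAlgebra; letI := h.toAlgebra; letI := k.toAlgebra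
       letI := (h.comp f).toAlgebra
       haveI : IsScalarTower A B D := .of_algebraMap_eq fun _ => rfl
       haveI : IsScalarTower A C D := .of_algebraMap_eq fun a => RingHom.congr_fun w a
       Algebra.IsPushout A B C D) := by
  let := f.toAlgebra; let := g.toAlgebra; let := h.toAlgebra; let := k.toAlgebra
  let := (h.comp f).toAlgebra
  have : IsScalarTower A B D := .of_algebraMap_eq fun _ => rfl
  have : IsScalarTower A C D := .of_algebraMap_eq fun a => RingHom.congr_fun w a
  rw [Algebra.isPushout_iff]
  unfold IsBaseChange IsTensorProduct TensorMapBijective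
  refine iff_of_eq (congrArg Function.Bijective ?_)
  ext x
  induction x with
  | zero => simp
  | add x y hx hy => rw [map_add, map_add, hx, hy]
  | tmul b c => simp [Algebra.smul_def]; rfl

/-- Since `D = B ⊗_A C`, one has `M ⊗_B D = M ⊗_A C`. This turns the tensor axiom for the rings into
base change for modules. -/
lemma IsBC.of_pushout (H : TensorMapBijective f g h k w) {M N : Type*} [AddCommGroup M]
    [AddCommGroup N] [Module A M] [Module B M] (hA : ∀ (a : A) (m : M), a • m = f a • m)
    [Module C N] [Module D N] (hC : ∀ (c : C) (n : N), c • n = k c • n)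
    {φ : M →ₛₗ[h] N} (hφ : IsBC φ) {ψ : M →ₛₗ[g] N} (hψ : ∀ m, ψ m = φ m) : IsBC ψ := by
  let := f.toAlgebra; let := g.toAlgebra; let := h.toAlgebra; let := k.toAlgebra
  let := (h.comp f).toAlgebra
  have : IsScalarTower A B D := .of_algebraMap_eq fun _ => rfl
  have : IsScalarTower A C D := .of_algebraMap_eq fun a => RingHom.congr_fun w a
  have : Algebra.IsPushout A B C D := tensorMapBijective_iff_isPushout.1 H
  have : Algebra.IsPushout A C B D := this.symm
  have : IsScalarTower A B M := .of_algebraMap_smul fun a m => (hA a m).symm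
  have : IsScalarTower C D N := .of_algebraMap_smul fun c n => (hC c n).symm
  let := Module.compHom N g
  have := isScalarTower_compHom (N := N) g
  let := Module.compHom N h
  have := isScalarTower_compHom (N := N) h
  have hφ : IsBaseChange D (toRestrict φ) := hφ
  refine IsBaseChange.of_equiv ((Algebra.IsPushout.cancelBaseChange A C B D M).symm.trans
    (hφ.equiv.restrictScalars C)) fun m => ?_
  have : (Algebra.IsPushout.cancelBaseChange A C B D M).symm (1 ⊗ₜ m) = 1 ⊗ₜ m := by
    rw [LinearEquiv.symm_apply_eq, Algebra.IsPushout.cancelBaseChange_tmul]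
  simp [this, hφ.equiv_tmul]
  exact (hψ m).symm

end Pushout
end FiniteRingedSpace

end

/-! ### Faithfully flat descent along a finite family of ring maps -/

noncomputable section

namespace FiniteRingedSpace

section Descent

/-- The sequence `E → S ⊗ E → S ⊗ S ⊗ E` is exact for `S` faithfully flat over `R`. -/
lemma exists_one_tmul_of_faithfullyFlat {R S : Type*} [CommRing R] [CommRing S] [Algebra R S]
    [Module.FaithfullyFlat R S] {E : Type*} [AddCommGroup E] [Module R E] (x : S ⊗[R] E)
    (hx : (TensorProduct.mk R S (S ⊗[R] E) 1) x = (TensorProduct.mk R S E 1).lTensor S x) :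
    ∃ e : E, x = 1 ⊗ₜ e := by
  let d₀ : E →ₗ[R] S ⊗[R] E := TensorProduct.mk R S E 1
  let d₁ : S ⊗[R] E →ₗ[R] S ⊗[R] (S ⊗[R] E) :=
    TensorProduct.mk R S (S ⊗[R] E) 1 - (TensorProduct.mk R S E 1).lTensor S
  let c : S ⊗[R] (S ⊗[R] (S ⊗[R] E)) →ₗ[R] S ⊗[R] (S ⊗[R] E) :=
    (TensorProduct.map (LinearMap.mul' R S) LinearMap.id) ∘ₗ
      (TensorProduct.assoc R S S (S ⊗[R] E)).symm.toLinearMap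
  let b : S ⊗[R] (S ⊗[R] E) →ₗ[R] S ⊗[R] E :=
    (TensorProduct.map (LinearMap.mul' R S) LinearMap.id) ∘ₗ
      (TensorProduct.assoc R S S E).symm.toLinearMap
  -- After one more tensoring with `S`, multiplication of the first two factors is a contracting
  -- homotopy; faithful flatness then gives exactness of the original sequence.
  have key : c ∘ₗ d₁.lTensor S = LinearMap.id - d₀.lTensor S ∘ₗ b := by
    ext t s e
    simp [c, d₁, b, d₀]
  have hcomp : d₁ ∘ₗ d₀ = 0 := by
    ext e
    simp [d₁, d₀]
  have hex : Function.Exact (d₀.lTensor S) (d₁.lTensor S) := by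
    intro y
    constructor
    · intro hy
      refine ⟨b y, ?_⟩
      have := congr($key y)
      simp only [LinearMap.comp_apply, hy, map_zero, LinearMap.sub_apply, LinearMap.id_apply] at this
      exact (sub_eq_zero.1 this.symm).symm
    · rintro ⟨z, rfl⟩
      rw [← LinearMap.comp_apply, ← LinearMap.lTensor_comp, hcomp]
      simp
  have := (Module.FaithfullyFlat.lTensor_exact_iff_exact R S d₀ d₁).1 hex
  obtain ⟨e, he⟩ := (this x).1 (by simp [d₁, hx])
  exact ⟨e, he.symm⟩

variable {R : Type u} [CommRing R] {ι : Type u} [Finite ι] {S : ι → Type u} [∀ i, CommRing (S i)]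
  {f : ∀ i, R →+* S i}

omit [Finite ι] in
-- Each factor is a retract of the product as an `R`-module.
lemma flat_of_pi (hf : (RingHom.pi f).FaithfullyFlat) (i : ι) : (f i).Flat := by
  classical
  let := (RingHom.pi f).toAlgebra
  let := (f i).toAlgebra
  have : Module.FaithfullyFlat R (∀ i, S i) := hf
  let p : (∀ i, S i) →ₗ[R] S i :=
    { toFun := fun s => s i, map_add' := fun _ _ => rfl, map_smul' := fun _ _ => rfl }
  let j : S i →ₗ[R] (∀ i, S i) :=
    { toFun := fun s => Pi.single i s
      map_add' := fun _ _ => Pi.single_add _ _ _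
      map_smul' := fun r s => by
        ext k
        change _ = (f k r) * _
        by_cases h : k = i
        · subst h; simp [Algebra.smul_def]; rfl
        · simp [h] }
  exact Module.Flat.of_retract j p (LinearMap.ext fun x => Pi.single_eq_same (M := S) i x)

variable {E : Type*} [AddCommGroup E] [Module R E] {E₁ : ι → Type*} [∀ i, AddCommGroup (E₁ i)]
  [∀ i, Module (S i) (E₁ i)] {e : ∀ i, E →ₛₗ[f i] E₁ i}

/-- Base change to a finite product of rings. -/
lemma exists_equiv_pi (he : ∀ i, IsBC (e i)) :
    letI := (RingHom.pi f).toAlgebra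
    ∃ φ : ((∀ i, S i) ⊗[R] E) ≃+ (∀ i, E₁ i), ∀ s x i, φ (s ⊗ₜ x) i = s i • e i x := by
  classical
  cases nonempty_fintype ι
  let (i : ι) := (f i).toAlgebra
  let (i : ι) := Module.compHom (E₁ i) (f i)
  have (i : ι) := isScalarTower_compHom (N := E₁ i) (f i)
  have he (i : ι) : IsBaseChange (S i) (toRestrict (e i)) := he i
  refine ⟨((TensorProduct.piLeft R E S).toAddEquiv.trans
    (AddEquiv.piCongrRight fun i => (he i).equiv.toAddEquiv)), fun s x i => ?_⟩
  simp
  exact (he i).equiv_tmul _ _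

lemma eq_zero_of_faithfullyFlat (hf : (RingHom.pi f).FaithfullyFlat) (he : ∀ i, IsBC (e i)) {x : E}
    (hx : ∀ i, e i x = 0) : x = 0 := by
  let := (RingHom.pi f).toAlgebra
  have : Module.FaithfullyFlat R (∀ i, S i) := hf
  obtain ⟨φ, hφ⟩ := exists_equiv_pi he
  rw [← Module.FaithfullyFlat.one_tmul_eq_zero_iff R E x (A := ∀ i, S i)]
  apply φ.injective
  ext i
  rw [hφ, hx, map_zero]
  simp

variable {E' : Type u} [AddCommGroup E'] [Module R E'] {E₁' : ι → Type*}
  [∀ i, AddCommGroup (E₁' i)] [∀ i, Module (S i) (E₁' i)] {e' : ∀ i, E' →ₛₗ[f i] E₁' i}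

/-- The cokernel of `φ` vanishes after each base change: the map from `E₁' i` to the extended
cokernel kills the image of `φ₁ i`, which is everything. -/
lemma surjective_of_faithfullyFlat (hf : (RingHom.pi f).FaithfullyFlat) (he : ∀ i, IsBC (e i))
    (he' : ∀ i, IsBC (e' i)) {φ : E →ₗ[R] E'} {φ₁ : ∀ i, E₁ i →ₗ[S i] E₁' i}
    (comm : ∀ i x, e' i (φ x) = φ₁ i (e i x)) (h : ∀ i, Function.Surjective (φ₁ i)) :
    Function.Surjective φ := by
  rw [← LinearMap.range_eq_top, ← Submodule.Quotient.subsingleton_iff]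
  refine subsingleton_of_forall_eq 0 fun c => ?_
  obtain ⟨x, rfl⟩ := Submodule.Quotient.mk_surjective _ c
  refine eq_zero_of_faithfullyFlat hf (fun i => Extend.isBC (M := E' ⧸ LinearMap.range φ) (f i))
    fun i => ?_
  obtain ⟨χ, hχ⟩ := (he' i).exists_lift (N' := Extend (f i) (E' ⧸ LinearMap.range φ))
    { toFun := fun y => Extend.mk (E' ⧸ LinearMap.range φ) (f i) (Submodule.Quotient.mk y)
      map_add' := fun y z => by rw [Submodule.Quotient.mk_add, map_add]
      map_smul' := fun r y => by rw [Submodule.Quotient.mk_smul, map_smulₛₗ] }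
  have h0 : χ.comp (φ₁ i) = 0 := by
    refine (he i).hom_ext fun m => ?_
    rw [LinearMap.comp_apply, ← comm, hχ]
    have : (Submodule.Quotient.mk (φ m) : E' ⧸ LinearMap.range φ) = 0 :=
      (Submodule.Quotient.mk_eq_zero _).2 ⟨m, rfl⟩
    simp [this]
  obtain ⟨z, hz⟩ := h i (e' i x)
  refine (hχ x).symm.trans ?_
  rw [← hz]
  exact congr($h0 z)

variable [∀ i, Module R (E₁ i)] {E₂ : ι → ι → Type*} [∀ i j, AddCommGroup (E₂ i j)]
  [∀ i j, Module (S i) (E₂ i j)] {q : ∀ i j, E₁ j →ₛₗ[f i] E₂ i j} {p : ∀ i j, E₁ i →ₗ[S i] E₂ i j}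

/-- Faithfully flat descent for elements of a module, along a finite family of ring maps. -/
lemma exists_eq_of_faithfullyFlat (hf : (RingHom.pi f).FaithfullyFlat) (he : ∀ i, IsBC (e i))
    (hR : ∀ i (r : R) (m : E₁ i), r • m = f i r • m) (hq : ∀ i j, IsBC (q i j))
    (hpq : ∀ i j x, p i j (e i x) = q i j (e j x)) (m : ∀ i, E₁ i)
    (hm : ∀ i j, p i j (m i) = q i j (m j)) : ∃ x, ∀ i, e i x = m i := by
  let := (RingHom.pi f).toAlgebra
  have : Module.FaithfullyFlat R (∀ i, S i) := hf
  obtain ⟨φ, hφ⟩ := exists_equiv_pi he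
  have hadd : ∀ i (r : R) (x : (∀ i, S i) ⊗[R] E), φ (r • x) i = r • φ x i := by
    intro i r x
    induction x with
    | zero => simp
    | add x y hx hy => rw [smul_add, map_add, Pi.add_apply, hx, hy, map_add, Pi.add_apply, smul_add]
    | tmul s y =>
      rw [TensorProduct.smul_tmul', hφ, hφ, hR, smul_smul]
      rfl
  let φ' : ((∀ i, S i) ⊗[R] E) ≃ₗ[R] (∀ i, E₁ i) :=
    φ.toLinearEquiv fun r x => funext fun i => hadd i r x
  let Q (i : ι) : ((∀ i, S i) ⊗[R] E) →ₛₗ[f i] (∀ j, E₂ i j) :=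
    { toFun := fun x j => q i j (φ' x j)
      map_add' := fun x y => by ext j; simp
      map_smul' := fun r x => by ext j; simp }
  have hQ (i : ι) : IsBC (Q i) := by
    have h : IsBC ({ toFun := fun x j => q i j (x j)
                     map_add' := fun x y => by ext j; simp
                     map_smul' := fun r x => by ext j; simp } :
                  (∀ j, E₁ j) →ₛₗ[f i] (∀ j, E₂ i j)) := IsBC.pi (hq i) fun _ _ => rfl
    refine (IsBC.comp_iff (f := RingHom.id R) (k := f i) (by simp) (g := φ'.toLinearMap) ?_ (h := _)
      fun x => rfl).2 h
    exact isBC_of_bijective Function.bijective_id φ'.bijective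
  -- With `S = ∏ S i`, this identifies `S ⊗ (S ⊗ E)` with the double product of the `E₂ i j`. The
  -- two maps of the descent sequence become `q i j` on the component `j` and `p i j` on the
  -- component `i`, so `hm` is the cocycle condition for `m`.
  obtain ⟨Φ, hΦ⟩ := exists_equiv_pi hQ
  obtain ⟨x, hx⟩ := exists_one_tmul_of_faithfullyFlat (φ'.symm m) (by
    apply Φ.injective
    ext i j
    have h1 : ∀ y, Φ ((TensorProduct.mk R (∀ i, S i) E 1).lTensor (∀ i, S i) y) i j =
        p i j (φ' y i) := by
      intro y
      induction y with
      | zero => simp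
      | add a b ha hb => simp only [map_add, Pi.add_apply, ha, hb]
      | tmul s y =>
        rw [LinearMap.lTensor_tmul, hΦ]
        change s i • q i j (φ _ j) = p i j (φ _ i)
        rw [TensorProduct.mk_apply, hφ, hφ]
        simp [hpq]
    rw [h1, TensorProduct.mk_apply, hΦ]
    change (1 : S i) • q i j (φ' (φ'.symm m) j) = _
    simp [hm])
  refine ⟨x, fun i => ?_⟩
  have := congr(φ' $hx i)
  rw [LinearEquiv.apply_symm_apply] at this
  rw [this]
  exact ((hφ 1 x i).trans (one_smul _ _)).symm

end Descent
end FiniteRingedSpace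

end

/-! ### Modules given by stalks and specialization maps -/

noncomputable section

namespace FiniteRingedSpace

section Stalkwise

variable {X : AlgebraicGeometry.RingedSpace.{u, u}}

lemma res_res {U V W : Opens X} (h : U ≤ V) (h' : V ≤ W) (s : X.presheaf.obj (op W)) :
    res X h (res X h' s) = res X (h.trans h') s :=
  RingHom.congr_fun (res_comp_res X h h') s

lemma res_self {U : Opens X} (h : U ≤ U) (s : X.presheaf.obj (op U)) : res X h s = s := by
  have : X.presheaf.map (homOfLE h).op = 𝟙 _ := X.presheaf.map_id _
  rw [res, this]; rfl

lemma res_bijective_of_le {U V : Opens X} (h : U ≤ V) (h' : V ≤ U) :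
    Function.Bijective (res X h) :=
  Function.bijective_iff_has_inverse.2 ⟨res X h', fun s => by rw [res_res, res_self],
    fun s => by rw [res_res, res_self]⟩

lemma mem_left {U V : Opens X} {x : X} (h : x ∈ U ⊓ V) : x ∈ U := h.1

lemma mem_right {U V : Opens X} {x : X} (h : x ∈ U ⊓ V) : x ∈ V := h.2

lemma mem_inf {U V : Opens X} {x : X} (h : x ∈ U) (h' : x ∈ V) : x ∈ U ⊓ V := ⟨h, h'⟩

variable [Finite X]

lemma minOpen_le_minOpen {x y z : X} (h : y ∈ minOpen X x) (h' : z ∈ minOpen X y) :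
    z ∈ minOpen X x :=
  minOpen_le h h'

variable (X) in
/-- A module on a finite ringed space, given by its stalks and the specialization maps. -/
structure StalkMod where
  /-- the stalks -/
  obj : X → Type u
  [addCommGroup : ∀ x, AddCommGroup (obj x)]
  [module : ∀ x, Module (stalkRing X x) (obj x)]
  /-- the specialization maps -/
  map : ∀ {x y : X} (h : y ∈ minOpen X x), obj x →ₛₗ[res X (minOpen_le h)] obj y
  map_self : ∀ {x : X} (h : x ∈ minOpen X x) (m : obj x), map h m = m
  map_map : ∀ {x y z : X} (h : y ∈ minOpen X x) (h' : z ∈ minOpen X y) (m : obj x),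
    map h' (map h m) = map (minOpen_le_minOpen h h') m

namespace StalkMod

attribute [instance] StalkMod.addCommGroup StalkMod.module

variable (M N P : StalkMod X)

/-- Homomorphisms of modules given by stalks. -/
structure Hom (M N : StalkMod X) where
  /-- the maps on stalks -/
  app : ∀ x, M.obj x →ₗ[stalkRing X x] N.obj x
  naturality : ∀ {x y : X} (h : y ∈ minOpen X x) (m : M.obj x),
    app y (M.map h m) = N.map h (app x m)

/-- The composition of homomorphisms. -/
def Hom.comp {M N P : StalkMod X} (g : Hom N P) (f : Hom M N) : Hom M P where
  app x := (g.app x).comp (f.app x)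
  naturality h m := by simp [f.naturality, g.naturality]

/-- Compatible families of germs. -/
def compatible (V : Opens X) : AddSubgroup (∀ x : V, M.obj x) where
  carrier := {s | ∀ (x y : V) (h : y.1 ∈ minOpen X x.1), M.map h (s x) = s y}
  zero_mem' x y h := map_zero _
  add_mem' hs ht x y h := by simp [hs x y h, ht x y h]
  neg_mem' hs x y h := by simp [hs x y h]

variable {U V W U' V' W' : Opens X}

/-- The sections of a module over an open set `V`, regarded as a module over the sections of the
structure sheaf on a larger open set `U`. -/
def Sec (_ : V ≤ U) : Type u := M.compatible V

variable {M N P}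

instance (h : V ≤ U) : AddCommGroup (M.Sec h) := inferInstanceAs (AddCommGroup (M.compatible V))

namespace Sec

/-- The value of a section at a point. -/
def val {h : V ≤ U} (s : M.Sec h) {x : X} (hx : x ∈ V) : M.obj x :=
  (show M.compatible V from s).1 ⟨x, hx⟩

lemma map_val {h : V ≤ U} (s : M.Sec h) {x y : X} (hx : x ∈ V) (hy : y ∈ minOpen X x) :
    M.map hy (s.val hx) = s.val (minOpen_le hx hy) :=
  (show M.compatible V from s).2 ⟨x, hx⟩ ⟨y, minOpen_le hx hy⟩ hy

@[ext] lemma ext {h : V ≤ U} {s t : M.Sec h} (hst : ∀ x (hx : x ∈ V), s.val hx = t.val hx) :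
    s = t :=
  Subtype.ext (funext fun x => hst x.1 x.2)

/-- A section from a compatible family. -/
def mk (h : V ≤ U) (s : ∀ x ∈ V, M.obj x)
    (hs : ∀ x (hx : x ∈ V) y (hy : y ∈ minOpen X x), M.map hy (s x hx) = s y (minOpen_le hx hy)) :
    M.Sec h :=
  ⟨fun x => s x.1 x.2, fun x y hy => hs x.1 x.2 y.1 hy⟩

@[simp] lemma val_mk (h : V ≤ U) (s : ∀ x ∈ V, M.obj x) (hs) {x : X} (hx : x ∈ V) :
    (mk h s hs).val hx = s x hx := rfl

@[simp] lemma val_zero {h : V ≤ U} {x : X} (hx : x ∈ V) : (0 : M.Sec h).val hx = 0 := rfl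

@[simp] lemma val_add {h : V ≤ U} (s t : M.Sec h) {x : X} (hx : x ∈ V) :
    (s + t).val hx = s.val hx + t.val hx := rfl

@[simp] lemma val_sub {h : V ≤ U} (s t : M.Sec h) {x : X} (hx : x ∈ V) :
    (s - t).val hx = s.val hx - t.val hx := rfl

instance (h : V ≤ U) : Module (X.presheaf.obj (op U)) (M.Sec h) where
  smul r s := mk h (fun x hx => res X ((minOpen_le hx).trans h) r • s.val hx) fun x hx y hy => by
    rw [map_smulₛₗ, map_val, res_res]
  one_smul s := ext fun x hx => by
    change res X _ 1 • s.val hx = s.val hx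
    simp
  mul_smul a b s := ext fun x hx => by
    change res X _ (a * b) • s.val hx = res X _ a • res X _ b • s.val hx
    simp [mul_smul]
  smul_zero a := ext fun x hx => by
    change res X _ a • (0 : M.obj x) = 0
    simp
  smul_add a s t := ext fun x hx => by
    have hx' : minOpen X x ≤ U := (minOpen_le hx).trans h
    change res X hx' a • (s.val hx + t.val hx) = res X hx' a • s.val hx + res X hx' a • t.val hx
    simp
  add_smul a b s := ext fun x hx => by
    have hx' : minOpen X x ≤ U := (minOpen_le hx).trans h
    change res X hx' (a + b) • s.val hx = res X hx' a • s.val hx + res X hx' b • s.val hx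
    simp [add_smul]
  zero_smul s := ext fun x hx => by
    change res X _ 0 • s.val hx = 0
    simp

@[simp] lemma val_smul {h : V ≤ U} (r : X.presheaf.obj (op U)) (s : M.Sec h) {x : X} (hx : x ∈ V) :
    (r • s).val hx = res X ((minOpen_le hx).trans h) r • s.val hx := rfl

/-- The germ of a section at a point. -/
def germ (h : V ≤ U) {x : X} (hx : x ∈ V) :
    M.Sec h →ₛₗ[res X ((minOpen_le hx).trans h)] M.obj x where
  toFun s := s.val hx
  map_add' _ _ := rfl
  map_smul' _ _ := rfl

/-- A semilinear map into sections, given by compatible maps to the stalks. -/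
def lift {R : Type*} [CommRing R] {E : Type*} [AddCommGroup E] [Module R E] (h : V ≤ U)
    (f : R →+* X.presheaf.obj (op U)) (e : ∀ x ∈ V, E → M.obj x)
    (hadd : ∀ x hx a b, e x hx (a + b) = e x hx a + e x hx b)
    (hsmul : ∀ x hx r a, e x hx (r • a) = res X ((minOpen_le hx).trans h) (f r) • e x hx a)
    (he : ∀ x (hx : x ∈ V) y (hy : y ∈ minOpen X x) a,
      M.map hy (e x hx a) = e y (minOpen_le hx hy) a) : E →ₛₗ[f] M.Sec h where
  toFun a := mk h (fun x hx => e x hx a) fun x hx y hy => he x hx y hy a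
  map_add' a b := ext fun x hx => by simp [hadd]
  map_smul' r a := ext fun x hx => by simp [hsmul]

/-- Restriction of sections. -/
def restrict (h : V ≤ U) (h' : V' ≤ U') (hU : U' ≤ U) (hV : V' ≤ V) :
    M.Sec h →ₛₗ[res X hU] M.Sec h' :=
  lift h' (res X hU) (fun _ hx s => s.val (hV hx)) (fun _ _ _ _ => rfl)
    (fun _ _ _ _ => by rw [val_smul, res_res]) fun _ _ _ _ _ => map_val _ _ _

/-- Change of the open subset over which sections are considered, over a fixed base. -/
def restrictₗ (h : V ≤ U) (h' : V' ≤ U) (hV : V' ≤ V) :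
    M.Sec h →ₗ[X.presheaf.obj (op U)] M.Sec h' :=
  lift h' (RingHom.id _) (fun _ hx s => s.val (hV hx)) (fun _ _ _ _ => rfl)
    (fun _ _ _ _ => rfl) fun _ _ _ _ _ => map_val _ _ _

@[simp] lemma val_restrictₗ (h : V ≤ U) (h' : V' ≤ U) (hV : V' ≤ V) (s : M.Sec h)
    {x : X} (hx : x ∈ V') : (restrictₗ h h' hV s).val hx = s.val (hV hx) := rfl

/-- The map on sections induced by a homomorphism. -/
def map (f : Hom M N) (h : V ≤ U) : M.Sec h →ₗ[X.presheaf.obj (op U)] N.Sec h :=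
  lift h (RingHom.id _) (fun x hx s => f.app x (s.val hx)) (by simp) (by simp) fun x hx y hy s => by
    rw [← f.naturality, map_val]

@[simp] lemma val_map (f : Hom M N) (h : V ≤ U) (s : M.Sec h) {x : X} (hx : x ∈ V) :
    (map f h s).val hx = f.app x (s.val hx) := rfl

/-- The section over an open subset of `U_x` defined by an element of the stalk at `x`. -/
def ofObj {x : X} (h : V ≤ U) (hU : U ≤ minOpen X x) :
    M.obj x →ₛₗ[res X hU] M.Sec h :=
  lift h (res X hU) (fun y hy m => M.map (hU (h hy)) m) (by simp)
    (fun y hy r m => by rw [map_smulₛₗ, res_res]) fun y hy z hz m => M.map_map _ _ _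

@[simp] lemma val_ofObj {x : X} (h : V ≤ U) (hU : U ≤ minOpen X x) (m : M.obj x) {y : X}
    (hy : y ∈ V) : (ofObj h hU m).val hy = M.map (hU (h hy)) m := rfl

lemma eq_map_of_mem {h : V ≤ U} (s : M.Sec h) {x : X} (hx : x ∈ V) {y : X}
    (hy : y ∈ minOpen X x) : s.val (minOpen_le hx hy) = M.map hy (s.val hx) := (map_val _ _ _).symm

/-- From `x ∈ V ≤ U ≤ U_x` all three open sets agree, and a section over `U_x` is determined by its
germ at `x`. -/
lemma bijective_ofObj {x : X} (h : V ≤ U) (hU : U ≤ minOpen X x) (hx : x ∈ V) :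
    Function.Bijective (ofObj (M := M) h hU) := by
  constructor
  · intro a b hab
    have := congr(Sec.val $hab hx)
    simpa [M.map_self] using this
  · intro s
    refine ⟨s.val hx, ext fun y hy => ?_⟩
    rw [val_ofObj, map_val]

end Sec

/-- The module `T_V M` with `Γ(W, T_V M) = Γ(W ∩ V, M)`. -/
def trunc (M : StalkMod X) (V : Opens X) : StalkMod X where
  obj y := M.Sec (inf_le_left : minOpen X y ⊓ V ≤ minOpen X y)
  map h := Sec.restrict _ _ (minOpen_le h) (inf_le_inf_right _ (minOpen_le h))
  map_self _ _ := rfl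
  map_map _ _ _ := rfl

/-- The values of an element of a stalk of the truncation. -/
def truncVal {V : Opens X} {y : X} (s : (M.trunc V).obj y) {x : X} (hx : x ∈ minOpen X y ⊓ V) :
    M.obj x :=
  Sec.val (h := inf_le_left) s hx

lemma trunc_ext {V : Opens X} {y : X} {s t : (M.trunc V).obj y}
    (h : ∀ x (hx : x ∈ minOpen X y ⊓ V), truncVal s hx = truncVal t hx) : s = t :=
  Sec.ext (h := inf_le_left) h

@[simp] lemma truncVal_map {V : Opens X} {y z : X} (h : z ∈ minOpen X y) (s : (M.trunc V).obj y)
    {x : X} (hx : x ∈ minOpen X z ⊓ V) :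
    truncVal ((M.trunc V).map h s) hx = truncVal s (mem_inf (minOpen_le h (mem_left hx)) (mem_right hx)) := rfl

lemma map_truncVal {V : Opens X} {y : X} (s : (M.trunc V).obj y) {x z : X}
    (hx : x ∈ minOpen X y ⊓ V) (hz : z ∈ minOpen X x) :
    M.map hz (truncVal s hx) = truncVal s (minOpen_le hx hz) :=
  Sec.map_val (h := inf_le_left) s hx hz

/-- The restriction homomorphism to the truncation. -/
def toTrunc (M : StalkMod X) (V : Opens X) : Hom M (M.trunc V) where
  app y := Sec.lift _ (RingHom.id _) (fun x hx m => M.map (mem_left hx) m) (by simp) (by simp)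
    fun x hx y hy m => M.map_map _ _ _
  naturality h m := trunc_ext fun x hx => M.map_map _ _ _

@[simp] lemma truncVal_toTrunc (M : StalkMod X) (V : Opens X) {y : X} (m : M.obj y) {x : X}
    (hx : x ∈ minOpen X y ⊓ V) : truncVal ((M.toTrunc V).app y m) hx = M.map (mem_left hx) m := rfl

/-- Functoriality of truncation. -/
def Hom.trunc (f : Hom M N) (V : Opens X) : Hom (M.trunc V) (N.trunc V) where
  app _ := Sec.map f _
  naturality _ _ := rfl

/-- Sections of the truncation. -/
def truncSec (M : StalkMod X) (V : Opens X) (h : W ≤ U) (h' : W' ≤ U) (hW : W ⊓ V = W') :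
    M.Sec h' →ₗ[X.presheaf.obj (op U)] (M.trunc V).Sec h :=
  Sec.lift h (RingHom.id _)
    (fun _ hy s => Sec.restrict h' inf_le_left ((minOpen_le hy).trans h)
      ((inf_le_inf_right _ (minOpen_le hy)).trans hW.le) s)
    (fun _ _ _ _ => rfl) (fun _ _ _ _ => map_smulₛₗ _ _ _) fun _ _ _ _ _ => rfl

/-- A section of the truncation is a compatible family of sections over the `U_y ∩ V`; its diagonal
germs recover a section over `W ∩ V`. -/
lemma bijective_truncSec (M : StalkMod X) (V : Opens X) (h : W ≤ U) (h' : W' ≤ U) (hW : W ⊓ V = W') :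
    Function.Bijective (M.truncSec V h h' hW) := by
  subst hW
  constructor
  · intro s t hst
    ext x hx
    exact congr(truncVal (Sec.val $hst (mem_left hx)) ((mem_inf (mem_minOpen x) (mem_right hx)) : x ∈ minOpen X x ⊓ V))
  · intro s
    have key : ∀ x (hx : x ∈ W) y (hy : y ∈ minOpen X x ⊓ V),
        truncVal (s.val hx) hy = truncVal (s.val (minOpen_le hx (mem_left hy))) (mem_inf (mem_minOpen y) (mem_right hy)) := by
      intro x hx y hy
      rw [← Sec.map_val s hx (mem_left hy), truncVal_map]
    refine ⟨Sec.mk h' (fun x hx => truncVal (s.val (mem_left hx)) (mem_inf (mem_minOpen x) (mem_right hx)))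
      fun x hx y hy => ?_, ?_⟩
    · rw [map_truncVal, key]
    · exact Sec.ext fun x hx => trunc_ext fun y hy => (key x hx y hy).symm

/-! ### Submodules and quotients -/

/-- A submodule of a module given by stalks. -/
structure Sub (M : StalkMod X) where
  /-- the stalks -/
  carrier : ∀ x, Submodule (stalkRing X x) (M.obj x)
  map_mem : ∀ {x y : X} (h : y ∈ minOpen X x) {m : M.obj x}, m ∈ carrier x → M.map h m ∈ carrier y

namespace Sub

variable (L : Sub M)

/-- A submodule as a module. -/
def toMod : StalkMod X where
  obj x := L.carrier x
  map h :=
    { toFun := fun m => ⟨M.map h m.1, L.map_mem h m.2⟩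
      map_add' := fun a b => by ext; simp
      map_smul' := fun a b => by ext; simp }
  map_self h m := Subtype.ext (M.map_self h _)
  map_map h h' m := Subtype.ext (M.map_map h h' _)

/-- The inclusion of a submodule. -/
def incl : Hom L.toMod M where
  app x := (L.carrier x).subtype
  naturality _ _ := rfl

lemma incl_injective (x : X) : Function.Injective (L.incl.app x) := Subtype.val_injective

/-- The quotient by a submodule. -/
def quot : StalkMod X where
  obj x := M.obj x ⧸ L.carrier x
  map {x y} h := Submodule.mapQ (L.carrier x) (L.carrier y) (M.map h) fun _ hm => L.map_mem h hm
  map_self h m := by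
    obtain ⟨m, rfl⟩ := Submodule.Quotient.mk_surjective _ m
    simp [M.map_self]
  map_map h h' m := by
    obtain ⟨m, rfl⟩ := Submodule.Quotient.mk_surjective _ m
    simp [M.map_map]

/-- The projection to the quotient. -/
def proj : Hom M L.quot where
  app x := (L.carrier x).mkQ
  naturality _ _ := rfl

lemma proj_surjective (x : X) : Function.Surjective (L.proj.app x) :=
  Submodule.Quotient.mk_surjective _

lemma proj_eq_zero_iff {x : X} (m : M.obj x) : L.proj.app x m = 0 ↔ m ∈ L.carrier x :=
  Submodule.Quotient.mk_eq_zero _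

end Sub

/-- The kernel of a homomorphism. -/
def Hom.ker (f : Hom M N) : Sub M where
  carrier x := LinearMap.ker (f.app x)
  map_mem h m hm := by
    rw [LinearMap.mem_ker] at hm ⊢
    rw [f.naturality, hm, map_zero]

/-- The range of a homomorphism. -/
def Hom.range (f : Hom M N) : Sub N where
  carrier x := LinearMap.range (f.app x)
  map_mem := by
    rintro x y h _ ⟨m, rfl⟩
    exact ⟨M.map h m, f.naturality h m⟩

/-- The submodule generated by a submodule of the stalk at `y`. -/
def spanAt (M : StalkMod X) {y : X} (L : Submodule (stalkRing X y) (M.obj y)) : Sub M where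
  carrier x := Submodule.span _ {m | ∃ (h : x ∈ minOpen X y) (l : M.obj y), l ∈ L ∧ M.map h l = m}
  map_mem {x z} h m hm := by
    induction hm using Submodule.span_induction with
    | mem m hm =>
      obtain ⟨hx, l, hl, rfl⟩ := hm
      exact Submodule.subset_span ⟨minOpen_le_minOpen hx h, l, hl, (M.map_map _ _ _).symm⟩
    | zero => simp
    | add a b _ _ ha hb => rw [map_add]; exact add_mem ha hb
    | smul r a _ ha => rw [map_smulₛₗ]; exact Submodule.smul_mem _ _ ha

/-! ### Quasi-coherence -/

/-- `M` is quasi-coherent on `W`. -/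
def QCOn (W : Opens X) (M : StalkMod X) : Prop :=
  ∀ x ∈ W, ∀ y (h : y ∈ minOpen X x), IsBC (M.map h)

/-- `M` is quasi-coherent. -/
abbrev QC (M : StalkMod X) : Prop := QCOn ⊤ M

lemma QC.on (h : QC M) (W : Opens X) : QCOn W M := fun x _ => h x trivial

/-- The structure sheaf as a module given by stalks. -/
def unit (X : AlgebraicGeometry.RingedSpace.{u, u}) [Finite X] : StalkMod X where
  obj x := stalkRing X x
  map h := (res X (minOpen_le h)).toSemilinearMap
  map_self _ _ := res_self _ _
  map_map _ _ _ := res_res _ _ _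

/-- The free module on a set. -/
def free (X : AlgebraicGeometry.RingedSpace.{u, u}) [Finite X] (I : Type u) : StalkMod X where
  obj x := I →₀ stalkRing X x
  map h :=
    { toFun := Finsupp.mapRange (res X (minOpen_le h)) (map_zero _)
      map_add' := fun a b => by ext; simp
      map_smul' := fun a b => by ext; simp }
  map_self h m := Finsupp.ext fun i => res_self _ _
  map_map h h' m := Finsupp.ext fun i => res_res _ _ _

lemma isBC_ringHom {R S : Type u} [CommRing R] [CommRing S] (f : R →+* S) :
    IsBC (f.toSemilinearMap) := by
  let := f.toAlgebra
  exact (isBC_iff f.toSemilinearMap (fun _ => rfl) _ fun m => rfl).2 (IsBaseChange.linearMap R S)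

lemma isBC_mapRange {R S : Type u} [CommRing R] [CommRing S] (f : R →+* S) {I : Type u}
    {g : (I →₀ R) →ₛₗ[f] (I →₀ S)} (hg : ∀ a i, g a i = f (a i)) : IsBC g := by
  let := f.toAlgebra
  exact (isBC_iff g (fun _ => rfl) _ fun m => Finsupp.ext fun i => (hg m i).symm).2
    ((IsBaseChange.linearMap R S).finsuppPow I)

lemma QC.unit : QC (unit X) := fun _ _ _ _ => isBC_ringHom _

lemma QC.free (I : Type u) : QC (free X I) := fun _ _ _ h => isBC_mapRange (res X (minOpen_le h)) fun _ _ => rfl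

end StalkMod
end Stalkwise
end FiniteRingedSpace

end

/-! ### Sections of quasi-coherent modules and affine open sets -/

noncomputable section

namespace FiniteRingedSpace

section Affine

/-- The map `B ⊗_A C → D` factors through the surjection `B ⊗_A C → B ⊗_{A'} C`; if the composite is
bijective, so is the second factor. This passes the tensor axiom from an affine open to a smaller
one. -/
lemma TensorMapBijective.cancel {A A' B C D : Type u} [CommRing A] [CommRing A'] [CommRing B]
    [CommRing C] [CommRing D] {f : A →+* B} {g : A →+* C} {h : B →+* D} {k : C →+* D}
    {w : h.comp f = k.comp g} (H : TensorMapBijective f g h k w) (i : A →+* A') {f' : A' →+* B}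
    {g' : A' →+* C} (w' : h.comp f' = k.comp g') (hf : f = f'.comp i) (hg : g = g'.comp i) :
    TensorMapBijective f' g' h k w' := by
  subst hf hg
  unfold TensorMapBijective at *
  constructor
  · let : Algebra A A' := i.toAlgebra
    let : Algebra A B := (f'.comp i).toAlgebra
    let : Algebra A C := (g'.comp i).toAlgebra
    let : Algebra A D := (h.comp (f'.comp i)).toAlgebra
    let : Algebra A' B := f'.toAlgebra
    let : Algebra A' C := g'.toAlgebra
    let : Algebra A' D := (h.comp f').toAlgebra
    have : IsScalarTower A A' B := .of_algebraMap_eq fun _ => rfl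
    have : IsScalarTower A A' C := .of_algebraMap_eq fun _ => rfl
    let p : B ⊗[A] C →+ B ⊗[A'] C := TensorProduct.liftAddHom
      { toFun := fun b => { toFun := fun c => b ⊗ₜ c
                            map_zero' := TensorProduct.tmul_zero _ _
                            map_add' := TensorProduct.tmul_add _ }
        map_zero' := by ext c; exact TensorProduct.zero_tmul _ _
        map_add' := fun a b => by ext c; exact TensorProduct.add_tmul _ _ _ }
      (fun r b c => by
        change (r • b) ⊗ₜ[A'] c = b ⊗ₜ[A'] (r • c)
        rw [← algebraMap_smul A' r b, ← algebraMap_smul A' r c, TensorProduct.smul_tmul])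
    have hp : ∀ x : B ⊗[A'] C, ∃ y, p y = x := by
      intro x
      induction x with
      | zero => exact ⟨0, map_zero _⟩
      | tmul b c => exact ⟨b ⊗ₜ c, rfl⟩
      | add a b ha hb =>
        obtain ⟨a, rfl⟩ := ha
        obtain ⟨b, rfl⟩ := hb
        exact ⟨a + b, map_add _ _ _⟩
    intro x y hxy
    obtain ⟨x, rfl⟩ := hp x
    obtain ⟨y, rfl⟩ := hp y
    congr 1
    apply H.1
    have key : ∀ z, (Algebra.TensorProduct.productMap (⟨h, fun _ => rfl⟩ : B →ₐ[A'] D)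
        (⟨k, fun a => (RingHom.congr_fun w' a).symm⟩ : C →ₐ[A'] D)) (p z) =
      (Algebra.TensorProduct.productMap (⟨h, fun _ => rfl⟩ : B →ₐ[A] D)
        (⟨k, fun a => (RingHom.congr_fun w a).symm⟩ : C →ₐ[A] D)) z := by
      intro z
      induction z with
      | zero => rw [map_zero, map_zero, map_zero]
      | tmul b c => rfl
      | add a b ha hb => rw [map_add, map_add, map_add, ha, hb]
    exact (key x).symm.trans (hxy.trans (key y))
  · intro d
    obtain ⟨x, rfl⟩ := H.2 d
    let : Algebra A B := (f'.comp i).toAlgebra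
    let : Algebra A C := (g'.comp i).toAlgebra
    let : Algebra A D := (h.comp (f'.comp i)).toAlgebra
    let : Algebra A' B := f'.toAlgebra
    let : Algebra A' C := g'.toAlgebra
    let : Algebra A' D := (h.comp f').toAlgebra
    induction x with
    | zero => exact ⟨0, by rw [map_zero, map_zero]⟩
    | tmul b c => exact ⟨b ⊗ₜ c, rfl⟩
    | add a b ha hb =>
      obtain ⟨a', ha⟩ := ha
      obtain ⟨b', hb⟩ := hb
      exact ⟨a' + b', by rw [map_add, map_add, ha, hb]⟩

variable {X : AlgebraicGeometry.RingedSpace.{u, u}} [Finite X] {U V W : Opens X}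

open StalkMod

namespace IsAffineOpen

lemma mono (hU : IsAffineOpen X U) (h : V ≤ U) (hV : (toProdStalks X V).FaithfullyFlat) :
    IsAffineOpen X V where
  faithfullyFlat := hV
  tensor x y hx hy := (hU.tensor x y (h hx) (h hy)).cancel (res X h) _
    (res_comp_res X _ _).symm (res_comp_res X _ _).symm
  faithfullyFlat_inf x hx y hy := hU.faithfullyFlat_inf x (h hx) y (h hy)

lemma inf_minOpen (hU : IsAffineOpen X U) {x y : X} (hx : x ∈ U) (hy : y ∈ U) :
    IsAffineOpen X (minOpen X x ⊓ minOpen X y) :=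
  hU.mono (inf_le_left.trans (minOpen_le hx)) (hU.faithfullyFlat_inf x hx y hy)

lemma minimal (hU : IsAffineOpen X U) {x : X} (hx : x ∈ U) : IsAffineOpen X (minOpen X x) := by
  simpa using hU.inf_minOpen hx hx

lemma flat (hU : IsAffineOpen X U) {x : X} (hx : x ∈ U) : (res X (minOpen_le hx)).Flat :=
  flat_of_pi (f := fun z : U => res X (minOpen_le z.2)) hU.faithfullyFlat ⟨x, hx⟩

section

variable {M : StalkMod X} {E : Type u} [AddCommGroup E] [Module (X.presheaf.obj (op U)) E]
  {e : ∀ x (hx : x ∈ U), E →ₛₗ[res X (minOpen_le hx)] M.obj x}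

lemma eq_of_isBC (hU : IsAffineOpen X U) (he : ∀ x hx, IsBC (e x hx)) {a b : E}
    (h : ∀ x hx, e x hx a = e x hx b) : a = b := by
  rw [← sub_eq_zero]
  refine eq_zero_of_faithfullyFlat (f := fun z : U => res X (minOpen_le z.2)) hU.faithfullyFlat
    (fun z => he z.1 z.2) fun z => ?_
  rw [map_sub, sub_eq_zero, h]

/-- This is descent along `𝒪(U) → ∏ 𝒪_x`: the tensor axiom computes the overlaps, and the third
axiom lets equality on overlaps be checked on stalks. -/
lemma exists_of_isBC (hU : IsAffineOpen X U) (he : ∀ x hx, IsBC (e x hx))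
    (hc : ∀ x (hx : x ∈ U) y (hy : y ∈ minOpen X x) a,
      M.map hy (e x hx a) = e y (minOpen_le hx hy) a) (s : M.Sec (le_refl U)) :
    ∃ a, ∀ x hx, e x hx a = s.val hx := by
  let D (i j : U) : Opens X := minOpen X j.1 ⊓ minOpen X i.1
  let (i : U) : Module (X.presheaf.obj (op U)) (M.obj i.1) :=
    Module.compHom _ (res X (minOpen_le i.2))
  -- This is `𝒪(U_j ∩ U_i) ⊗_{𝒪_j} M_j`, which the tensor axiom identifies with `𝒪_i ⊗_{𝒪(U)} M_j`,
  -- the component `(i, j)` of the double tensor product.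
  let E₂ (i j : U) : Type u := Extend (res X (inf_le_left : D i j ≤ _)) (M.obj j.1)
  let (i j : U) : AddCommGroup (E₂ i j) := inferInstanceAs (AddCommGroup (Extend _ _))
  let (i j : U) : Module (X.presheaf.obj (op (D i j))) (E₂ i j) :=
    inferInstanceAs (Module _ (Extend _ _))
  let (i j : U) : Module (stalkRing X i.1) (E₂ i j) :=
    Module.compHom _ (res X (inf_le_right : D i j ≤ _))
  let mk (i j : U) : M.obj j.1 →ₛₗ[res X (inf_le_left : D i j ≤ _)] E₂ i j := Extend.mk _ _
  have hmk (i j : U) : IsBC (mk i j) := Extend.isBC _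
  let q (i j : U) : M.obj j.1 →ₛₗ[res X (minOpen_le i.2)] E₂ i j :=
    { toFun := mk i j
      map_add' := map_add _
      map_smul' := fun r m => by
        change mk i j (res X (minOpen_le j.2) r • m) =
          res X (inf_le_right : D i j ≤ _) (res X (minOpen_le i.2) r) • mk i j m
        rw [map_smulₛₗ, res_res, res_res] }
  have hq (i j : U) : IsBC (q i j) :=
    IsBC.of_pushout (hU.tensor j.1 i.1 j.2 i.2) (fun _ _ => rfl) (fun _ _ => rfl) (hmk i j)
      fun _ => rfl
  have hl (i j : U) : ∃ p : M.obj i.1 →ₗ[stalkRing X i.1] E₂ i j,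
      ∀ a, p (e i.1 i.2 a) = q i j (e j.1 j.2 a) :=
    (he i.1 i.2).exists_lift
      { toFun := fun a => q i j (e j.1 j.2 a)
        map_add' := fun a b => by simp
        map_smul' := fun r a => by
          rw [map_smulₛₗ]
          exact (q i j).map_smulₛₗ r _ }
  choose p hp using hl
  have hg (i j : U) (w : D i j) : ∃ φ : E₂ i j →ₛₗ[res X (minOpen_le w.2)] M.obj w.1,
      ∀ m, φ (mk i j m) = M.map (mem_left w.2) m :=
    (hmk i j).exists_semilinear_lift (res_comp_res X _ _).symm _
  choose g hg using hg
  obtain ⟨a, ha⟩ := exists_eq_of_faithfullyFlat (f := fun z : U => res X (minOpen_le z.2))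
    hU.faithfullyFlat (e := fun i => e i.1 i.2) (fun i => he i.1 i.2) (fun _ _ _ => rfl) (q := q) hq
    (p := p) hp (fun i => s.val i.2) fun i j => by
      have hpg (w : D i j) (m : M.obj i.1) : g i j w (p i j m) = M.map (mem_right w.2) m := by
        let φ : M.obj i.1 →ₛₗ[res X (minOpen_le (mem_right w.2))] M.obj w.1 :=
          { toFun := fun m => g i j w (p i j m)
            map_add' := fun a b => by simp
            map_smul' := fun r m => by
              rw [map_smul]
              refine ((g i j w).map_smulₛₗ (res X inf_le_right r) (p i j m)).trans ?_
              rw [res_res] }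
        have : φ = M.map (mem_right w.2) := (he i.1 i.2).hom_ext fun a => by
          refine (congrArg (g i j w) (hp i j a)).trans ((hg i j w _).trans ?_)
          rw [hc, hc]
        exact congr($this m)
      -- Both sides lie in a module over `𝒪(U_j ∩ U_i)`, which maps faithfully flatly to the product
      -- of its stalks; at each point `w` of the intersection both become the germ of `s`.
      rw [← sub_eq_zero]
      refine eq_zero_of_faithfullyFlat (f := fun z : D i j => res X (minOpen_le z.2))
        (hU.faithfullyFlat_inf j.1 j.2 i.1 i.2) (e := g i j) (fun w => ?_) fun w => ?_
      · refine (IsBC.comp_iff (res_comp_res X _ _).symm (hmk i j) (m := M.map (mem_left w.2))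
          fun m => (hg i j w m).symm).1 ?_
        exact (IsBC.comp_iff (res_comp_res X _ _).symm (he j.1 j.2)
          (m := e w.1 (minOpen_le j.2 (mem_left w.2))) fun m => (hc _ _ _ _ _).symm).1 (he _ _)
      · rw [map_sub, hpg, sub_eq_zero]
        refine Eq.trans ?_ (hg i j w _).symm
        rw [Sec.map_val, Sec.map_val]
  exact ⟨a, fun x hx => ha ⟨x, hx⟩⟩

/-- Sections over an affine open set of a module obtained by base change. -/
lemma bijective_sec (hU : IsAffineOpen X U) (he : ∀ x hx, IsBC (e x hx))
    {φ : E →ₗ[X.presheaf.obj (op U)] M.Sec (le_refl U)}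
    (hφ : ∀ a x hx, (φ a).val hx = e x hx a) : Function.Bijective φ := by
  constructor
  · intro a b hab
    refine hU.eq_of_isBC he fun x hx => ?_
    rw [← hφ, ← hφ, hab]
  · intro s
    obtain ⟨a, ha⟩ := hU.exists_of_isBC he (fun x hx y hy a => by rw [← hφ, ← hφ, Sec.map_val]) s
    exact ⟨a, Sec.ext fun x hx => by rw [hφ, ha]⟩

end

lemma isBC_sec (hU : IsAffineOpen X U) {M : StalkMod X} {R E : Type u} [CommRing R] [AddCommGroup E]
    [Module R E] {f : R →+* X.presheaf.obj (op U)} {σ : ∀ x ∈ U, R →+* stalkRing X x}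
    (hσ : ∀ x hx, σ x hx = (res X (minOpen_le hx)).comp f) {l : ∀ x hx, E →ₛₗ[σ x hx] M.obj x}
    (hl : ∀ x hx, IsBC (l x hx)) {φ : E →ₛₗ[f] M.Sec (le_refl U)}
    (hφ : ∀ a x hx, (φ a).val hx = l x hx a) : IsBC φ := by
  obtain ⟨φ', hφ'⟩ := (Extend.isBC (M := E) f).exists_lift φ
  refine (Extend.isBC f).of_bijective hφ' (hU.bijective_sec (e := fun x hx =>
    { toFun := fun a => (φ' a).val hx
      map_add' := fun a b => by simp
      map_smul' := fun r a => by simp }) (fun x hx => ?_) fun _ _ _ => rfl)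
  refine (IsBC.comp_iff (hσ x hx) (Extend.isBC f) fun a => ?_).1 (hl x hx)
  rw [← hφ, ← hφ']
  rfl

lemma isBC_ofObj {D : Opens X} (hD : IsAffineOpen X D) {M : StalkMod X} {x : X}
    (hx : D ≤ minOpen X x) (hM : ∀ y (hy : y ∈ D), IsBC (M.map (hx hy)))
    (h : V ≤ D) (h' : D ≤ V) : IsBC (Sec.ofObj (M := M) h hx) := by
  obtain rfl := le_antisymm h h'
  exact hD.isBC_sec (fun y hy => (res_comp_res X _ _).symm) hM fun _ _ _ => rfl

end IsAffineOpen

/-! ### Base change for sections -/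

namespace StalkMod

/-- Restriction of sections to the members of the covering of `D` by minimal open sets. -/
def toCover (M : StalkMod X) (h : V ≤ U) (W : Opens X) :
    M.Sec h →ₗ[X.presheaf.obj (op U)]
      ∀ z : W, M.Sec (inf_le_left.trans h : V ⊓ minOpen X z.1 ≤ U) :=
  LinearMap.pi fun _ => Sec.restrictₗ _ _ inf_le_left

/-- The obstruction to gluing. -/
def coverDiff (M : StalkMod X) (h : V ≤ U) (W : Opens X) :
    (∀ z : W, M.Sec (inf_le_left.trans h : V ⊓ minOpen X z.1 ≤ U)) →ₗ[X.presheaf.obj (op U)]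
      ∀ p : {p : W × W // p.2.1 ∈ minOpen X p.1.1},
        M.Sec (inf_le_left.trans h : V ⊓ minOpen X p.1.2.1 ≤ U) where
  toFun s p := Sec.restrictₗ (M := M) (inf_le_left.trans h) (inf_le_left.trans h)
    (inf_le_inf_left _ (minOpen_le p.2)) (s p.1.1) - s p.1.2
  map_add' s t := funext fun p => by simp only [Pi.add_apply, map_add, add_sub_add_comm]
  map_smul' r s := funext fun p => by
    simp only [Pi.smul_apply, map_smul, smul_sub, RingHom.id_apply]

lemma toCover_injective (M : StalkMod X) (h : V ≤ U) (hW : V ≤ W) :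
    Function.Injective (M.toCover h W) := by
  intro s t hst
  ext x hx
  exact congr(Sec.val ($hst ⟨x, hW hx⟩) (mem_inf hx (mem_minOpen x)))

/-- Only pairs with `w ∈ U_z` are needed: at a point `x` of `V ∩ U_z` the section indexed by `z` can
be compared with the one indexed by `x`. -/
lemma exact_toCover (M : StalkMod X) (h : V ≤ U) (hW : V ≤ W) :
    Function.Exact (M.toCover h W) (M.coverDiff h W) := by
  intro s
  constructor
  · intro hs
    have key : ∀ (z w : W) (hw : w.1 ∈ minOpen X z.1) x (hx : x ∈ V ⊓ minOpen X w.1),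
        (s z).val (inf_le_inf_left V (minOpen_le hw) hx) = (s w).val hx := by
      intro z w hw x hx
      have := congr(Sec.val ($hs ⟨(z, w), hw⟩) hx)
      rw [← sub_eq_zero]
      simpa [coverDiff] using this
    refine ⟨Sec.mk h (fun x hx => (s ⟨x, hW hx⟩).val (mem_inf hx (mem_minOpen x)))
      fun x hx y hy => ?_, ?_⟩
    · rw [Sec.map_val]
      exact key ⟨x, hW hx⟩ ⟨y, hW (minOpen_le hx hy)⟩ hy y _
    · ext z x hx
      exact (key z ⟨x, hW (mem_left hx)⟩ (mem_right hx) x (mem_inf (mem_left hx) (mem_minOpen x))).symm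
  · rintro ⟨t, rfl⟩
    funext p
    ext x hx
    simp [coverDiff, toCover]

/-- Base change for sections over the part of a minimal open set lying in an affine open set. -/
lemma isBC_restrict_minOpen {M : StalkMod X} (hU : IsAffineOpen X U) {y z : X} (hy : y ∈ U) (hz : z ∈ U)
    (hM : ∀ w (hw : w ∈ minOpen X z), IsBC (M.map hw)) (h : V ≤ U) (hV : V = minOpen X z)
    (h' : V' ≤ minOpen X y) (hV' : V' = minOpen X z ⊓ minOpen X y) :
    IsBC (Sec.restrict (M := M) h h' (minOpen_le hy) (hV'.le.trans (inf_le_left.trans hV.ge))) := by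
  subst hV
  let D := minOpen X z ⊓ minOpen X y
  let : Module (X.presheaf.obj (op U)) (M.obj z) := Module.compHom _ (res X (minOpen_le hz))
  let g : M.obj z →ₗ[X.presheaf.obj (op U)] M.Sec h :=
    { toFun := fun m => Sec.ofObj (M := M) (le_refl (minOpen X z)) (le_refl (minOpen X z)) m
      map_add' := fun a b => map_add _ a b
      map_smul' := fun r a => Sec.ext fun x hx => by
        refine (M.map hx).map_smulₛₗ (res X (minOpen_le hz) r) a |>.trans ?_
        rw [res_res]
        rfl }
  have hg : Function.Bijective g := Sec.bijective_ofObj (M := M) (le_refl (minOpen X z))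
    (le_refl (minOpen X z)) (mem_minOpen z)
  let N := M.Sec (hV'.le : V' ≤ D)
  let : Module (stalkRing X y) N := Module.compHom _ (res X (inf_le_right : D ≤ _))
  -- The intersection `D` is affine, so sections of `M` over it are `M_z ⊗_{𝒪_z} 𝒪(D)`; the tensor
  -- axiom then reads this as `M_z ⊗_{𝒪(U)} 𝒪_y`.
  have h1 : IsBC (Sec.ofObj (M := M) (hV'.le : V' ≤ D) (inf_le_left : D ≤ minOpen X z)) :=
    (hU.inf_minOpen hz hy).isBC_ofObj _ (fun w hw => hM _ _) _ hV'.ge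
  let ψ : M.obj z →ₛₗ[res X (minOpen_le hy)] N :=
    { toFun := Sec.ofObj (M := M) (hV'.le : V' ≤ D) (inf_le_left : D ≤ minOpen X z)
      map_add' := map_add _
      map_smul' := fun r m => Sec.ext fun x hx => by
        refine (M.map _).map_smulₛₗ (res X (minOpen_le hz) r) m |>.trans ?_
        rw [res_res, ← res_res (minOpen_le (hV'.le hx)) ((inf_le_right : D ≤ _).trans (minOpen_le hy)),
          ← res_res (inf_le_right : D ≤ _)]
        rfl }
  have h2 : IsBC ψ := IsBC.of_pushout (hU.tensor z y hz hy) (fun _ _ => rfl) (fun _ _ => rfl) h1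
    fun _ => rfl
  -- The same sections, with scalars from `𝒪_y` acting through `𝒪(D)` on one side and directly on
  -- the other.
  let χ : N →ₗ[stalkRing X y] M.Sec h' :=
    { toFun := fun s => s
      map_add' := fun _ _ => rfl
      map_smul' := fun r s => Sec.ext fun x hx => by
        change res X _ (res X _ r) • _ = res X _ r • _
        rw [res_res]
        rfl }
  have h3 : IsBC (χ.comp ψ) := h2.of_bijective (φ := χ) (fun _ => rfl) Function.bijective_id
  refine (IsBC.comp_iff (f := RingHom.id _) (by simp) (isBC_of_bijective Function.bijective_id hg)
    fun m => ?_).1 h3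
  rfl

/-- Restriction of families of sections. -/
def Sec.piRestrict {M : StalkMod X} {ι : Type*} {A B : ι → Opens X} {U U' : Opens X}
    (hA : ∀ i, A i ≤ U) (hB : ∀ i, B i ≤ U') (hU : U' ≤ U) (hAB : ∀ i, B i ≤ A i) :
    (∀ i, M.Sec (hA i)) →ₛₗ[res X hU] (∀ i, M.Sec (hB i)) where
  toFun s i := Sec.restrict (hA i) (hB i) hU (hAB i) (s i)
  map_add' _ _ := funext fun _ => map_add _ _ _
  map_smul' r s := funext fun i => (Sec.restrict (hA i) (hB i) hU (hAB i)).map_smulₛₗ r (s i)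

lemma isBC_piRestrict {M : StalkMod X} {ι : Type*} [Finite ι] {A B : ι → Opens X} {U U' : Opens X}
    (hA : ∀ i, A i ≤ U) (hB : ∀ i, B i ≤ U') (hU : U' ≤ U) (hAB : ∀ i, B i ≤ A i)
    (h : ∀ i, IsBC (Sec.restrict (M := M) (hA i) (hB i) hU (hAB i))) :
    IsBC (Sec.piRestrict (M := M) hA hB hU hAB) :=
  IsBC.pi h fun _ _ => rfl

/-- Base change for sections of a quasi-coherent module, over an affine open set. -/
theorem isBC_restrict {M : StalkMod X} (hU : IsAffineOpen X U) {y : X} (hy : y ∈ U) (h : V ≤ U)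
    (hM : M.QCOn V) (h' : V' ≤ minOpen X y) (hV' : V' = minOpen X y ⊓ V) :
    IsBC (Sec.restrict (M := M) h h' (minOpen_le hy) (hV'.le.trans inf_le_right)) := by
  subst hV'
  have hz (z : V) : IsBC (Sec.restrict (M := M) (inf_le_left.trans h : V ⊓ minOpen X z.1 ≤ U)
      (inf_le_left.trans h' : minOpen X y ⊓ V ⊓ minOpen X z.1 ≤ minOpen X y) (minOpen_le hy)
      (inf_le_inf_right _ inf_le_right)) :=
    isBC_restrict_minOpen hU hy (h z.2) (hM z.1 z.2) _ (inf_eq_right.2 (minOpen_le z.2)) _ (by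
      rw [inf_assoc, inf_eq_right.2 (minOpen_le z.2), inf_comm])
  have h₂ := isBC_piRestrict (M := M) (ι := V) _ _ _ _ hz
  have h₃ := isBC_piRestrict (M := M) (ι := {p : V × V // p.2.1 ∈ minOpen X p.1.1})
    _ _ _ _ fun p => hz p.1.2
  -- Sections over `V` are a kernel of maps between finite products of sections over minimal opens,
  -- and flat base change commutes with such kernels.
  exact IsBC.of_left_exact (hU.flat hy) (φ := M.toCover h V) (ψ := M.coverDiff h V)
    (φ' := M.toCover h' V) (ψ' := M.coverDiff h' V) (fun _ => rfl)
    (fun s => funext fun p => Sec.ext fun x hx => rfl)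
    h₂ h₃ (M.exact_toCover _ le_rfl) (M.toCover_injective _ le_rfl)
    (M.exact_toCover _ inf_le_right) (M.toCover_injective _ inf_le_right)

end StalkMod

end Affine
end FiniteRingedSpace

end

/-! ### Kernels, quotients, truncations and submodules with a prescribed stalk -/

noncomputable section

namespace FiniteRingedSpace

section Serre

variable {X : AlgebraicGeometry.RingedSpace.{u, u}} [Finite X] {U V W : Opens X}

lemma IsSchematic.isAffineOpen_minOpen (hX : IsSchematic X) (x : X) :
    IsAffineOpen X (minOpen X x) := by
  obtain ⟨ι, U, hU, h⟩ := hX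
  obtain ⟨i, hi⟩ := hU x
  exact (h i).minimal hi

namespace StalkMod

variable {M N P : StalkMod X}

lemma QCOn.of_right_exact (f : Hom M N) (g : Hom N P)
    (hex : ∀ x, Function.Exact (f.app x) (g.app x)) (hg : ∀ x, Function.Surjective (g.app x))
    (hM : QCOn W M) (hN : QCOn W N) : QCOn W P := fun x hx y hy =>
  IsBC.of_right_exact (φ := f.app x) (ψ := g.app x) (φ' := f.app y) (ψ' := g.app y)
    (fun m => (f.naturality hy m).symm) (fun m => (g.naturality hy m).symm)
    (hM x hx y hy) (hN x hx y hy) (hex x) (hg x) (hex y) (hg y)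

lemma QCOn.of_left_exact (hX : ∀ x, IsAffineOpen X (minOpen X x)) (f : Hom M N) (g : Hom N P)
    (hex : ∀ x, Function.Exact (f.app x) (g.app x)) (hf : ∀ x, Function.Injective (f.app x))
    (hN : QCOn W N) (hP : QCOn W P) : QCOn W M := fun x hx y hy =>
  IsBC.of_left_exact ((hX x).flat hy) (φ := f.app x) (ψ := g.app x) (φ' := f.app y) (ψ' := g.app y)
    (fun m => (f.naturality hy m).symm) (fun m => (g.naturality hy m).symm)
    (hN x hx y hy) (hP x hx y hy) (hex x) (hf x) (hex y) (hf y)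

lemma exact_incl_ker (f : Hom M N) (x : X) : Function.Exact (f.ker.incl.app x) (f.app x) := fun m =>
  ⟨fun h => ⟨⟨m, h⟩, rfl⟩, by rintro ⟨m, rfl⟩; exact m.2⟩

lemma exact_incl_proj (L : Sub M) (x : X) : Function.Exact (L.incl.app x) (L.proj.app x) := fun m =>
  (L.proj_eq_zero_iff m).trans ⟨fun h => ⟨⟨m, h⟩, rfl⟩, by rintro ⟨m, rfl⟩; exact m.2⟩

lemma exact_proj_range (f : Hom M N) (x : X) : Function.Exact (f.app x) (f.range.proj.app x) :=
  fun m => f.range.proj_eq_zero_iff m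

lemma QCOn.ker (hX : ∀ x, IsAffineOpen X (minOpen X x)) (f : Hom M N) (hM : QCOn W M)
    (hN : QCOn W N) : QCOn W f.ker.toMod :=
  .of_left_exact hX _ _ (exact_incl_ker f) f.ker.incl_injective hM hN

lemma QCOn.quot {L : Sub M} (hL : QCOn W L.toMod) (hM : QCOn W M) : QCOn W L.quot :=
  .of_right_exact _ _ (exact_incl_proj L) L.proj_surjective hL hM

lemma QCOn.quot_range (f : Hom M N) (hM : QCOn W M) (hN : QCOn W N) : QCOn W f.range.quot :=
  .of_right_exact _ _ (exact_proj_range f) f.range.proj_surjective hM hN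

/-- The truncation of a quasi-coherent module is quasi-coherent. -/
lemma QCOn.trunc (hX : ∀ x, IsAffineOpen X (minOpen X x)) (hM : QCOn V M) : QC (M.trunc V) :=
  fun x _ y hy => isBC_restrict (hX x) hy inf_le_left (fun z hz => hM z (mem_right hz)) inf_le_left
    (by rw [← inf_assoc, inf_eq_left.2 (minOpen_le hy)])

/-- Base change of `Γ(U, M)` to `𝒪_x` gives the sections over `U_x ∩ U = U_x`, that is, the stalk.
-/
lemma isBC_germ (hU : IsAffineOpen X U) (hM : QCOn U M) {x : X} (hx : x ∈ U) :
    IsBC (Sec.germ (M := M) (le_refl U) hx) := by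
  have h := isBC_restrict (M := M) hU hx (le_refl U) hM inf_le_left rfl
  refine h.of_bijective (φ :=
    { toFun := fun s => s.val (mem_inf (mem_minOpen x) hx)
      map_add' := fun _ _ => rfl
      map_smul' := fun r s => by rw [Sec.val_smul, res_self]; rfl }) (fun _ => rfl) ⟨fun s t hst => ?_, fun m => ?_⟩
  · ext y hy
    rw [Sec.eq_map_of_mem s (mem_inf (mem_minOpen x) hx) (mem_left hy),
      Sec.eq_map_of_mem t (mem_inf (mem_minOpen x) hx) (mem_left hy)]
    exact congrArg _ hst
  · exact ⟨Sec.ofObj _ (le_refl _) m, M.map_self _ m⟩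

/-- Surjections of quasi-coherent modules are surjective on sections over affine open sets. -/
lemma surjective_sec_map (hU : IsAffineOpen X U) (f : Hom M N) (hM : QCOn U M) (hN : QCOn U N)
    (hf : ∀ x, Function.Surjective (f.app x)) : Function.Surjective (Sec.map f (le_refl U)) :=
  surjective_of_faithfullyFlat (f := fun z : U => res X (minOpen_le z.2)) hU.faithfullyFlat
    (fun z => isBC_germ hU hM z.2) (fun z => isBC_germ hU hN z.2) (φ₁ := fun z => f.app z.1)
    (fun _ _ => rfl) fun z => hf z.1

/-- The extension of `L` maps onto `L'`, so right exactness presents both quotients compatibly. -/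
lemma isBC_mapQ {R S : Type u} [CommRing R] [CommRing S] {f : R →+* S} {A B : Type u}
    [AddCommGroup A] [AddCommGroup B] [Module R A] [Module S B] {g : A →ₛₗ[f] B} (hg : IsBC g)
    (L : Submodule R A) (L' : Submodule S B) (hL : L ≤ L'.comap g)
    (hL' : L' ≤ Submodule.span S (g '' L)) : IsBC (L.mapQ L' g hL) := by
  obtain ⟨φ, hφ⟩ := (Extend.isBC (M := L) f).exists_lift (N' := B)
    { toFun := fun l => g l.1
      map_add' := fun a b => by simp
      map_smul' := fun r a => by simp }
  have hr : LinearMap.range φ = L' := by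
    apply le_antisymm
    · rw [LinearMap.range_eq_map, ← (Extend.isBC (M := L) f).span_range, Submodule.map_span_le]
      rintro _ ⟨l, rfl⟩
      rw [hφ]
      exact hL l.2
    · refine hL'.trans (Submodule.span_le.2 ?_)
      rintro _ ⟨l, hl, rfl⟩
      exact ⟨Extend.mk _ f ⟨l, hl⟩, hφ _⟩
  refine IsBC.of_right_exact (φ := L.subtype) (ψ := L.mkQ) (φ' := φ) (ψ' := L'.mkQ)
    (fun l => (hφ l).symm) (fun _ => rfl) (Extend.isBC f) hg
    (LinearMap.exact_subtype_mkQ L) L.mkQ_surjective (fun b => ?_) L'.mkQ_surjective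
  change L'.mkQ b = 0 ↔ b ∈ LinearMap.range φ
  rw [hr]
  exact Submodule.Quotient.mk_eq_zero _

/-- On `U_y` the quotient is the extension of `M_y / L`. Nothing is claimed away from `U_y`, which
is why it is truncated before use. -/
lemma QCOn.quot_spanAt {y : X} (hM : ∀ v (hv : v ∈ minOpen X y), IsBC (M.map hv))
    (L : Submodule (stalkRing X y) (M.obj y)) : QCOn (minOpen X y) (M.spanAt L).quot := by
  have key : ∀ v (hv : v ∈ minOpen X y), IsBC ((M.spanAt L).quot.map hv) := fun v hv => by
    refine isBC_mapQ (hM v hv) ((M.spanAt L).carrier y) ((M.spanAt L).carrier v)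
      (fun _ hm => (M.spanAt L).map_mem hv hm) (Submodule.span_le.2 ?_)
    rintro _ ⟨_, l, hl, rfl⟩
    exact Submodule.subset_span ⟨l, Submodule.subset_span ⟨mem_minOpen y, l, hl, M.map_self _ _⟩, rfl⟩
  intro v hv w hw
  exact (IsBC.comp_iff (res_comp_res X _ _).symm (key v hv) fun m =>
    ((M.spanAt L).quot.map_map _ _ _).symm).1 (key w (minOpen_le hv hw))

lemma mem_spanAt_self {y : X} (L : Submodule (stalkRing X y) (M.obj y)) (m : M.obj y) :
    m ∈ (M.spanAt L).carrier y ↔ m ∈ L := by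
  refine ⟨fun h => ?_, fun h => Submodule.subset_span ⟨mem_minOpen y, m, h, M.map_self _ _⟩⟩
  have : (M.spanAt L).carrier y ≤ L := Submodule.span_le.2 (by
    rintro _ ⟨_, l, hl, rfl⟩
    rwa [M.map_self])
  exact this h

/-- The largest submodule of `M` with stalk `L` at `y`. -/
def largest (M : StalkMod X) {y : X} (L : Submodule (stalkRing X y) (M.obj y)) : Sub M :=
  (((M.spanAt L).proj.trunc (minOpen X y)).comp (M.toTrunc (minOpen X y))).ker

lemma largest_carrier {y : X} (L : Submodule (stalkRing X y) (M.obj y)) :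
    (M.largest L).carrier y = L := by
  ext m
  constructor
  · intro h
    have h1 : (((M.spanAt L).proj.trunc (minOpen X y)).comp (M.toTrunc (minOpen X y))).app y m = 0 :=
      h
    have := congr(truncVal $h1 (mem_inf (mem_minOpen y) (mem_minOpen y)))
    have h2 : (M.spanAt L).proj.app y (M.map (mem_minOpen y) m) = 0 := this
    rwa [M.map_self, Sub.proj_eq_zero_iff, mem_spanAt_self] at h2
  · intro h
    refine trunc_ext fun x hx => ?_
    change (M.spanAt L).proj.app x (M.map (mem_left hx) m) = 0
    rw [Sub.proj_eq_zero_iff]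
    exact Submodule.subset_span ⟨_, m, h, rfl⟩

/-- Truncating to `U_y` restores quasi-coherence of the quotient on all of `X`, and the submodule is
the kernel of a map into this truncation. -/
lemma QC.largest (hX : ∀ x, IsAffineOpen X (minOpen X x)) (hM : QC M) {y : X}
    (L : Submodule (stalkRing X y) (M.obj y)) : QC (M.largest L).toMod :=
  QCOn.ker hX _ hM (QCOn.trunc hX (QCOn.quot_spanAt (fun v _ => hM y trivial v _) L))

end StalkMod
end Serre
end FiniteRingedSpace

end

/-! ### Vanishing of quasi-coherent modules without global sections -/

noncomputable section

namespace FiniteRingedSpace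

section Vanishing

variable {X : AlgebraicGeometry.RingedSpace.{u, u}} [Finite X] {U V W : Opens X}

namespace StalkMod

variable {M N P : StalkMod X}

variable (X) in
/-- Surjections of quasi-coherent modules are surjective on global sections. -/
def SurjectiveOnSections : Prop :=
  ∀ ⦃M N : StalkMod X⦄ (f : Hom M N), QC M → QC N → (∀ x, Function.Surjective (f.app x)) →
    Function.Surjective (Sec.map f (le_refl ⊤))

/-- `M` has no nonzero global section. -/
def NoSections (M : StalkMod X) : Prop := ∀ s : M.Sec (le_refl ⊤), s = 0

lemma NoSections.of_injective (f : Hom M N) (hf : ∀ x, Function.Injective (f.app x))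
    (hN : NoSections N) : NoSections M := fun s => Sec.ext fun x hx => hf x (by
  have := congr(Sec.val $(hN (Sec.map f _ s)) hx)
  simpa using this)

lemma NoSections.of_surjective (hΓ : SurjectiveOnSections X) (f : Hom M N) (hQM : QC M)
    (hQN : QC N) (hf : ∀ x, Function.Surjective (f.app x)) (hM : NoSections M) :
    NoSections N := fun s => by
  obtain ⟨t, rfl⟩ := hΓ f hQM hQN hf s
  rw [hM t, map_zero]

/-- The support of a module. -/
def supp (M : StalkMod X) : Set X := {x | Nontrivial (M.obj x)}

lemma supp_subset_of_injective (f : Hom M N) (hf : ∀ x, Function.Injective (f.app x)) :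
    supp M ⊆ supp N := fun x (_ : Nontrivial (M.obj x)) => (hf x).nontrivial

lemma supp_subset_of_surjective (f : Hom M N) (hf : ∀ x, Function.Surjective (f.app x)) :
    supp N ⊆ supp M := fun x (_ : Nontrivial (N.obj x)) => (hf x).nontrivial

lemma eq_zero_of_notMem_supp {x : X} (h : x ∉ supp M) (m : M.obj x) : m = 0 := by
  have := not_nontrivial_iff_subsingleton.1 h
  exact Subsingleton.elim _ _

lemma mem_supp_of_ne_zero {x : X} {m : M.obj x} (h : m ≠ 0) : x ∈ supp M :=
  nontrivial_of_ne m 0 h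

/-- A quasi-coherent module without global sections, of minimal support among the nonzero ones. -/
structure IsMinimal (M : StalkMod X) : Prop where
  qc : QC M
  noSections : NoSections M
  eq_supp : ∀ N : StalkMod X, QC N → NoSections N → supp N ⊆ supp M → (supp N).Nonempty →
    supp N = supp M

lemma exists_isMinimal (hM : QC M) (hs : NoSections M) (hne : (supp M).Nonempty) :
    ∃ N : StalkMod X, IsMinimal N ∧ (supp N).Nonempty := by
  induction h : (supp M).ncard using Nat.strong_induction_on generalizing M with
  | _ n ih =>
    by_cases hmin : IsMinimal M
    · exact ⟨M, hmin, hne⟩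
    · have : ∃ N : StalkMod X, QC N ∧ NoSections N ∧ supp N ⊆ supp M ∧ (supp N).Nonempty ∧
          supp N ≠ supp M := by
        by_contra! hc
        exact hmin ⟨hM, hs, hc⟩
      obtain ⟨N, h1, h2, h3, h4, h5⟩ := this
      exact ih _ (h ▸ Set.ncard_lt_ncard (h3.ssubset_of_ne h5)) h1 h2 h4 rfl

lemma IsMinimal.of_supp_subset (hM : IsMinimal M) (hN : QC N) (hs : NoSections N)
    (h : supp N ⊆ supp M) (hne : (supp N).Nonempty) : IsMinimal N where
  qc := hN
  noSections := hs
  eq_supp P h1 h2 h3 h4 := (hM.eq_supp P h1 h2 (h3.trans h) h4).trans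
    (hM.eq_supp N hN hs h hne).symm

section Minimal

variable (hX : ∀ x, IsAffineOpen X (minOpen X x)) (hM : IsMinimal M) {y : X} (hy : y ∈ supp M)

include hX hM hy in
-- The kernel is quasi-coherent without global sections, and its stalk at `y` is zero; by minimality
-- of the support it is zero.
lemma IsMinimal.injective_toTrunc (x : X) :
    Function.Injective ((M.toTrunc (minOpen X y)).app x) := by
  let K := (M.toTrunc (minOpen X y)).ker
  have h0 : ¬ (supp K.toMod).Nonempty := fun h => by
    have := hM.eq_supp K.toMod (QCOn.ker hX _ hM.qc (QCOn.trunc hX (hM.qc.on _)))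
      (hM.noSections.of_injective _ K.incl_injective)
      (supp_subset_of_injective _ K.incl_injective) h
    rw [← this] at hy
    obtain ⟨⟨m, hm⟩, hne⟩ := @exists_ne _ hy (0 : K.toMod.obj y)
    refine hne (Subtype.ext ?_)
    have hm' : (M.toTrunc (minOpen X y)).app y m = 0 := hm
    have := congr(truncVal $hm' (mem_inf (mem_minOpen y) (mem_minOpen y)))
    rwa [truncVal_toTrunc, M.map_self] at this
  rw [injective_iff_map_eq_zero]
  intro m hm
  by_contra hne
  exact h0 ⟨x, mem_supp_of_ne_zero (M := K.toMod) (m := ⟨m, hm⟩)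
    fun h => hne congr(Subtype.val $h)⟩

variable (hmin : ∀ w ∈ supp M, w ∈ minOpen X y → y ∈ minOpen X w)

include hX hM hy

include hmin in
-- A nonzero element of `M_z` survives in the truncation, hence is nonzero at some `w ∈ U_z ∩ U_y`
-- in the support; minimality of `U_y` puts `y` in `U_w`.
lemma IsMinimal.mem_minOpen {z : X} (hz : z ∈ supp M) : y ∈ minOpen X z := by
  obtain ⟨m, hm⟩ := @exists_ne _ hz (0 : M.obj z)
  have : (M.toTrunc (minOpen X y)).app z m ≠ 0 := fun h =>
    hm (hM.injective_toTrunc hX hy z (h.trans (map_zero _).symm))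
  obtain ⟨w, hw, hne⟩ : ∃ w, ∃ hw : w ∈ minOpen X z ⊓ minOpen X y, M.map (mem_left hw) m ≠ 0 := by
    by_contra! hc
    exact this (trunc_ext fun w hw => hc w hw)
  exact minOpen_le_minOpen (mem_left hw) (hmin w (mem_supp_of_ne_zero hne) (mem_right hw))

/-- An element killed at `y` is killed on all of `U_z ∩ U_y`, so it vanishes in the truncation. -/
lemma IsMinimal.map_injective {z : X} (h : y ∈ minOpen X z) : Function.Injective (M.map h) := by
  rw [injective_iff_map_eq_zero]
  intro m hm
  apply hM.injective_toTrunc hX hy z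
  rw [map_zero]
  refine trunc_ext fun w hw => ?_
  rw [truncVal_toTrunc, ← M.map_map h (mem_right hw), hm, map_zero]
  rfl

end Minimal

lemma QC.subsingleton (hM : QC M) {x y : X} (h : y ∈ minOpen X x) (hx : x ∉ supp M) :
    y ∉ supp M := by
  intro (hy : Nontrivial (M.obj y))
  have h1 := (hM x trivial y h).span_range
  have h2 : Set.range (M.map h) ⊆ {0} := by
    rintro _ ⟨m, rfl⟩
    rw [eq_zero_of_notMem_supp hx m, map_zero]
    rfl
  have := (Submodule.span_mono h2).trans_eq (Submodule.span_zero_singleton (stalkRing X y))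
  rw [h1, top_le_iff] at this
  exact bot_ne_top this

/-- The stalk at `y` has no nontrivial submodules. -/
def SimpleAt (M : StalkMod X) (y : X) : Prop :=
  ∀ L : Submodule (stalkRing X y) (M.obj y), L = ⊥ ∨ L = ⊤

lemma mem_supp_toMod_iff {L : Sub M} {x : X} : x ∈ supp L.toMod ↔ L.carrier x ≠ ⊥ :=
  Submodule.nontrivial_iff_ne_bot

lemma mem_supp_quot_iff {L : Sub M} {x : X} : x ∈ supp L.quot ↔ L.carrier x ≠ ⊤ :=
  Submodule.Quotient.nontrivial_iff

section Simple

variable (hΓ : SurjectiveOnSections X) (hX : ∀ x, IsAffineOpen X (minOpen X x))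
include hΓ hX

/-- A subquotient of `M` has stalk `𝒪_y / J` at `y` for a maximal ideal `J`. Quotients have no
sections because `Γ` is exact, submodules for trivial reasons, so the subquotient is still minimal.
-/
lemma IsMinimal.exists_simpleAt (hM : IsMinimal M) {y : X} (hy : y ∈ supp M) :
    ∃ N : StalkMod X, IsMinimal N ∧ supp N = supp M ∧ SimpleAt N y := by
  obtain ⟨m₀, hm₀⟩ := @exists_ne _ hy (0 : M.obj y)
  obtain ⟨J, hJ, hle⟩ := Ideal.exists_le_maximal (LinearMap.ker (LinearMap.toSpanSingleton
    (stalkRing X y) (M.obj y) m₀)) (fun h => hm₀ (by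
      have : (1 : stalkRing X y) ∈ LinearMap.ker (LinearMap.toSpanSingleton
        (stalkRing X y) (M.obj y) m₀) := h ▸ Submodule.mem_top
      simpa using this))
  -- As `J` contains the annihilator of `m₀`, the class of `m₀` modulo `J m₀` has annihilator
  -- exactly `J`.
  let L₀ : Submodule (stalkRing X y) (M.obj y) :=
    Submodule.map (LinearMap.toSpanSingleton (stalkRing X y) (M.obj y) m₀) J
  have hL₀ : ∀ r : stalkRing X y, r • m₀ ∈ L₀ ↔ r ∈ J := by
    intro r
    constructor
    · rintro ⟨j, hj, hr⟩
      have h1 : r - j ∈ LinearMap.ker (LinearMap.toSpanSingleton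
        (stalkRing X y) (M.obj y) m₀) := by
        rw [LinearMap.mem_ker, map_sub, hr]
        simp
      simpa using add_mem (hle h1) hj
    · exact fun hr => ⟨r, hr, rfl⟩
  let K₀ := M.largest L₀
  have hK₀ : K₀.carrier y = L₀ := largest_carrier L₀
  let M₁ := K₀.quot
  have hQ₁ : QC M₁ := QCOn.quot (hM.qc.largest hX L₀) hM.qc
  have hs₁ : NoSections M₁ := .of_surjective hΓ K₀.proj hM.qc hQ₁ K₀.proj_surjective hM.noSections
  let m₁ : M₁.obj y := K₀.proj.app y m₀
  have hm₁ : ∀ r : stalkRing X y, r • m₁ = 0 ↔ r ∈ J := by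
    intro r
    rw [← map_smul, K₀.proj_eq_zero_iff, hK₀, hL₀]
  -- Passing to the submodule with stalk generated by `m₁` cuts the stalk at `y` down to `𝒪_y / J`.
  let L₁ : Submodule (stalkRing X y) (M₁.obj y) := Submodule.span _ {m₁}
  let K₁ := M₁.largest L₁
  have hK₁ : K₁.carrier y = L₁ := largest_carrier L₁
  have hsub : supp K₁.toMod ⊆ supp M := (supp_subset_of_injective _ K₁.incl_injective).trans
    (supp_subset_of_surjective _ K₀.proj_surjective)
  have hne : y ∈ supp K₁.toMod := by
    rw [mem_supp_toMod_iff, hK₁, Ne, Submodule.span_singleton_eq_bot]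
    intro h
    refine hJ.ne_top ((Ideal.eq_top_iff_one _).2 ((hm₁ 1).1 ?_))
    rw [h, smul_zero]
  have hQ : QC K₁.toMod := hQ₁.largest hX L₁
  have hs : NoSections K₁.toMod := hs₁.of_injective _ K₁.incl_injective
  refine ⟨K₁.toMod, hM.of_supp_subset hQ hs hsub ⟨y, hne⟩, hM.eq_supp _ hQ hs hsub ⟨y, hne⟩,
    fun L => or_iff_not_imp_left.2 fun hL => ?_⟩
  obtain ⟨⟨x, hx⟩, hxL, hx0⟩ := Submodule.exists_mem_ne_zero_of_ne_bot hL
  have hx' : x ∈ L₁ := hK₁ ▸ hx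
  obtain ⟨r, rfl⟩ := Submodule.mem_span_singleton.1 hx'
  have hr : r ∉ J := fun h => hx0 (Subtype.ext ((hm₁ r).2 h))
  obtain ⟨s, j, hj, hsr⟩ := hJ.exists_inv hr
  rw [eq_top_iff]
  rintro ⟨z, hz⟩ -
  have hz' : z ∈ L₁ := hK₁ ▸ hz
  obtain ⟨t, rfl⟩ := Submodule.mem_span_singleton.1 hz'
  have : (⟨t • m₁, hz⟩ : K₁.carrier y) = (t * s) • ⟨r • m₁, hx⟩ := Subtype.ext (by
    change t • m₁ = (t * s) • r • m₁
    rw [mul_smul, smul_smul s r, eq_sub_of_add_eq hsr, sub_smul, (hm₁ j).2 hj, sub_zero, one_smul])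
  rw [this]
  exact L.smul_mem _ hxL

/-- A proper nonzero submodule of `M_z` would give a nonzero submodule `K` with `M / K` nonzero.
Both would have the support of `M`, so both stalks at `y` would be nonzero, against simplicity of
`M_y`. -/
lemma IsMinimal.simpleAt (hM : IsMinimal M) {y : X} (hy : SimpleAt M y) (hys : y ∈ supp M) (z : X) :
    SimpleAt M z := by
  intro L
  by_contra! hL
  let K := M.largest L
  have hK : K.carrier z = L := largest_carrier L
  have hQK : QC K.toMod := hM.qc.largest hX L
  have hQ : QC K.quot := QCOn.quot hQK hM.qc
  have h1 := hM.eq_supp K.toMod hQK (hM.noSections.of_injective _ K.incl_injective)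
    (supp_subset_of_injective _ K.incl_injective) ⟨z, mem_supp_toMod_iff.2 (hK ▸ hL.1)⟩
  have h2 := hM.eq_supp K.quot hQ (.of_surjective hΓ K.proj hM.qc hQ K.proj_surjective hM.noSections)
    (supp_subset_of_surjective _ K.proj_surjective) ⟨z, mem_supp_quot_iff.2 (hK ▸ hL.2)⟩
  rcases hy (K.carrier y) with h | h
  · exact mem_supp_toMod_iff.1 (h1.symm ▸ hys) h
  · exact mem_supp_quot_iff.1 (h2.symm ▸ hys) h

omit hΓ in
-- The image of `M_z` spans `M_y` over `𝒪_y`, so it is enough that this image is stable under `𝒪_y`;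
-- simplicity of `M_z` forces that.
lemma QC.map_surjective (hM : QC M) {y z : X} (h : y ∈ minOpen X z) (hy : y ∈ supp M)
    (hz : SimpleAt M z) : Function.Surjective (M.map h) := by
  let T := M.trunc (minOpen X y)
  let f := M.toTrunc (minOpen X y)
  let Q := f.range.quot
  have hQT : QC T := QCOn.trunc hX (hM.on _)
  have hQ : QC Q := QCOn.quot_range f hM hQT
  have hQy : Subsingleton (Q.obj y) := by
    rw [← not_nontrivial_iff_subsingleton]
    refine fun hn => mem_supp_quot_iff.1 (show y ∈ supp Q from hn) (LinearMap.range_eq_top.2 ?_)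
    exact (Sec.bijective_ofObj (M := M) _ (le_refl (minOpen X y))
      (mem_inf (mem_minOpen y) (mem_minOpen y))).2
  have key : ∀ (s : stalkRing X y) (m : M.obj z), ∃ m', M.map h m' = s • M.map h m := by
    intro s
    -- Multiplication by `s ∈ 𝒪_y` makes sense on sections over `U_z ∩ U_y`, although `s` need not
    -- extend to `U_z`. Composed with the projection to `Q_z`, its kernel is zero or everything.
    let ψ' : M.obj z →ₗ[stalkRing X z] T.obj z :=
      Sec.lift _ (RingHom.id _) (fun x hx m => res X (minOpen_le (mem_right hx)) s •
        M.map (mem_left hx) m) (by simp)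
        (fun x hx r m => by rw [map_smulₛₗ, smul_comm]; rfl)
        fun x hx w hw m => by rw [map_smulₛₗ, res_res, M.map_map]
    let ψ : M.obj z →ₗ[stalkRing X z] Q.obj z := (f.range.proj.app z).comp ψ'
    rcases hz (LinearMap.ker ψ) with hk | hk
    -- If the kernel is zero, flat base change to `y` yields an injection of `M_y` into `Q_y = 0`,
    -- which is excluded by `y ∈ supp M`.
    · exfalso
      obtain ⟨φ, hφ⟩ := (hM z trivial y h).exists_lift
        { toFun := fun m => Q.map h (ψ m)
          map_add' := fun a b => by simp
          map_smul' := fun r a => by rw [map_smul, map_smulₛₗ] }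
      have : Function.Injective φ := IsBC.injective_of_flat ((hX z).flat h) (φ := ψ)
        (fun m => (hφ m).symm) (hM z trivial y h) (hQ z trivial y h) (LinearMap.ker_eq_bot.1 hk)
      exact not_nontrivial_iff_subsingleton.2 this.subsingleton hy
    · intro m
      have hm : m ∈ LinearMap.ker ψ := hk ▸ Submodule.mem_top
      obtain ⟨m', hm'⟩ := (f.range.proj_eq_zero_iff _).1 hm
      refine ⟨m', ?_⟩
      have := congr(truncVal $hm' (mem_inf h (mem_minOpen y)))
      refine this.trans ?_
      change res X _ s • _ = _
      rw [res_self]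
  intro m
  have hm : m ∈ Submodule.span (stalkRing X y) (Set.range (M.map h)) :=
    (hM z trivial y h).span_range ▸ Submodule.mem_top
  induction hm using Submodule.span_induction with
  | mem _ h => exact h
  | zero => exact ⟨0, map_zero _⟩
  | add a b _ _ ha hb =>
    obtain ⟨a, rfl⟩ := ha
    obtain ⟨b, rfl⟩ := hb
    exact ⟨a + b, map_add _ _ _⟩
  | smul s a _ ha =>
    obtain ⟨a, rfl⟩ := ha
    exact key s a

/-- A quasi-coherent module without global sections vanishes. -/
theorem QC.eq_zero (hM : QC M) (hs : NoSections M) {x : X} (m : M.obj x) : m = 0 := by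
  by_contra hne
  obtain ⟨M, hM, hne⟩ := exists_isMinimal hM hs ⟨x, mem_supp_of_ne_zero hne⟩
  obtain ⟨y, hy, hy'⟩ := Set.exists_min_image (supp M) (fun y => (minOpen X y : Set X).ncard)
    (Set.toFinite _) hne
  obtain ⟨N, hN, hNM, hNy⟩ := hM.exists_simpleAt hΓ hX hy
  rw [← hNM] at hy hy'
  have hmin : ∀ w ∈ supp N, w ∈ minOpen X y → y ∈ minOpen X w := fun w hw hwy => by
    have := Set.eq_of_subset_of_ncard_le (s := (minOpen X w : Set X)) (minOpen_le hwy) (hy' w hw)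
    exact this.ge (mem_minOpen y)
  have hmem (z : X) (hz : z ∈ supp N) : y ∈ minOpen X z := hN.mem_minOpen hX hy hmin hz
  obtain ⟨m₀, hm₀⟩ := @exists_ne _ hy (0 : N.obj y)
  have hpre (z : X) (hz : z ∈ supp N) : ∃ m, N.map (hmem z hz) m = m₀ :=
    QC.map_surjective hX hN.qc _ hy (hN.simpleAt hΓ hX hNy hy z) m₀
  choose g hg using hpre
  classical
  -- The unique preimages of `m₀` on the support, extended by zero. The extension is compatible
  -- because the zero stalk of a quasi-coherent module stays zero under specialization.
  let s : N.Sec (le_refl ⊤) := Sec.mk _ (fun z _ => if hz : z ∈ supp N then g z hz else 0)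
    fun z _ w hw => by
      by_cases hz : z ∈ supp N
      · by_cases hw' : w ∈ supp N
        · rw [dif_pos hz, dif_pos hw']
          apply hN.map_injective hX hy (hmem w hw')
          rw [N.map_map, hg, hg]
        · rw [dif_neg hw']
          exact eq_zero_of_notMem_supp hw' _
      · rw [dif_neg hz, dif_neg (QC.subsingleton hN.qc hw hz), map_zero]
  have h1 := congr(Sec.val $(hN.noSections s) (show y ∈ ⊤ from trivial))
  have h2 : s.val (show y ∈ ⊤ from trivial) = g y hy := dif_pos hy
  rw [h2] at h1
  apply hm₀
  rw [← hg y hy, h1, Sec.val_zero, map_zero]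

end Simple

end StalkMod
end Vanishing
end FiniteRingedSpace

end

/-! ### Algebraic criteria, and the pullback of an `𝒪(X)`-module -/

noncomputable section

namespace FiniteRingedSpace

section Criterion

section Algebra

variable {R : Type u} [CommRing R]

lemma IsBC.subsingleton {S : Type u} [CommRing S] {f : R →+* S} {M N : Type*} [AddCommGroup M]
    [AddCommGroup N] [Module R M] [Module S N] {g : M →ₛₗ[f] N} (hg : IsBC g) {I : Ideal R}
    (hI : I.map f = ⊤) (hM : ∀ r ∈ I, ∀ m : M, r • m = 0) : Subsingleton N := by
  have h1 : I.map f ≤ Module.annihilator S N := by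
    rw [Ideal.map_le_iff_le_comap]
    intro r hr
    rw [Ideal.mem_comap, Module.mem_annihilator]
    intro n
    have hn : n ∈ Submodule.span S (Set.range g) := hg.span_range ▸ Submodule.mem_top
    induction hn using Submodule.span_induction with
    | mem _ h =>
      obtain ⟨m, rfl⟩ := h
      rw [← map_smulₛₗ, hM r hr, map_zero]
    | zero => exact smul_zero _
    | add a b _ _ ha hb => rw [smul_add, ha, hb, add_zero]
    | smul s a _ ha => rw [smul_comm, ha, smul_zero]
  refine subsingleton_of_forall_eq 0 fun n => ?_
  have := h1 (hI ▸ Submodule.mem_top : (1 : S) ∈ I.map f)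
  rw [Module.mem_annihilator] at this
  simpa using this n

variable {ι : Type u} [Finite ι] {S : ι → Type u} [∀ i, CommRing (S i)]
  {f : ∀ i, R →+* S i}

lemma faithfullyFlat_pi (hf : ∀ i, (f i).Flat)
    (h : ∀ I : Ideal R, (∀ i, I.map (f i) = ⊤) → I = ⊤) : (RingHom.pi f).FaithfullyFlat := by
  classical
  cases nonempty_fintype ι
  have hflat : (RingHom.pi f).Flat := by
    let (i : ι) := (f i).toAlgebra
    have (i : ι) : Module.Flat R (S i) := hf i
    exact Module.Flat.of_linearEquiv (DirectSum.linearEquivFunOnFintype R ι S).symm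
  let := (RingHom.pi f).toAlgebra
  have : Module.Flat R (∀ i, S i) := hflat
  refine Module.FaithfullyFlat.mk (R := R) (M := ∀ i, S i) fun {m} hm he => hm.ne_top (h m fun i => ?_)
  rw [Ideal.smul_top_eq_map] at he
  rw [← show (Pi.evalRingHom S i).comp (RingHom.pi f) = f i from rfl, ← Ideal.map_map]
  have he' : m.map (RingHom.pi f) = ⊤ := by
    rw [← Submodule.restrictScalars_eq_top_iff R]
    exact he
  rw [he', Ideal.map_top]

/-- Flatness is injectivity of `I ⊗ S → S`. The map is left arbitrary so that it can be matched with
the stalk of a morphism of modules on `X`. -/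
lemma flat_of_extend {S : Type u} [CommRing S] {f : R →+* S}
    (h : ∀ (I : Ideal R) (φ : Extend f I →ₗ[S] S), (∀ i, φ (Extend.mk I f i) = f i) →
      Function.Injective φ) : f.Flat := by
  let := f.toAlgebra
  refine Module.Flat.iff_lTensor_injective.2 fun I _ => ?_
  let e : S ⊗[R] R ≃ₗ[S] S := AlgebraTensorModule.rid R S S
  have := h I (e.toLinearMap ∘ₗ I.subtype.baseChange S) fun i => by
    change e ((I.subtype.baseChange S) (1 ⊗ₜ i)) = _
    simp [e, Algebra.smul_def]
    rfl
  exact Function.Injective.of_comp this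

end Algebra

/-- This converts base change for sections of the structure sheaf, viewed as the modules `C₁` and
`D₁`, into the tensor axiom for the rings. -/
lemma tensorMapBijective_of_isBC {A B C D : Type u} [CommRing A] [CommRing B] [CommRing C]
    [CommRing D] {f : A →+* B} {g : A →+* C} {h : B →+* D} {k : C →+* D}
    (w : h.comp f = k.comp g) {C₁ D₁ : Type u} [AddCommGroup C₁] [AddCommGroup D₁]
    [Module A C₁] [Module B D₁] {ψ : C₁ →ₛₗ[f] D₁} (hψ : IsBC ψ) (i : C →+ C₁)
    (hi : Function.Bijective i) (hi' : ∀ a c, i (g a * c) = a • i c) (j : D →+ D₁)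
    (hj : Function.Bijective j) (hj' : ∀ b d, j (h b * d) = b • j d)
    (hij : ∀ c, ψ (i c) = j (k c)) : TensorMapBijective f g h k w := by
  rw [tensorMapBijective_iff_isPushout]
  let := f.toAlgebra; let := g.toAlgebra; let := h.toAlgebra; let := k.toAlgebra
  let := (h.comp f).toAlgebra
  have : IsScalarTower A B D := .of_algebraMap_eq fun _ => rfl
  have : IsScalarTower A C D := .of_algebraMap_eq fun a => RingHom.congr_fun w a
  rw [Algebra.isPushout_iff]
  let i' : C →ₗ[A] C₁ :=
    { toFun := i, map_add' := map_add _, map_smul' := fun a c => by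
        rw [Algebra.smul_def]; exact hi' a c }
  let j' : D →ₗ[B] D₁ :=
    { toFun := j, map_add' := map_add _, map_smul' := fun a c => by
        rw [Algebra.smul_def]; exact hj' a c }
  let e : D ≃ₗ[B] D₁ := LinearEquiv.ofBijective j' hj
  let k' : C →ₛₗ[f] D :=
    { toFun := k, map_add' := map_add _, map_smul' := fun a c => by
        rw [Algebra.smul_def, Algebra.smul_def, map_mul]
        congr 1
        exact (RingHom.congr_fun w a).symm }
  have h1 : IsBC (ψ.comp i') :=
    (IsBC.comp_iff (f := RingHom.id A) (by simp) (isBC_of_bijective Function.bijective_id hi)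
      fun m => rfl).2 hψ
  have h2 : IsBC k' := h1.of_bijective (φ := e.symm.toLinearMap)
    (fun m => e.symm_apply_eq.2 (hij m)) e.symm.bijective
  exact (isBC_iff k' (fun _ => rfl) _ fun _ => rfl).1 h2

lemma TensorMapBijective.symm {A B C D : Type u} [CommRing A] [CommRing B] [CommRing C]
    [CommRing D] {f : A →+* B} {g : A →+* C} {h : B →+* D} {k : C →+* D}
    {w : h.comp f = k.comp g} (H : TensorMapBijective f g h k w) :
    TensorMapBijective g f k h w.symm := by
  rw [tensorMapBijective_iff_isPushout] at H
  let := f.toAlgebra; let := g.toAlgebra; let := h.toAlgebra; let := k.toAlgebra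
  let := (h.comp f).toAlgebra
  have : IsScalarTower A B D := .of_algebraMap_eq fun _ => rfl
  have : IsScalarTower A C D := .of_algebraMap_eq fun a => RingHom.congr_fun w a
  have H' : Algebra.IsPushout A C B D := Algebra.IsPushout.symm H
  let ψ : B →ₛₗ[g] D :=
    { toFun := h
      map_add' := map_add _
      map_smul' := fun a b => (map_mul h _ _).trans (congrArg (· * h b) (RingHom.congr_fun w a)) }
  have hψ : IsBC ψ := (isBC_iff ψ (fun _ => rfl) _ fun _ => rfl).2 H'.out
  exact tensorMapBijective_of_isBC w.symm hψ (AddMonoidHom.id _) Function.bijective_id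
    (fun _ _ => rfl) (AddMonoidHom.id _) Function.bijective_id (fun _ _ => rfl) fun _ => rfl

variable {X : AlgebraicGeometry.RingedSpace.{u, u}}

lemma flat_of_tensorMapBijective {A B C D : Type u} [CommRing A] [CommRing B] [CommRing C]
    [CommRing D] {f : A →+* B} {g : A →+* C} {h : B →+* D} {k : C →+* D}
    {w : h.comp f = k.comp g} (H : TensorMapBijective f g h k w) (hf : f.Flat) : k.Flat := by
  rw [tensorMapBijective_iff_isPushout] at H
  let := f.toAlgebra; let := g.toAlgebra; let := h.toAlgebra; let := k.toAlgebra
  let := (h.comp f).toAlgebra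
  have : IsScalarTower A B D := .of_algebraMap_eq fun _ => rfl
  have : IsScalarTower A C D := .of_algebraMap_eq fun a => RingHom.congr_fun w a
  have : Module.Flat A B := hf
  have : Algebra.IsPushout A C B D := H.symm
  exact Module.Flat.isBaseChange A C B D this.out

variable [Finite X] {U V W : Opens X}

/-! ### Sections of the structure sheaf -/

namespace StalkMod

variable (V) in
/-- A section of the structure sheaf as a compatible family of germs. -/
def unitSec : X.presheaf.obj (op V) →ₗ[X.presheaf.obj (op V)] (unit X).Sec (le_refl V) :=
  Sec.lift _ (RingHom.id _) (fun _ hx a => res X (minOpen_le hx) a) (fun _ _ => map_add _)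
    (fun _ hx a b => map_mul (res X (minOpen_le hx)) a b) fun _ _ _ _ _ => res_res _ _ _

lemma bijective_unitSec : Function.Bijective (unitSec V) := by
  let F : TopCat.Sheaf CommRingCat X := X.sheaf
  have hcov : V ≤ iSup fun z : V => minOpen X z.1 := fun x hx =>
    Opens.mem_iSup.2 ⟨⟨x, hx⟩, mem_minOpen x⟩
  constructor
  · intro a b hab
    exact F.eq_of_locally_eq' (fun z : V => minOpen X z.1) V (fun z => homOfLE (minOpen_le z.2)) hcov
      a b fun z => congr(Sec.val $hab z.2)
  · intro s
    have hloc (z w : V) (x : X) (hx : x ∈ minOpen X z.1 ⊓ minOpen X w.1) :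
        res X (minOpen_le (mem_left hx)) (s.val z.2) = res X (minOpen_le (mem_right hx)) (s.val w.2) :=
      (s.map_val z.2 (mem_left hx)).trans (s.map_val w.2 (mem_right hx)).symm
    obtain ⟨a, ha, -⟩ := F.existsUnique_gluing' (fun z : V => minOpen X z.1) V
      (fun z => homOfLE (minOpen_le z.2)) hcov (fun z => s.val z.2) fun z w => by
        refine F.eq_of_locally_eq' (fun x : (minOpen X z.1 ⊓ minOpen X w.1 : Opens X) => minOpen X x.1)
          _ (fun x => homOfLE (minOpen_le x.2)) (fun x hx =>
            Opens.mem_iSup.2 ⟨⟨x, hx⟩, mem_minOpen x⟩) _ _ fun x => ?_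
        refine (res_res (minOpen_le x.2) inf_le_left _).trans
          ((hloc z w x.1 x.2).trans (res_res (minOpen_le x.2) inf_le_right _).symm)
    exact ⟨a, Sec.ext fun x hx => ha ⟨x, hx⟩⟩

/-! ### The quasi-coherent module defined by a module over the global sections -/

section Pullback

variable (E : Type u) [AddCommGroup E] [Module (X.presheaf.obj (op ⊤)) E]

lemma exists_pullback_map {x y : X} (h : y ∈ minOpen X x) :
    ∃ φ : Extend (res X (le_top : minOpen X x ≤ ⊤)) E →ₛₗ[res X (minOpen_le h)]
        Extend (res X (le_top : minOpen X y ≤ ⊤)) E,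
      ∀ e, φ (Extend.mk E _ e) = Extend.mk E _ e :=
  (Extend.isBC _).exists_semilinear_lift (res_comp_res X _ _).symm _

/-- The quasi-coherent module defined by a module over the global sections. -/
def pullback : StalkMod X where
  obj x := Extend (res X (le_top : minOpen X x ≤ ⊤)) E
  map h := (exists_pullback_map E h).choose
  map_self {x} h m := by
    let φ : Extend (res X (le_top : minOpen X x ≤ ⊤)) E →ₛₗ[res X (minOpen_le h)]
        Extend (res X (le_top : minOpen X x ≤ ⊤)) E :=
      { toFun := fun m => m
        map_add' := fun _ _ => rfl
        map_smul' := fun r m => by rw [res_self] }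
    have : (exists_pullback_map E h).choose = φ := (Extend.isBC _).hom_ext fun e =>
      (exists_pullback_map E h).choose_spec e
    exact congr($this m)
  map_map {x y z} h h' m := by
    let φ : Extend (res X (le_top : minOpen X x ≤ ⊤)) E
        →ₛₗ[res X (minOpen_le (minOpen_le_minOpen h h'))]
        Extend (res X (le_top : minOpen X z ≤ ⊤)) E :=
      { toFun := fun m => (exists_pullback_map E h').choose ((exists_pullback_map E h).choose m)
        map_add' := fun _ _ => by rw [map_add, map_add]
        map_smul' := fun r m => by rw [map_smulₛₗ, map_smulₛₗ, res_res] }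
    have : φ = (exists_pullback_map E (minOpen_le_minOpen h h')).choose :=
      (Extend.isBC _).hom_ext fun e => by
        exact (congrArg _ ((exists_pullback_map E h).choose_spec e)).trans
          (((exists_pullback_map E h').choose_spec e).trans
            ((exists_pullback_map E (minOpen_le_minOpen h h')).choose_spec e).symm)
    exact congr($this m)

/-- The canonical map to a stalk of the pullback. -/
def pullbackMk (x : X) : E →ₛₗ[res X (le_top : minOpen X x ≤ ⊤)] (pullback E).obj x :=
  Extend.mk E _

lemma isBC_pullbackMk (x : X) : IsBC (pullbackMk E x) := Extend.isBC _

variable {E}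

@[simp] lemma map_pullbackMk {x y : X} (h : y ∈ minOpen X x) (e : E) :
    (pullback E).map h (pullbackMk E x e) = pullbackMk E y e :=
  (exists_pullback_map E h).choose_spec e

lemma qc_pullback : QC (pullback (X := X) E) := fun x _ y h =>
  (IsBC.comp_iff (res_comp_res X _ _).symm (isBC_pullbackMk E x) fun e =>
    (map_pullbackMk h e).symm).1 (isBC_pullbackMk E y)

lemma exists_pullback_desc {M : StalkMod X} (φ : E →ₗ[X.presheaf.obj (op ⊤)] M.Sec (le_refl ⊤)) :
    ∃ f : Hom (pullback E) M, ∀ x e,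
      f.app x (pullbackMk E x e) = (φ e).val (show x ∈ ⊤ from trivial) := by
  have h (x : X) := (isBC_pullbackMk E x).exists_lift (N' := M.obj x)
    { toFun := fun e => (φ e).val (show x ∈ ⊤ from trivial)
      map_add' := fun a b => by simp
      map_smul' := fun r a => by simp }
  choose f hf using h
  refine ⟨⟨f, fun {x y} h m => ?_⟩, hf⟩
  let p : (pullback E).obj x →ₛₗ[res X (minOpen_le h)] M.obj y :=
    { toFun := fun m => f y ((pullback E).map h m)
      map_add' := fun a b => by simp
      map_smul' := fun r m => by rw [map_smulₛₗ, map_smul] }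
  let q : (pullback E).obj x →ₛₗ[res X (minOpen_le h)] M.obj y :=
    { toFun := fun m => M.map h (f x m)
      map_add' := fun a b => by simp
      map_smul' := fun r m => by rw [map_smul, map_smulₛₗ] }
  have : p = q := (isBC_pullbackMk E x).hom_ext fun e => by
    change f y ((pullback E).map h _) = M.map h (f x _)
    rw [map_pullbackMk, hf, hf]
    exact (Sec.map_val _ _ _).symm
  exact congr($this m)

/-- The free module on the set `E` maps onto the pullback, and exactness lifts `s` to it. The
coefficients of the lift glue to global functions `a e`, and the element sought is the sum of the `a
e • e`. -/
lemma exists_sec_pullback (hΓ : SurjectiveOnSections X)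
    (s : (pullback E).Sec (le_refl ⊤)) :
    ∃ e : E, ∀ x (hx : x ∈ (⊤ : Opens X)), s.val hx = pullbackMk E x e := by
  classical
  let p : Hom (free X E) (pullback E) :=
    { app := fun x => Finsupp.linearCombination _ (pullbackMk E x)
      naturality := fun {x y} h m => by
        let m' : E →₀ stalkRing X x := m
        change Finsupp.linearCombination _ (pullbackMk E y)
            (Finsupp.mapRange (res X (minOpen_le h)) (map_zero _) m') =
          (pullback E).map h (Finsupp.linearCombination _ (pullbackMk E x) m')
        rw [Finsupp.linearCombination_apply, Finsupp.linearCombination_apply,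
          Finsupp.sum_mapRange_index (h := fun e r => r • pullbackMk E y e) (fun _ => zero_smul _ _), Finsupp.sum, Finsupp.sum, map_sum]
        exact Finset.sum_congr rfl fun e _ => by rw [map_smulₛₗ, map_pullbackMk] }
  obtain ⟨t, rfl⟩ := hΓ p (QC.free E) qc_pullback (fun x => by
    rw [← LinearMap.range_eq_top]
    exact (Finsupp.range_linearCombination _).trans (isBC_pullbackMk E x).span_range) s
  have hx (x : X) : x ∈ (⊤ : Opens X) := trivial
  let c (x : X) : E →₀ stalkRing X x := t.val (hx x)
  have ha (e : E) : ∃ a : X.presheaf.obj (op ⊤), ∀ x, res X (le_top : minOpen X x ≤ ⊤) a = c x e := by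
    obtain ⟨a, ha⟩ := bijective_unitSec.2 (Sec.mk (M := unit X) (le_refl ⊤) (fun x _ => c x e)
      fun x hx y hy => DFunLike.congr_fun (F := E →₀ stalkRing X y) (Sec.map_val t hx hy) e)
    exact ⟨a, fun x => congr(Sec.val $ha (hx x))⟩
  choose a ha using ha
  cases nonempty_fintype X
  -- Finiteness of `X` makes one finite set of indices serve at all points.
  let F : Finset E := Finset.univ.biUnion fun x => (c x).support
  refine ⟨∑ e ∈ F, a e • e, fun x _ => ?_⟩
  change Finsupp.linearCombination _ (pullbackMk E x) (c x) = _
  rw [Finsupp.linearCombination_apply, Finsupp.sum_of_support_subset (c x) (s := F)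
    (Finset.subset_biUnion_of_mem (fun x => (c x).support) (Finset.mem_univ x))
    (fun e r => r • pullbackMk E x e) (fun _ _ => zero_smul _ _), map_sum]
  exact Finset.sum_congr rfl fun e _ => by rw [map_smulₛₗ, ha]

end Pullback

end StalkMod
end Criterion
end FiniteRingedSpace

end

/-! ### Exactness of global sections implies affineness -/

noncomputable section

namespace FiniteRingedSpace

section AffineCriterion

variable {X : AlgebraicGeometry.RingedSpace.{u, u}} [Finite X] {U V W D D' : Opens X}

namespace StalkMod

variable (hΓ : SurjectiveOnSections X) (hX : ∀ x, IsAffineOpen X (minOpen X x))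

include hΓ in
-- A global section of `K` is one of the pullback, so it comes from some `e ∈ E`; since `f` kills
-- it, the hypothesis forces `e = 0`.
lemma NoSections.of_pullback {E : Type u} [AddCommGroup E] [Module (X.presheaf.obj (op ⊤)) E]
    {M K : StalkMod X} (f : Hom (pullback E) M) (i : Hom K (pullback E))
    (hi : ∀ x, Function.Injective (i.app x)) (hfi : ∀ x m, f.app x (i.app x m) = 0)
    (h : ∀ e, (∀ x, f.app x (pullbackMk E x e) = 0) → e = 0) : NoSections K := fun s => by
  obtain ⟨e, he⟩ := exists_sec_pullback hΓ (Sec.map i _ s)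
  have h0 : e = 0 := h e fun x => by
    rw [← he x trivial]
    exact hfi x _
  ext x hx
  apply hi x
  have := he x hx
  rwa [h0, map_zero, Sec.val_map, ← map_zero (i.app x)] at this

include hΓ hX

/-- If global sections are exact, quasi-coherent modules are determined by their global sections. -/
lemma isBC_germ_top {M : StalkMod X} (hM : QC M) (x : X) :
    IsBC (Sec.germ (M := M) (le_refl ⊤) (show x ∈ ⊤ from trivial)) := by
  obtain ⟨f, hf⟩ := exists_pullback_desc (M := M) LinearMap.id
  have hinj : Function.Injective (f.app x) := by
    rw [injective_iff_map_eq_zero]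
    intro m hm
    have hs : NoSections f.ker.toMod := .of_pullback hΓ f f.ker.incl f.ker.incl_injective
      (fun x m => m.2) fun e he => Sec.ext fun x hx => by
        exact (hf x e).symm.trans (he x)
    have := QC.eq_zero hΓ hX (QCOn.ker hX f qc_pullback hM) hs (x := x) ⟨m, hm⟩
    exact congr(Subtype.val $this)
  have hsurj : Function.Surjective (f.app x) := by
    have hQ : QC f.range.quot := QCOn.quot_range f qc_pullback hM
    -- A section of the cokernel lifts to a global section of `M`, which lies in the image of `f` by
    -- construction.
    have hs : NoSections f.range.quot := fun s => by
      obtain ⟨t, rfl⟩ := hΓ f.range.proj hM hQ f.range.proj_surjective s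
      exact Sec.ext fun x hx => (f.range.proj_eq_zero_iff _).2 ⟨_, hf x t⟩
    intro m
    exact (f.range.proj_eq_zero_iff m).1 (QC.eq_zero hΓ hX hQ hs _)
  exact (isBC_pullbackMk _ x).of_bijective (φ := f.app x) (hf x) ⟨hinj, hsurj⟩

/-- The truncation to `D` has global sections `Γ(D, M)` and stalk `Γ(U_y ∩ D, M)` at `y`. -/
lemma isBC_restrict_top {M : StalkMod X} (hM : QCOn D M) (y : X) :
    IsBC (Sec.restrict (M := M) (le_top : D ≤ ⊤) (inf_le_left : minOpen X y ⊓ D ≤ _) le_top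
      inf_le_right) := by
  have h1 := isBC_germ_top hΓ hX (QCOn.trunc hX hM) y
  refine (IsBC.comp_iff (f := RingHom.id _) (k := res X (le_top : minOpen X y ≤ ⊤)) (by simp)
    (isBC_of_bijective Function.bijective_id (M.bijective_truncSec D (le_refl ⊤) le_top (by simp)))
    fun s => ?_).2 h1
  rfl

lemma tensorMapBijective (y : X) (hD' : D' = minOpen X y ⊓ D) (h : D' ≤ minOpen X y)
    (h' : D' ≤ D) :
    TensorMapBijective (res X (le_top : minOpen X y ≤ ⊤)) (res X (le_top : D ≤ ⊤)) (res X h)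
      (res X h') (by rw [res_comp_res, res_comp_res]) := by
  subst hD'
  let i : X.presheaf.obj (op D) →+ (unit X).Sec (le_top : D ≤ ⊤) := (unitSec D).toAddMonoidHom
  let j : X.presheaf.obj (op (minOpen X y ⊓ D)) →+
    (unit X).Sec (inf_le_left : minOpen X y ⊓ D ≤ minOpen X y) := (unitSec _).toAddMonoidHom
  refine tensorMapBijective_of_isBC _ (isBC_restrict_top hΓ hX (QC.unit.on D) y) i bijective_unitSec
    (fun a c => Sec.ext fun x hx => ?_) j bijective_unitSec (fun a c => Sec.ext fun x hx => ?_)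
    fun c => Sec.ext fun x hx => ?_
  · exact (map_mul (res X (minOpen_le hx)) _ _).trans (by rw [res_res]; rfl)
  · exact (map_mul (res X (minOpen_le hx)) _ _).trans (by rw [res_res]; rfl)
  · exact (res_res _ _ _).symm

/-- For an ideal `I`, the kernel of the pullback of `I` mapping to `𝒪` has no global sections
because `I → 𝒪(X)` is injective; hence it vanishes. -/
lemma flat_res_top (x : X) : (res X (le_top : minOpen X x ≤ ⊤)).Flat := by
  refine flat_of_extend fun I φ hφ => ?_
  obtain ⟨f, hf⟩ := exists_pullback_desc (M := unit X) ((unitSec ⊤).comp I.subtype)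
  have hs : NoSections f.ker.toMod := .of_pullback hΓ f f.ker.incl f.ker.incl_injective
    (fun x m => m.2) fun e he => Subtype.ext (bijective_unitSec.1 (Sec.ext fun x hx => by
      refine ((hf x e).symm.trans (he x)).trans ?_
      exact (map_zero (res X (minOpen_le hx))).symm))
  have : f.app x = φ := (isBC_pullbackMk I x).hom_ext fun e => (hf x e).trans (hφ e).symm
  rw [← this]
  refine (injective_iff_map_eq_zero (f.app x)).2 fun m hm => ?_
  have := QC.eq_zero hΓ hX (QCOn.ker hX f qc_pullback QC.unit) hs (x := x) ⟨m, hm⟩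
  exact congr(Subtype.val $this)

omit hX in
-- If `I` generates every stalk, the pullback of `I` surjects onto `𝒪`. Lifting the section `1`
-- shows that it comes from `I`.
lemma eq_top_of_map_eq_top (I : Ideal (X.presheaf.obj (op ⊤)))
    (hI : ∀ x, I.map (res X (le_top : minOpen X x ≤ ⊤)) = ⊤) : I = ⊤ := by
  obtain ⟨f, hf⟩ := exists_pullback_desc (M := unit X) ((unitSec ⊤).comp I.subtype)
  obtain ⟨s, hs⟩ := hΓ f qc_pullback QC.unit (fun x => by
    rw [← LinearMap.range_eq_top]
    refine top_le_iff.1 ((hI x).ge.trans (Ideal.map_le_iff_le_comap.2 fun r hr => ?_))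
    exact ⟨pullbackMk I x ⟨r, hr⟩, hf x _⟩) (unitSec ⊤ 1)
  obtain ⟨e, he⟩ := exists_sec_pullback hΓ s
  have : unitSec ⊤ 1 = unitSec ⊤ e.1 := by
    rw [← hs]
    ext x hx
    rw [Sec.val_map, he, hf]
    rfl
  rw [Ideal.eq_top_iff_one, bijective_unitSec.1 this]
  exact e.2

/-- A schematic space is affine if global sections of quasi-coherent modules are exact. -/
theorem isAffine_of_surjectiveOnSections : IsAffine X where
  faithfullyFlat := faithfullyFlat_pi (f := fun z : (⊤ : Opens X) => res X (minOpen_le z.2))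
    (fun z => flat_res_top hΓ hX z.1) fun I hI => eq_top_of_map_eq_top hΓ I fun x => hI ⟨x, trivial⟩
  tensor x y hx hy := tensorMapBijective hΓ hX x rfl _ _
  faithfullyFlat_inf x _ y _ := by
    refine faithfullyFlat_pi (f := fun z : (minOpen X x ⊓ minOpen X y : Opens X) =>
      res X (minOpen_le z.2)) (fun z => flat_of_tensorMapBijective (tensorMapBijective hΓ hX z.1
        (inf_eq_left.2 (minOpen_le z.2)).symm (le_refl _) (minOpen_le z.2)) (flat_res_top hΓ hX z.1))
      fun I hI => ?_
    let D := minOpen X x ⊓ minOpen X y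
    -- The goal is `E = 0`. Its pullback has zero stalks on `D`, while `E` itself is recovered from
    -- sections of the pullback over `U_x ∩ U_y = D`.
    let E := X.presheaf.obj (op D) ⧸ I
    let : Module (X.presheaf.obj (op ⊤)) E := Module.compHom _ (res X (le_top : D ≤ ⊤))
    let : Module (stalkRing X x) E := Module.compHom _ (res X (inf_le_left : D ≤ minOpen X x))
    let : Module (stalkRing X y) E := Module.compHom _ (res X (inf_le_right : D ≤ minOpen X y))
    -- Tensoring `E` with `𝒪_z` over `𝒪(X)` or over `𝒪(D)` gives the same module by the tensor
    -- condition, and the latter is zero since `I` generates the unit ideal at `z`.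
    have hE (z : X) (hz : z ∈ D) : Subsingleton ((pullback (X := X) E).obj z) := by
      have H := (tensorMapBijective hΓ hX z
        (inf_eq_left.2 (minOpen_le hz)).symm (le_refl _) (minOpen_le hz)).symm
      have h1 : Subsingleton (Extend (res X (minOpen_le hz)) E) :=
        (Extend.isBC (M := E) _).subsingleton (hI ⟨z, hz⟩) fun r hr e => by
          obtain ⟨e, rfl⟩ := Ideal.Quotient.mk_surjective e
          exact (Submodule.Quotient.mk_smul I r e).symm.trans
            ((Submodule.Quotient.mk_eq_zero I).2 (I.mul_mem_right e hr))
      let ψ : E →ₛₗ[res X (le_top : minOpen X z ≤ ⊤)] Extend (res X (minOpen_le hz)) E :=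
        { toFun := Extend.mk E (res X (minOpen_le hz))
          map_add' := map_add _
          map_smul' := fun r e => by
            refine ((Extend.mk E (res X (minOpen_le hz))).map_smulₛₗ (res X le_top r) e).trans ?_
            rw [res_res] }
      have h2 : IsBC ψ := IsBC.of_pushout H (fun _ _ => rfl) (fun _ _ => by rw [res_self])
        (Extend.isBC _) fun _ => rfl
      obtain ⟨φ, hφ⟩ := (isBC_pullbackMk E z).exists_lift ψ
      exact ((isBC_pullbackMk E z).bijective_of_bc h2 hφ).1.subsingleton
    let M := pullback (X := X) E
    have hM : QC M := qc_pullback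
    obtain ⟨γ, hγ⟩ := (isBC_pullbackMk E x).exists_lift (N' := E)
      { toFun := fun e => e
        map_add' := fun _ _ => rfl
        map_smul' := fun r e => by
          change res X (le_top : D ≤ ⊤) r • e = res X (inf_le_left : D ≤ minOpen X x) (res X le_top r) • e
          rw [res_res] }
    -- The retraction `γ` of the stalk at `x` onto `E` factors through restriction to `U_y ∩ U_x`,
    -- since sections there are `Γ(U_x, M) ⊗ 𝒪_y` and `E` is also an `𝒪_y`-module. Those sections
    -- are zero by `hE`.
    obtain ⟨δ, hδ⟩ := (isBC_restrict_top hΓ hX (hM.on (minOpen X x)) y).exists_lift (N' := E)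
      { toFun := fun s => γ (s.val (mem_minOpen x))
        map_add' := fun _ _ => by rw [Sec.val_add, map_add]
        map_smul' := fun r s => by
          rw [Sec.val_smul, map_smul]
          change res X (inf_le_left : D ≤ minOpen X x) (res X le_top r) • γ (s.val (mem_minOpen x)) =
            res X (inf_le_right : D ≤ minOpen X y) (res X le_top r) • γ (s.val (mem_minOpen x))
          rw [res_res, res_res] }
    have h0 (e : E) : e = 0 := by
      let s : M.Sec (le_top : minOpen X x ≤ ⊤) := Sec.mk _ (fun z _ => pullbackMk E z e)
        fun z _ w hw => map_pullbackMk hw e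
      have h1 : Sec.restrict (M := M) (le_top : minOpen X x ≤ ⊤)
          (inf_le_left : minOpen X y ⊓ minOpen X x ≤ _) le_top inf_le_right s = 0 :=
        Sec.ext fun z hz => @Subsingleton.elim _ (hE z (mem_inf (mem_right hz) (mem_left hz))) _ _
      have h2 := hδ s
      rw [h1, map_zero] at h2
      exact (h2.trans (hγ e)).symm
    exact (Ideal.eq_top_iff_one I).2 ((Submodule.Quotient.mk_eq_zero I).1 (h0 (Ideal.Quotient.mk I 1)))

end StalkMod
end AffineCriterion
end FiniteRingedSpace

end

/-! ### Godement modules and acyclicity on affine open sets -/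

noncomputable section

namespace FiniteRingedSpace

section Acyclic

variable {X : AlgebraicGeometry.RingedSpace.{u, u}} [Finite X] {U V W : Opens X}

namespace StalkMod

variable {M N P F : StalkMod X}

/-- Discontinuous sections on a minimal open set. -/
def Discontinuous (F : StalkMod X) (x : X) : Type u := ∀ y : minOpen X x, F.obj y.1

instance (F : StalkMod X) (x : X) : AddCommGroup (Discontinuous F x) :=
  inferInstanceAs (AddCommGroup (∀ y : minOpen X x, F.obj y.1))

instance (F : StalkMod X) (x : X) : Module (stalkRing X x) (Discontinuous F x) where
  smul r s y := res X (minOpen_le y.2) r • s y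
  one_smul s := funext fun y => by
    change res X (minOpen_le y.2) 1 • s y = s y
    rw [map_one, one_smul]
  mul_smul a b s := funext fun y => by
    change res X (minOpen_le y.2) (a * b) • s y =
      res X (minOpen_le y.2) a • res X (minOpen_le y.2) b • s y
    rw [map_mul, mul_smul]
  smul_zero a := funext fun y => smul_zero (res X (minOpen_le y.2) a)
  smul_add a s t := funext fun y => smul_add (res X (minOpen_le y.2) a) (s y) (t y)
  add_smul a b s := funext fun y => by
    change res X (minOpen_le y.2) (a + b) • s y =
      res X (minOpen_le y.2) a • s y + res X (minOpen_le y.2) b • s y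
    rw [map_add, add_smul]
  zero_smul s := funext fun y => by
    change res X (minOpen_le y.2) 0 • s y = 0
    rw [map_zero, zero_smul]

/-- The Godement module of discontinuous sections. -/
def godement (F : StalkMod X) : StalkMod X where
  obj x := Discontinuous F x
  map h :=
    { toFun := fun s y => s ⟨y.1, minOpen_le_minOpen h y.2⟩
      map_add' := fun _ _ => rfl
      map_smul' := fun r s => funext fun y =>
        congrArg (· • s ⟨y.1, minOpen_le_minOpen h y.2⟩)
        (res_res (minOpen_le y.2) (minOpen_le h) r).symm }
  map_self _ _ := rfl
  map_map _ _ _ := rfl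

/-- The values of an element of a stalk of the Godement module. -/
def gval {x : X} (s : (godement F).obj x) {y : X} (hy : y ∈ minOpen X x) : F.obj y := s ⟨y, hy⟩

lemma gext {x : X} {s t : (godement F).obj x}
    (h : ∀ y (hy : y ∈ minOpen X x), gval s hy = gval t hy) : s = t :=
  funext fun y => h y.1 y.2

/-- An element of a stalk of the Godement module. -/
def gmk {x : X} (s : ∀ y ∈ minOpen X x, F.obj y) : (godement F).obj x := fun y => s y.1 y.2

@[simp] lemma gval_map {x y z : X} (h : y ∈ minOpen X x) (s : (godement F).obj x)
    (hz : z ∈ minOpen X y) :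
    gval ((godement F).map h s) hz = gval s (minOpen_le_minOpen h hz) := rfl

variable (F) in
/-- The inclusion of a module in its Godement module. -/
def toGodement : Hom F (godement F) where
  app _ :=
    { toFun := fun m => gmk fun _ hy => F.map hy m
      map_add' := fun _ _ => gext fun _ _ => map_add _ _ _
      map_smul' := fun _ _ => gext fun _ hy => map_smulₛₗ (F.map hy) _ _ }
  naturality _ _ := gext fun _ _ => F.map_map _ _ _

@[simp] lemma gval_toGodement {x y : X} (m : F.obj x) (hy : y ∈ minOpen X x) :
    gval ((toGodement F).app x m) hy = F.map hy m := rfl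

lemma toGodement_injective (x : X) : Function.Injective ((toGodement F).app x) := fun a b h => by
  have := congr(gval $h (mem_minOpen x))
  simpa [F.map_self] using this

/-- Functoriality of the Godement module. -/
def Hom.godement (f : Hom M N) : Hom (godement M) (godement N) where
  app _ :=
    { toFun := fun s => gmk fun y hy => f.app y (gval s hy)
      map_add' := fun _ _ => gext fun _ _ => map_add _ _ _
      map_smul' := fun _ _ => gext fun _ _ => map_smul _ _ _ }
  naturality _ _ := rfl

lemma godement_toGodement (f : Hom M N) {x : X} (m : M.obj x) :
    f.godement.app x ((toGodement M).app x m) = (toGodement N).app x (f.app x m) :=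
  gext fun _ hy => f.naturality hy m

variable (F) in
/-- The cokernel of a module in its Godement module. -/
abbrev cosyzygy : StalkMod X := (toGodement F).range.quot

variable (F) in
/-- The projection to the cosyzygy. -/
abbrev toCosyzygy : Hom (godement F) (cosyzygy F) := (toGodement F).range.proj

lemma toCosyzygy_eq_zero_iff {x : X} (s : (godement F).obj x) :
    (toCosyzygy F).app x s = 0 ↔ ∃ m, (toGodement F).app x m = s :=
  Sub.proj_eq_zero_iff _ _

@[simp] lemma toCosyzygy_toGodement {x : X} (m : F.obj x) :
    (toCosyzygy F).app x ((toGodement F).app x m) = 0 :=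
  (toCosyzygy_eq_zero_iff _).2 ⟨m, rfl⟩

/-- Functoriality of the cosyzygy. -/
def Hom.cosyzygy (f : Hom M N) : Hom (cosyzygy M) (cosyzygy N) where
  app x := Submodule.mapQ _ _ (f.godement.app x) (by
    rintro _ ⟨m, rfl⟩
    exact ⟨f.app x m, (godement_toGodement f m).symm⟩)
  naturality h m := by
    obtain ⟨m, rfl⟩ := Submodule.Quotient.mk_surjective _ m
    rfl

@[simp] lemma cosyzygy_toCosyzygy (f : Hom M N) {x : X} (s : (StalkMod.godement M).obj x) :
    f.cosyzygy.app x ((toCosyzygy M).app x s) = (toCosyzygy N).app x (f.godement.app x s) := rfl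

/-- `VanishOn n V F` says that the cohomology of `F` on `V` vanishes in degree `n + 1`. -/
def VanishOn : ℕ → Opens X → StalkMod X → Prop
  | 0, V, F => Function.Surjective (Sec.map (toCosyzygy F) (le_refl V))
  | n + 1, V, F => VanishOn n V (cosyzygy F)

/-- Short exact sequences on an open set. -/
structure ExactOn (V : Opens X) (f : Hom M N) (g : Hom N P) : Prop where
  injective : ∀ x ∈ V, Function.Injective (f.app x)
  exact : ∀ x ∈ V, Function.Exact (f.app x) (g.app x)
  surjective : ∀ x ∈ V, Function.Surjective (g.app x)

namespace ExactOn

variable {f : Hom M N} {g : Hom N P}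

lemma exists_sec (h : ExactOn V f g) {hV : V ≤ U} (s : N.Sec hV) (hs : Sec.map g _ s = 0) :
    ∃ t, Sec.map f _ t = s := by
  have h1 (x : X) (hx : x ∈ V) : ∃ m, f.app x m = s.val hx :=
    (h.exact x hx _).1 congr(Sec.val $hs hx)
  choose t ht using h1
  refine ⟨Sec.mk _ t fun x hx y hy => h.injective y (minOpen_le hx hy) ?_, Sec.ext ht⟩
  rw [f.naturality, ht, ht, Sec.map_val]

lemma sec_injective (h : ExactOn V f g) (hV : V ≤ U) : Function.Injective (Sec.map f hV) :=
  fun _ _ hst => Sec.ext fun x hx => h.injective x hx congr(Sec.val $hst hx)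

lemma godement (h : ExactOn V f g) : ExactOn V f.godement g.godement where
  injective x hx _ _ hst := gext fun y hy => h.injective y (minOpen_le hx hy) congr(gval $hst hy)
  exact x hx s := by
    constructor
    · intro hs
      have h1 (y : X) (hy : y ∈ minOpen X x) : ∃ m, f.app y m = gval s hy :=
        (h.exact y (minOpen_le hx hy) _).1 congr(gval $hs hy)
      choose t ht using h1
      exact ⟨gmk t, gext ht⟩
    · rintro ⟨s, rfl⟩
      exact gext fun y hy => (h.exact y (minOpen_le hx hy) _).2 ⟨_, rfl⟩
  surjective x hx s := by
    have h1 (y : X) (hy : y ∈ minOpen X x) := h.surjective y (minOpen_le hx hy) (gval s hy)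
    choose t ht using h1
    exact ⟨gmk t, gext ht⟩

lemma cosyzygy (h : ExactOn V f g) : ExactOn V f.cosyzygy g.cosyzygy where
  injective x hx := by
    rw [injective_iff_map_eq_zero]
    intro s hs
    obtain ⟨s, rfl⟩ := (toGodement M).range.proj_surjective x s
    rw [cosyzygy_toCosyzygy, toCosyzygy_eq_zero_iff] at hs
    obtain ⟨n, hn⟩ := hs
    have h1 : g.app x n = 0 := toGodement_injective x (by
      rw [← godement_toGodement, hn, map_zero]
      exact (h.godement.exact x hx _).2 ⟨s, rfl⟩)
    obtain ⟨m, rfl⟩ := (h.exact x hx n).1 h1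
    rw [toCosyzygy_eq_zero_iff]
    exact ⟨m, h.godement.injective x hx (by rw [godement_toGodement, hn])⟩
  exact x hx s := by
    constructor
    · intro hs
      obtain ⟨s, rfl⟩ := (toGodement N).range.proj_surjective x s
      rw [cosyzygy_toCosyzygy, toCosyzygy_eq_zero_iff] at hs
      obtain ⟨q, hq⟩ := hs
      obtain ⟨n, rfl⟩ := h.surjective x hx q
      obtain ⟨t, ht⟩ := (h.godement.exact x hx (s - (toGodement N).app x n)).1 (by
        rw [map_sub, godement_toGodement, hq, sub_self])
      exact ⟨(toCosyzygy M).app x t, by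
        rw [cosyzygy_toCosyzygy, ht, map_sub, toCosyzygy_toGodement, sub_zero]⟩
    · rintro ⟨s, rfl⟩
      obtain ⟨s, rfl⟩ := (toGodement M).range.proj_surjective x s
      rw [cosyzygy_toCosyzygy, cosyzygy_toCosyzygy, (h.godement.exact x hx _).2 ⟨s, rfl⟩, map_zero]
  surjective x hx s := by
    obtain ⟨s, rfl⟩ := (toGodement P).range.proj_surjective x s
    obtain ⟨t, rfl⟩ := h.godement.surjective x hx s
    exact ⟨(toCosyzygy N).app x t, cosyzygy_toCosyzygy g t⟩

/-- A discontinuous section is lifted point by point, with no compatibility to check. -/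
lemma surjective_godement_sec (h : ExactOn V f g) :
    Function.Surjective (Sec.map g.godement (le_refl V)) := by
  intro s
  have h1 (x : X) (hx : x ∈ V) := h.surjective x hx (gval (s.val hx) (mem_minOpen x))
  choose t ht using h1
  refine ⟨Sec.mk _ (fun x hx => gmk fun y hy => t y (minOpen_le hx hy)) fun x hx y hy => rfl,
    Sec.ext fun x hx => gext fun y hy => ?_⟩
  refine (ht y (minOpen_le hx hy)).trans ?_
  rw [← s.map_val hx hy]
  rfl

/-- This is the piece `Γ(N) → Γ(P) → H¹(M) → H¹(N)` of the long exact sequence, chased through the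
Godement modules. -/
lemma vanishOn_zero (h : ExactOn V f g) (hg : Function.Surjective (Sec.map g (le_refl V)))
    (hN : VanishOn 0 V N) : VanishOn 0 V M := by
  intro t
  obtain ⟨s, hs⟩ := hN (Sec.map f.cosyzygy _ t)
  have h1 (x : X) (hx : x ∈ V) : (toCosyzygy P).app x (g.godement.app x (s.val hx)) = 0 := by
    have h2 := congr(Sec.val $hs hx)
    rw [Sec.val_map, Sec.val_map] at h2
    rw [← cosyzygy_toCosyzygy, h2]
    exact (h.cosyzygy.exact x hx _).2 ⟨_, rfl⟩
  choose q hq using fun x hx => (toCosyzygy_eq_zero_iff _).1 (h1 x hx)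
  -- The lift `s` maps to zero in the cosyzygy of `P`, so its image comes from a section `q` of `P`;
  -- subtracting a lift of `q` to `N` moves `s` into the Godement module of `M`.
  obtain ⟨n, hn⟩ := hg (Sec.mk _ q fun x hx y hy => toGodement_injective y (by
    rw [(toGodement P).naturality, hq, hq, ← g.godement.naturality, s.map_val]))
  obtain ⟨m, hm⟩ := h.godement.exists_sec (s - Sec.map (toGodement N) _ n) (Sec.ext fun x hx => by
    rw [Sec.val_map, Sec.val_sub, map_sub, Sec.val_map, godement_toGodement, ← Sec.val_map g, hn,
      Sec.val_mk, hq, sub_self, Sec.val_zero])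
  refine ⟨m, h.cosyzygy.sec_injective _ (Sec.ext fun x hx => ?_)⟩
  rw [Sec.val_map, Sec.val_map, cosyzygy_toCosyzygy, ← Sec.val_map f.godement, hm, Sec.val_sub,
    map_sub, Sec.val_map, toCosyzygy_toGodement, sub_zero, ← Sec.val_map (toCosyzygy N), hs]

/-- The piece `H^{n+1}(P) → H^{n+2}(M) → H^{n+2}(N)`, by passing to cosyzygies until degree one is
reached. -/
lemma vanishOn_succ {n : ℕ} (h : ExactOn V f g) (hP : VanishOn n V P)
    (hN : VanishOn (n + 1) V N) : VanishOn (n + 1) V M := by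
  induction n generalizing M N P with
  | zero =>
    refine h.cosyzygy.vanishOn_zero (fun s => ?_) hN
    obtain ⟨s, rfl⟩ := hP s
    obtain ⟨s, rfl⟩ := h.surjective_godement_sec s
    exact ⟨Sec.map (toCosyzygy N) _ s, rfl⟩
  | succ n ih => exact ih h.cosyzygy hP hN

end ExactOn

/-- `F` is a direct summand of its Godement module. -/
def Splits (F : StalkMod X) : Prop :=
  ∃ r : Hom (godement F) F, ∀ x m, r.app x ((toGodement F).app x m) = m

lemma Splits.of_retract (hN : Splits N) (i : Hom M N) (p : Hom N M)
    (hp : ∀ x m, p.app x (i.app x m) = m) : Splits M := by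
  obtain ⟨r, hr⟩ := hN
  refine ⟨(p.comp r).comp i.godement, fun x m => ?_⟩
  change p.app x (r.app x (i.godement.app x ((toGodement M).app x m))) = m
  rw [godement_toGodement, hr, hp]

/-- The retraction reads the component at `z` from the member of the family indexed by `z` itself.
-/
lemma splits_trunc_godement (F : StalkMod X) (W : Opens X) : Splits ((godement F).trunc W) := by
  refine ⟨⟨fun y =>
    { toFun := fun h => Sec.mk (M := godement F) inf_le_left
        (fun v hv => gmk fun z hz => gval (truncVal (gval h (minOpen_le_minOpen (mem_left hv) hz))
          (mem_inf (mem_minOpen z) (minOpen_le (mem_right hv) hz))) (mem_minOpen z))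
        fun _ _ _ _ => rfl
      map_add' := fun _ _ => rfl
      map_smul' := fun r h => trunc_ext fun v hv => gext fun z hz => ?_ }, fun _ _ => rfl⟩,
    fun y m => trunc_ext fun v hv => gext fun z hz => ?_⟩
  · have e : res X (le_refl (minOpen X z)) (res X (le_refl (minOpen X z))
        (res X (minOpen_le (minOpen_le_minOpen (mem_left hv) hz)) r)) =
        res X (minOpen_le hz) (res X (minOpen_le (mem_left hv)) r) := by simp only [res_res]
    exact congrArg (· • gval (truncVal (gval h (minOpen_le_minOpen (mem_left hv) hz))
          (mem_inf (mem_minOpen z) (minOpen_le (mem_right hv) hz))) (mem_minOpen z)) e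
  · exact congr(gval $(map_truncVal m hv hz) (mem_minOpen z)).symm

lemma splits_godement (F : StalkMod X) : Splits (godement F) := by
  refine ⟨⟨fun y =>
    { toFun := fun h => gmk fun z hz => gval (gval h hz) (mem_minOpen z)
      map_add' := fun _ _ => rfl
      map_smul' := fun r h => gext fun z hz => ?_ }, fun _ _ => rfl⟩,
    fun y m => gext fun z hz => rfl⟩
  exact congrArg (· • gval (gval h hz) (mem_minOpen z))
    (res_self (le_refl (minOpen X z)) (res X (minOpen_le hz) r))

lemma Splits.exists_section (hF : Splits F) :
    ∃ σ : Hom (cosyzygy F) (godement F), ∀ x m, (toCosyzygy F).app x (σ.app x m) = m := by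
  obtain ⟨r, hr⟩ := hF
  refine ⟨⟨fun x => Submodule.liftQ _ (LinearMap.id - ((toGodement F).app x).comp (r.app x)) ?_,
    fun h m => ?_⟩, fun x m => ?_⟩
  · rintro _ ⟨m, rfl⟩
    rw [LinearMap.mem_ker, LinearMap.sub_apply, LinearMap.comp_apply, hr, LinearMap.id_apply,
      sub_self]
  · obtain ⟨m, rfl⟩ := (toGodement F).range.proj_surjective _ m
    change (godement F).map h m - (toGodement F).app _ (r.app _ ((godement F).map h m)) =
      (godement F).map h (m - (toGodement F).app _ (r.app _ m))
    rw [r.naturality, (toGodement F).naturality, map_sub]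
  · obtain ⟨m, rfl⟩ := (toGodement F).range.proj_surjective _ m
    change (toCosyzygy F).app x (m - (toGodement F).app _ (r.app _ m)) = _
    rw [map_sub, toCosyzygy_toGodement, sub_zero]

lemma Splits.cosyzygy (hF : Splits F) : Splits (cosyzygy F) := by
  obtain ⟨σ, hσ⟩ := hF.exists_section
  exact (splits_godement F).of_retract σ (toCosyzygy F) hσ

lemma Splits.vanishOn (hF : Splits F) (n : ℕ) (V : Opens X) : VanishOn n V F := by
  induction n generalizing F with
  | zero =>
    obtain ⟨σ, hσ⟩ := hF.exists_section
    exact fun s => ⟨Sec.map σ _ s, Sec.ext fun x hx => hσ x _⟩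
  | succ n ih => exact ih hF.cosyzygy

/-- Sections over `U_z` are the stalk at `z`, which is exact, and this persists for all cosyzygies.
-/
lemma vanishOn_minOpen (n : ℕ) (z : X) (F : StalkMod X) : VanishOn n (minOpen X z) F := by
  induction n generalizing F with
  | zero =>
    intro s
    obtain ⟨t, ht⟩ := (toGodement F).range.proj_surjective z (s.val (mem_minOpen z))
    refine ⟨Sec.ofObj _ (le_refl _) t, Sec.ext fun x hx => ?_⟩
    rw [Sec.val_map, Sec.val_ofObj, (toCosyzygy F).naturality, ht, Sec.map_val]
  | succ n ih => exact ih _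

lemma exactOn_godement (V : Opens X) (F : StalkMod X) :
    ExactOn V (toGodement F) (toCosyzygy F) where
  injective x _ := toGodement_injective x
  exact x _ := exact_proj_range _ x
  surjective x _ := (toGodement F).range.proj_surjective x

lemma exactOn_trunc_godement {F : StalkMod X}
    (hV : ∀ y ∈ V, VanishOn 0 (minOpen X y ⊓ W) F) :
    ExactOn V ((toGodement F).trunc W) ((toCosyzygy F).trunc W) where
  injective x _ := (exactOn_godement _ F).sec_injective _
  exact x _ s := by
    constructor
    · exact (exactOn_godement _ F).exists_sec s
    · rintro ⟨t, rfl⟩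
      exact trunc_ext fun z hz => toCosyzygy_toGodement _
  surjective x hx := hV x hx

/-- Vanishing of cohomology for the extension of a module from an open set. -/
lemma vanishOn_trunc {n : ℕ} (hV : ∀ n, ∀ y ∈ V, VanishOn n (minOpen X y ⊓ W) F)
    (h : ∀ n, VanishOn n (V ⊓ W) F) : VanishOn n V (F.trunc W) := by
  induction n generalizing F with
  | zero =>
    -- The hypothesis on the `U_y ∩ W` says that higher direct images vanish, so the truncated
    -- Godement sequence stays exact on `V`. Its middle term is acyclic, and its sections over `V`
    -- are those of the original sequence over `V ∩ W`.
    refine (exactOn_trunc_godement (hV 0)).vanishOn_zero (fun s => ?_)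
      ((splits_trunc_godement F W).vanishOn _ _)
    obtain ⟨s, rfl⟩ := ((cosyzygy F).bijective_truncSec W (le_refl V) inf_le_left rfl).2 s
    obtain ⟨t, ht⟩ := h 0 s
    refine ⟨(godement F).truncSec W (le_refl V) inf_le_left rfl t, ?_⟩
    rw [← ht]
    rfl
  | succ n ih =>
    exact (exactOn_trunc_godement (hV 0)).vanishOn_succ
      (ih (fun n => hV (n + 1)) (fun n => h (n + 1))) ((splits_trunc_godement F W).vanishOn _ _)

variable (X) in
/-- The zero module. -/
def zero : StalkMod X where
  obj _ := PUnit
  map _ := 0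
  map_self _ _ := rfl
  map_map _ _ _ := rfl

lemma splits_zero : Splits (zero X) := ⟨⟨fun _ => 0, fun _ _ => rfl⟩, fun _ _ => rfl⟩

lemma vanishOn_of_bijective (f : Hom M N) (hf : ∀ x ∈ V, Function.Bijective (f.app x)) {n : ℕ}
    (hN : VanishOn n V N) : VanishOn n V M := by
  let g : Hom N (zero X) := ⟨fun _ => 0, fun _ _ => rfl⟩
  have h : ExactOn V f g :=
    { injective := fun x hx => (hf x hx).1
      exact := fun x hx m => ⟨fun _ => (hf x hx).2 m, fun _ => rfl⟩
      surjective := fun x hx m => ⟨0, rfl⟩ }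
  cases n with
  | zero => exact h.vanishOn_zero (fun s => ⟨0, Sec.ext fun _ _ => rfl⟩) hN
  | succ n => exact h.vanishOn_succ (splits_zero.vanishOn _ _) hN

section Pi

variable {ι : Type u} (G : ι → StalkMod X)

/-- Products of modules. -/
def pi : StalkMod X where
  obj x := ∀ i, (G i).obj x
  map h :=
    { toFun := fun m i => (G i).map h (m i)
      map_add' := fun _ _ => funext fun _ => map_add _ _ _
      map_smul' := fun r m => funext fun i => ((G i).map h).map_smulₛₗ r (m i) }
  map_self _ _ := funext fun i => (G i).map_self _ _
  map_map _ _ _ := funext fun i => (G i).map_map _ _ _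

/-- The projections of a product. -/
def piProj (i : ι) : Hom (pi G) (G i) where
  app _ := LinearMap.proj i
  naturality _ _ := rfl

/-- Homomorphisms into a product. -/
def piLift (f : ∀ i, Hom M (G i)) : Hom M (pi G) where
  app x := LinearMap.pi fun i => (f i).app x
  naturality h m := funext fun i => (f i).naturality h m

variable {G}

lemma QC.pi [Finite ι] (h : ∀ i, QC (G i)) : QC (pi G) := fun x hx y hy =>
  IsBC.pi (g := fun i => (G i).map hy) (fun i => h i x hx y hy) fun _ _ => rfl

lemma exists_toGodement_pi {x : X} (s : (godement (StalkMod.pi G)).obj x)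
    (h : ∀ i, ∃ m, (toGodement (G i)).app x m = (piProj G i).godement.app x s) :
    ∃ m, (toGodement (StalkMod.pi G)).app x m = s := by
  choose m hm using h
  exact ⟨m, gext fun y hy => funext fun i => congr(gval $(hm i) hy)⟩

/-- Discontinuous sections commute with products, and so do cosyzygies, so lifts can be chosen
componentwise. -/
lemma vanishOn_pi {n : ℕ} (h : ∀ i, VanishOn n V (G i)) : VanishOn n V (StalkMod.pi G) := by
  induction n generalizing G with
  | zero =>
    intro t
    choose g hg using fun i => h i (Sec.map (piProj G i).cosyzygy _ t)
    let s : (godement (StalkMod.pi G)).Sec (le_refl V) := Sec.mk _ (fun x hx => gmk fun y hy i =>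
      gval ((g i).val hx) hy) fun x hx y hy => gext fun z hz => funext fun i =>
        congr(gval $((g i).map_val hx hy) hz)
    refine ⟨s, Sec.ext fun x hx => ?_⟩
    obtain ⟨t', ht'⟩ := (toGodement (StalkMod.pi G)).range.proj_surjective x (t.val hx)
    rw [Sec.val_map, ← ht', ← sub_eq_zero, ← map_sub, toCosyzygy_eq_zero_iff]
    refine exists_toGodement_pi _ fun i => ?_
    rw [← toCosyzygy_eq_zero_iff, map_sub, map_sub, ← cosyzygy_toCosyzygy _ t', ht', sub_eq_zero]
    exact congr(Sec.val $(hg i) hx)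
  | succ n ih =>
    refine vanishOn_of_bijective (piLift _ fun i => (piProj G i).cosyzygy) (fun x hx => ⟨?_, ?_⟩)
      (ih h)
    · rw [injective_iff_map_eq_zero]
      intro s hs
      obtain ⟨s, rfl⟩ := (toGodement (StalkMod.pi G)).range.proj_surjective x s
      rw [toCosyzygy_eq_zero_iff]
      exact exists_toGodement_pi _ fun i => (toCosyzygy_eq_zero_iff _).1 (congrFun hs i)
    · intro s
      choose t ht using fun i => (toGodement (G i)).range.proj_surjective x (s i)
      exact ⟨(toCosyzygy (StalkMod.pi G)).app x (gmk fun y hy i => gval (t i) hy), funext ht⟩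

end Pi

/-- Higher cohomology of quasi-coherent modules vanishes on affine open sets. -/
theorem IsAffineOpen.vanishOn (hX : ∀ x, IsAffineOpen X (minOpen X x)) (hV : IsAffineOpen X V)
    (hM : QC M) (n : ℕ) : VanishOn n V M := by
  induction hc : (V : Set X).ncard using Nat.strong_induction_on generalizing V M n with
  | _ c ih =>
    by_cases hz : ∃ z, V = minOpen X z
    · obtain ⟨z, rfl⟩ := hz
      exact vanishOn_minOpen n z M
    · push Not at hz
      -- The sets `U_y ∩ U_z` are affine and lie in `U_z ≠ V`, so the induction hypothesis applies
      -- to them, while on `V ∩ U_z = U_z` cohomology vanishes anyway.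
      have hT (z : V) {M : StalkMod X} (hM : QC M) (n : ℕ) :
          VanishOn n V (M.trunc (minOpen X z.1)) := by
        refine vanishOn_trunc (fun n y hy => ?_) fun n => ?_
        · refine ih _ ?_ (hV.inf_minOpen hy z.2) hM n rfl
          rw [← hc]
          refine Set.ncard_lt_ncard (lt_of_le_of_lt (b := (minOpen X z.1 : Set X))
            (fun x hx => hx.2) ?_)
          exact lt_of_le_of_ne (minOpen_le z.2) fun h => hz z.1 (SetLike.coe_injective h.symm)
        · rw [inf_eq_right.2 (minOpen_le z.2)]
          exact vanishOn_minOpen n z.1 M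
      have hQT (z : V) {M : StalkMod X} (hM : QC M) : QC (M.trunc (minOpen X z.1)) :=
        QCOn.trunc hX (hM.on _)
      have hP {M : StalkMod X} (hM : QC M) (n : ℕ) :
          VanishOn n V (StalkMod.pi fun z : V => M.trunc (minOpen X z.1)) :=
        vanishOn_pi fun z => hT z hM n
      -- Injectivity at `x ∈ V` is visible in the factor `z = x`.
      have hex (M : StalkMod X) : ExactOn V (piLift _ fun z : V => M.toTrunc (minOpen X z.1))
          (piLift _ fun z : V => M.toTrunc (minOpen X z.1)).range.proj :=
        { injective := fun x hx a b h => by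
            have : M.map (mem_minOpen x) a = M.map (mem_minOpen x) b :=
              congr(truncVal $(congrFun h ⟨x, hx⟩) (mem_inf (mem_minOpen x) (mem_minOpen x)))
            rwa [M.map_self, M.map_self] at this
          exact := fun x _ => exact_proj_range _ x
          surjective := fun x _ => Sub.proj_surjective _ x }
      induction n generalizing M with
      | zero =>
        -- In degree one the affineness of `V` enters: the quasi-coherent cokernel receives all its
        -- sections over `V` from the product. Higher degrees shift down to this one.
        refine (hex M).vanishOn_zero (surjective_sec_map hV _ (QC.on (QC.pi fun z => hQT z hM) V) ?_
          (Sub.proj_surjective _)) (hP hM 0)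
        exact QC.on (QCOn.quot_range _ hM (QC.pi fun z => hQT z hM)) V
      | succ n ihn =>
        exact (hex M).vanishOn_succ (ihn (QCOn.quot_range _ hM (QC.pi fun z => hQT z hM)))
          (hP hM (n + 1))

end StalkMod
end Acyclic
end FiniteRingedSpace

end

/-! ### Passage between sheaves of modules and stalk data -/

noncomputable section

namespace FiniteRingedSpace

section Sheaves

variable {X : AlgebraicGeometry.RingedSpace.{u, u}}

/-! ### Sections of sheaves of modules -/

/-- The sections of an `𝒪_X`-module over an open set. -/
def sec (M : ModX X) (U : Opens X) : Type u := M.val.obj (op U)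

instance (M : ModX X) (U : Opens X) : AddCommGroup (sec M U) :=
  inferInstanceAs (AddCommGroup (M.val.obj (op U)))

instance (M : ModX X) (U : Opens X) : Module (X.presheaf.obj (op U)) (sec M U) :=
  (M.val.obj (op U)).isModule

/-- The restriction of sections of an `𝒪_X`-module. -/
def secRes (M : ModX X) {U V : Opens X} (h : U ≤ V) : sec M V →ₛₗ[res X h] sec M U where
  toFun m := M.val.map (homOfLE h).op m
  map_add' := map_add (M.val.map (homOfLE h).op).hom
  map_smul' r m := M.val.map_smul (homOfLE h).op r m

lemma secRes_secRes (M : ModX X) {U V W : Opens X} (h : U ≤ V) (h' : V ≤ W) (s : sec M W) :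
    secRes M h (secRes M h' s) = secRes M (h.trans h') s :=
  (M.val.map_comp_apply (homOfLE h').op (homOfLE h).op s).symm

lemma secRes_self (M : ModX X) {U : Opens X} (h : U ≤ U) (s : sec M U) : secRes M h s = s := by
  have := congr(($(M.val.map_id (op U))).hom s)
  exact this

variable [Finite X]

lemma le_iSup_minOpen (V : Opens X) : V ≤ iSup fun z : V => minOpen X z.1 := fun x hx =>
  Opens.mem_iSup.2 ⟨⟨x, hx⟩, mem_minOpen x⟩

namespace StalkMod

/-- The stalks of an `𝒪_X`-module. -/
def ofSheaf (M : ModX X) : StalkMod X where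
  obj x := sec M (minOpen X x)
  map h := secRes M (minOpen_le h)
  map_self _ m := secRes_self M _ m
  map_map _ _ m := secRes_secRes M _ _ m

/-- The family of germs of a section of an `𝒪_X`-module. -/
def sheafSec (M : ModX X) (V : Opens X) :
    sec M V →ₗ[X.presheaf.obj (op V)] (ofSheaf M).Sec (le_refl V) :=
  Sec.lift _ (RingHom.id _) (fun _ hx a => secRes M (minOpen_le hx) a)
    (fun _ _ => map_add _) (fun _ hx a b => map_smulₛₗ (secRes M (minOpen_le hx)) a b)
    fun _ _ _ _ _ => secRes_secRes M _ _ _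

lemma bijective_sheafSec (M : ModX X) (V : Opens X) : Function.Bijective (sheafSec M V) := by
  let F : TopCat.Sheaf AddCommGrpCat.{u} X := (SheafOfModules.toSheaf (ringSheaf X)).obj M
  constructor
  · intro a b hab
    exact F.eq_of_locally_eq' (fun z : V => minOpen X z.1) V (fun z => homOfLE (minOpen_le z.2))
      (le_iSup_minOpen V) a b fun z => congrArg (fun s => Sec.val s z.2) hab
  · intro s
    have hloc (z w : V) (x : X) (hx : x ∈ minOpen X z.1 ⊓ minOpen X w.1) :
        secRes M (minOpen_le (mem_left hx)) (s.val z.2) =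
          secRes M (minOpen_le (mem_right hx)) (s.val w.2) :=
      (s.map_val z.2 (mem_left hx)).trans (s.map_val w.2 (mem_right hx)).symm
    obtain ⟨a, ha, -⟩ := F.existsUnique_gluing' (fun z : V => minOpen X z.1) V
      (fun z => homOfLE (minOpen_le z.2)) (le_iSup_minOpen V) (fun z => s.val z.2) fun z w => by
        refine F.eq_of_locally_eq' (fun x : (minOpen X z.1 ⊓ minOpen X w.1 : Opens X) =>
          minOpen X x.1) _ (fun x => homOfLE (minOpen_le x.2)) (le_iSup_minOpen _) _ _ fun x => ?_
        exact (secRes_secRes M (minOpen_le x.2) inf_le_left (s.val z.2)).trans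
          ((hloc z w x.1 x.2).trans
            (secRes_secRes M (minOpen_le x.2) inf_le_right (s.val w.2)).symm)
    exact ⟨a, Sec.ext fun x hx => ha ⟨x, hx⟩⟩

/-! ### The sheaf of modules with given stalks -/

/-- The presheaf of abelian groups of sections. -/
def secPresheaf (F : StalkMod X) : (Opens X)ᵒᵖ ⥤ AddCommGrpCat.{u} where
  obj V := AddCommGrpCat.of (F.Sec (le_refl V.unop))
  map {V W} i := AddCommGrpCat.ofHom
    (Sec.restrict (M := F) (le_refl V.unop) (le_refl W.unop) (leOfHom i.unop)
      (leOfHom i.unop)).toAddMonoidHom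
  map_id _ := rfl
  map_comp _ _ := rfl

instance (F : StalkMod X) (V : (Opens X)ᵒᵖ) :
    Module ((ringSheaf X).obj.obj V) ((secPresheaf F).obj V) :=
  inferInstanceAs (Module (X.presheaf.obj (op V.unop)) (F.Sec (le_refl V.unop)))

lemma isSheaf_secPresheaf (F : StalkMod X) :
    TopCat.Presheaf.IsSheaf (X := X.toPresheafedSpace.carrier) (secPresheaf F) := by
  refine (TopCat.Presheaf.isSheaf_iff_isSheafUniqueGluing (X := X.toPresheafedSpace.carrier) (secPresheaf F)).2 ?_
  intro ι U s hs
  let t (i : ι) : F.Sec (le_refl (U i)) := s i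
  have hU {x : X} (hx : x ∈ iSup U) : ∃ i, x ∈ U i := Opens.mem_iSup.1 hx
  have key (i j : ι) {x : X} (hi : x ∈ U i) (hj : x ∈ U j) : (t i).val hi = (t j).val hj :=
    congrArg (fun a : F.Sec (le_refl (U i ⊓ U j)) => a.val (mem_inf hi hj)) (hs i j)
  let a : F.Sec (le_refl (iSup U)) := Sec.mk _ (fun x hx => (t (hU hx).choose).val (hU hx).choose_spec)
    fun x hx y hy => ((t _).map_val _ hy).trans (key _ _ _ _)
  refine ⟨a, fun i => Sec.ext fun x hx => key _ _ _ _, fun b hb => Sec.ext fun x hx => ?_⟩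
  obtain ⟨i, hi⟩ := hU hx
  have : (t i).val hi = Sec.val (M := F) (h := le_refl (iSup U)) b hx :=
    congrArg (fun a : F.Sec (le_refl (U i)) => a.val hi) (hb i).symm
  exact this.symm.trans (key _ _ _ _)

/-- The `𝒪_X`-module with given stalks. -/
def toSheaf (F : StalkMod X) : ModX X where
  val := PresheafOfModules.ofPresheaf (secPresheaf F) fun V W i r m =>
    map_smulₛₗ (Sec.restrict (M := F) (le_refl V.unop) (le_refl W.unop) (leOfHom i.unop)
      (leOfHom i.unop)) r m
  isSheaf := isSheaf_secPresheaf F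

variable {M N : StalkMod X}

/-- The homomorphism of `𝒪_X`-modules with given maps on stalks. -/
def Hom.toSheaf (f : Hom M N) : M.toSheaf ⟶ N.toSheaf where
  val := PresheafOfModules.homMk
    { app V := AddCommGrpCat.ofHom (Sec.map f (le_refl V.unop)).toAddMonoidHom
      naturality _ _ _ := rfl } fun V r m =>
      (Sec.map f (le_refl V.unop)).map_smul (show X.presheaf.obj (op V.unop) from r) m

/-- The comparison of an `𝒪_X`-module with the one defined by its stalks. -/
def sheafUnit (M : ModX X) : M ⟶ (ofSheaf M).toSheaf where
  val := PresheafOfModules.homMk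
    { app V := AddCommGrpCat.ofHom (sheafSec M V.unop).toAddMonoidHom
      naturality V W i := by
        refine ConcreteCategory.hom_ext _ _ fun s => ?_
        exact Sec.ext (h := le_refl W.unop) fun x hx =>
          secRes_secRes M (minOpen_le hx) (leOfHom i.unop) s }
    fun V r m => (sheafSec M V.unop).map_smul (show X.presheaf.obj (op V.unop) from r) m

instance (M : ModX X) : IsIso (sheafUnit M) := by
  have : IsIso ((SheafOfModules.toSheaf (ringSheaf X)).map (sheafUnit M)) := by
    rw [← isIso_iff_of_reflects_iso _ (sheafToPresheaf _ _), NatTrans.isIso_iff_isIso_app]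
    intro V
    rw [ConcreteCategory.isIso_iff_bijective]
    exact bijective_sheafSec M V.unop
  exact isIso_of_reflects_iso _ (SheafOfModules.toSheaf (ringSheaf X))

end StalkMod
end Sheaves
end FiniteRingedSpace

end

/-! ### Sheaf cohomology: dimension shifting and flasque sheaves -/

noncomputable section

namespace FiniteRingedSpace
open Limits Abelian

section Cohomology

variable {T : TopCat.{u}}

lemma injective_freeAbelianGroup_map {α β : Type u} {f : α → β} (hf : Function.Injective f) :
    Function.Injective (FreeAbelianGroup.map f) := by
  rcases isEmpty_or_nonempty α with h | h
  · exact Function.injective_of_subsingleton _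
  · obtain ⟨g, hg⟩ := hf.hasLeftInverse
    refine Function.LeftInverse.injective (g := FreeAbelianGroup.map g) fun x => ?_
    rw [← FreeAbelianGroup.map_comp_apply, hg.comp_eq_id, FreeAbelianGroup.map_id_apply]

/-- Sections over an open set are maps from the free abelian sheaf on it. For a smaller open set
this sheaf embeds in the one for the larger, and maps to an injective extend. -/
lemma isFlasque_of_injective (F : Sheaf (Opens.grothendieckTopology T) AddCommGrpCat.{u}) [Injective F] :
    TopCat.Presheaf.IsFlasque (X := T) F.obj where
  epi {U V} i := by
    rw [AddCommGrpCat.epi_iff_surjective]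
    let adj := (AddCommGrpCat.adj.{u}.whiskerRight (Opens T)ᵒᵖ).comp
      (sheafificationAdjunction (Opens.grothendieckTopology T) AddCommGrpCat.{u})
    let L := ((Functor.whiskeringRight (Opens T)ᵒᵖ _ _).obj AddCommGrpCat.free.{u}) ⋙
      presheafToSheaf (Opens.grothendieckTopology T) AddCommGrpCat.{u}
    have : Mono (((Functor.whiskeringRight (Opens T)ᵒᵖ _ _).obj AddCommGrpCat.free.{u}).map
        (yoneda.map i.unop)) := by
      rw [NatTrans.mono_iff_mono_app]
      intro W
      rw [AddCommGrpCat.mono_iff_injective]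
      exact injective_freeAbelianGroup_map fun a b _ => Subsingleton.elim (α := W.unop ⟶ V.unop) a b
    have : Mono (L.map (yoneda.map i.unop)) :=
      inferInstanceAs (Mono ((presheafToSheaf _ _).map _))
    intro t
    let t' : L.obj (yoneda.obj V.unop) ⟶ F := (adj.homEquiv _ _).symm (yonedaEquiv.symm t)
    let s' := adj.homEquiv _ _ (Injective.factorThru t' (L.map (yoneda.map i.unop)))
    have h : yoneda.map i.unop ≫ s' = yonedaEquiv.symm t := by
      rw [← adj.homEquiv_naturality_left, Injective.comp_factorThru, Equiv.apply_symm_apply]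
    refine ⟨yonedaEquiv s', ?_⟩
    have h2 := congr(yonedaEquiv $h)
    rw [Equiv.apply_symm_apply, ← yonedaEquiv_naturality] at h2
    exact h2

variable {S : ShortComplex (Sheaf (Opens.grothendieckTopology T) AddCommGrpCat.{u})}

lemma subsingleton_H_succ (hS : S.ShortExact) {n : ℕ} (h₂ : Subsingleton (Sheaf.H S.X₂ (n + 1)))
    (h₃ : Subsingleton (Sheaf.H S.X₃ n)) : Subsingleton (Sheaf.H S.X₁ (n + 1)) := by
  refine subsingleton_of_forall_eq 0 fun x => ?_
  obtain ⟨y, rfl⟩ := Ext.covariant_sequence_exact₁ _ hS x (Subsingleton.elim (α := Sheaf.H S.X₂ (n + 1)) _ _) rfl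
  rw [Subsingleton.elim (α := Sheaf.H S.X₃ n) y 0, Ext.zero_comp]

lemma subsingleton_H_one (hS : S.ShortExact) (h₂ : Subsingleton (Sheaf.H S.X₂ 1))
    (h : Function.Surjective (S.g.hom.app (op ⊤))) : Subsingleton (Sheaf.H S.X₁ 1) := by
  refine subsingleton_of_forall_eq 0 fun x => ?_
  obtain ⟨y, rfl⟩ := Ext.covariant_sequence_exact₁ _ hS x (Subsingleton.elim (α := Sheaf.H S.X₂ 1) _ _) rfl
  let e₂ := Sheaf.H.equiv₀ S.X₂ (isTerminalTop (α := Opens T))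
  let e₃ := Sheaf.H.equiv₀ S.X₃ (isTerminalTop (α := Opens T))
  obtain ⟨z, hz⟩ := h (e₃ y)
  have : Sheaf.H.map S.g 0 (e₂.symm z) = y := by
    rw [Sheaf.H.equiv₀_symm_naturality, hz, AddEquiv.symm_apply_apply]
  rw [← this, Sheaf.H.map_apply, Ext.comp_assoc_of_second_deg_zero, hS.comp_extClass,
    Ext.comp_zero]

lemma surjective_app_top (hS : S.ShortExact) (h₁ : Subsingleton (Sheaf.H S.X₁ 1)) :
    Function.Surjective (S.g.hom.app (op ⊤)) := by
  intro y
  let e₂ := Sheaf.H.equiv₀ S.X₂ (isTerminalTop (α := Opens T))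
  let e₃ := Sheaf.H.equiv₀ S.X₃ (isTerminalTop (α := Opens T))
  obtain ⟨z, hz⟩ := Ext.covariant_sequence_exact₃ _ hS (e₃.symm y) rfl
    (Subsingleton.elim (α := Sheaf.H S.X₁ 1) _ _)
  refine ⟨e₂ z, ?_⟩
  rw [Sheaf.H.equiv₀_naturality, Sheaf.H.map_apply, hz, AddEquiv.apply_symm_apply]

/-- Embed `F` in an injective sheaf. The quotient is flasque as well, so dimension shifting reduces
to degree one, where sections of the quotient lift because `F` is flasque. -/
lemma subsingleton_H_of_isFlasque (n : ℕ) : ∀ (F : Sheaf (Opens.grothendieckTopology T) AddCommGrpCat.{u}) [TopCat.Presheaf.IsFlasque (X := T) F.obj],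
    Subsingleton (Sheaf.H F (n + 1)) := by
  induction n with
  | zero =>
    intro F _
    have hS : (ShortComplex.mk (Injective.ι F) (cokernel.π _) (cokernel.condition _)).ShortExact :=
      { exact := ShortComplex.exact_cokernel _ }
    refine subsingleton_H_one hS inferInstance ?_
    rw [← AddCommGrpCat.epi_iff_surjective]
    exact TopCat.Sheaf.IsFlasque.epi_of_shortExact hS
  | succ n ih =>
    intro F _
    have hS : (ShortComplex.mk (Injective.ι F) (cokernel.π _) (cokernel.condition _)).ShortExact :=
      { exact := ShortComplex.exact_cokernel _ }
    have : TopCat.Presheaf.IsFlasque (X := T) (Injective.under F).obj := isFlasque_of_injective _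
    have := TopCat.Sheaf.IsFlasque.of_shortExact_of_isFlasque₁₂ hS
    exact subsingleton_H_succ hS inferInstance (ih (cokernel (Injective.ι F)))

end Cohomology
end FiniteRingedSpace

end

/-! ### Exactness for sheaves of modules and for the associated stalk data -/

noncomputable section

namespace FiniteRingedSpace
open Limits

section Site

universe v' u'

variable {C : Type u'} [Category.{v'} C] {J : GrothendieckTopology C}
  {R : Sheaf J RingCat.{u}}

instance (c : Cᵒᵖ) : (SheafOfModules.evaluation.{u} R c).PreservesZeroMorphisms :=
  ⟨fun _ _ => rfl⟩

lemma injective_app_of_mono {M N : SheafOfModules.{u} R} (f : M ⟶ N) [Mono f] (c : C) :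
    Function.Injective (f.val.app (op c)) :=
  (ModuleCat.mono_iff_injective _).1
    (inferInstanceAs (Mono ((SheafOfModules.evaluation.{u} R (op c)).map f)))

lemma IsLocalObject.over {c d : C} (hc : IsLocalObject J c) (f : c ⟶ d) :
    IsLocalObject (J.over d) (Over.mk f) := fun _ hS =>
  (Sieve.overEquiv (Over.mk f)).injective ((hc _ hS).trans (map_top _).symm)

variable [HasSheafify J AddCommGrpCat.{u}] [J.WEqualsLocallyBijective AddCommGrpCat.{u}]

instance : PreservesFiniteColimits (SheafOfModules.toSheaf.{u} R) := ⟨fun _ => inferInstance⟩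

lemma exact_app_of_exact {S : ShortComplex (SheafOfModules.{u} R)} (hS : S.Exact) [Mono S.f]
    (c : C) : Function.Exact (S.f.val.app (op c)) (S.g.val.app (op c)) :=
  (ShortComplex.ShortExact.moduleCat_exact_iff_function_exact _).1
    (hS.map_of_mono_of_preservesKernel (SheafOfModules.evaluation.{u} R (op c)) inferInstance
      inferInstance)

lemma exact_kernel_app {M N : SheafOfModules.{u} R} (f : M ⟶ N) (c : C) :
    Function.Exact ((kernel.ι f).val.app (op c)) (f.val.app (op c)) :=
  exact_app_of_exact (S := .mk _ _ (kernel.condition f)) (ShortComplex.exact_kernel f) c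

lemma mono_of_injective_app {M N : SheafOfModules.{u} R} (f : M ⟶ N)
    (h : ∀ c, Function.Injective (f.val.app (op c))) : Mono f := by
  refine Preadditive.mono_of_kernel_zero ?_
  ext c s
  refine h _ ?_
  exact ((exact_kernel_app f c.unop).apply_apply_eq_zero s).trans (map_zero _).symm

lemma exact_of_exact_app {S : ShortComplex (SheafOfModules.{u} R)}
    (h : ∀ c, Function.Exact (S.f.val.app (op c)) (S.g.val.app (op c))) : S.Exact := by
  rw [ShortComplex.exact_iff_epi_kernel_lift]
  refine epi_of_surjective_of_local _ fun c => ⟨⊤, by simp, fun d _ _ k => ?_⟩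
  obtain ⟨m, hm⟩ := (h d _).1 ((exact_kernel_app S.g d).apply_apply_eq_zero k)
  refine ⟨m, injective_app_of_mono (kernel.ι S.g) d ?_⟩
  rw [← hm]
  exact congr((($(kernel.lift_ι S.g S.f S.zero)).val.app (op d)) m)

end Site

section Space

variable {X : AlgebraicGeometry.RingedSpace.{u, u}} [Finite X]

/-- A member of a cover of `U_x` that contains `x` contains `U_x`. -/
lemma isLocalObject_minOpen (x : X) :
    IsLocalObject (Opens.grothendieckTopology X) (minOpen X x) := by
  intro S hS
  obtain ⟨U, f, hf, hx⟩ := hS x (mem_minOpen x)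
  rw [← Sieve.id_mem_iff_eq_top]
  exact S.downward_closed hf (homOfLE (minOpen_le hx))

namespace StalkMod

variable {M N P : StalkMod X}

lemma Hom.surjective_toSheaf {f : Hom M N} {x : X} (hf : Function.Surjective (f.app x)) :
    Function.Surjective (f.toSheaf.val.app (op (minOpen X x))) := by
  intro s
  obtain ⟨m, hm⟩ := hf (Sec.val (M := N) (h := le_refl (minOpen X x)) s (mem_minOpen x))
  refine ⟨Sec.ofObj (le_refl (minOpen X x)) le_rfl m, ?_⟩
  refine Sec.ext (M := N) (h := le_refl (minOpen X x)) fun y hy => ?_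
  change f.app y (M.map hy m) = Sec.val (M := N) (h := le_refl (minOpen X x)) s hy
  exact (f.naturality hy m).trans ((congrArg (N.map hy) hm).trans
    (Sec.map_val (M := N) (h := le_refl (minOpen X x)) s _ hy))

lemma Hom.epi_toSheaf (f : Hom M N) (hf : ∀ x, Function.Surjective (f.app x)) : Epi f.toSheaf := by
  refine epi_of_surjective_of_local _ fun V => ⟨fun W _ => ∃ x, W = minOpen X x, fun x hx =>
    ⟨minOpen X x, homOfLE (minOpen_le hx), Sieve.le_generate _ _ _ ⟨x, rfl⟩, mem_minOpen x⟩,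
    fun W _ hW => ?_⟩
  obtain ⟨x, rfl⟩ := hW
  exact Hom.surjective_toSheaf (hf x)

/-- The short complex of sheaves attached to a complex of modules given by stalks. -/
abbrev shortComplex (f : Hom M N) (g : Hom N P) (h : ∀ x, Function.Exact (f.app x) (g.app x)) :
    ShortComplex (ModX X) :=
  .mk f.toSheaf g.toSheaf <| by
    ext V s
    exact Sec.ext (M := P) (h := le_refl V.unop) fun x hx =>
      (h x).apply_apply_eq_zero (Sec.val (M := M) (h := le_refl V.unop) s hx)

lemma shortExact_shortComplex (f : Hom M N) (g : Hom N P)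
    (h : ∀ x, Function.Exact (f.app x) (g.app x)) (hf : ∀ x, Function.Injective (f.app x))
    (hg : ∀ x, Function.Surjective (g.app x)) : (shortComplex f g h).ShortExact := by
  have hE (V : Opens X) : ExactOn V f g := ⟨fun x _ => hf x, fun x _ => h x, fun x _ => hg x⟩
  refine { exact := exact_of_exact_app fun V s => ⟨(hE V).exists_sec s, ?_⟩,
           mono_f := mono_of_injective_app _ fun V => (hE V).sec_injective le_rfl,
           epi_g := g.epi_toSheaf hg }
  rintro ⟨t, rfl⟩
  exact Sec.ext (M := P) (h := le_refl V) fun x hx => (h x).apply_apply_eq_zero _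

end StalkMod
end Space
end FiniteRingedSpace

end

/-! ### Presentations imply that the specialization maps are base changes -/

noncomputable section

namespace FiniteRingedSpace
open Limits

lemma isBC_of_basis {R S : Type u} [CommRing R] [CommRing S] {f : R →+* S} {M N I : Type u}
    [AddCommGroup M] [AddCommGroup N] [Module R M] [Module S N] {g : M →ₛₗ[f] N}
    (b : Module.Basis I R M) (b' : Module.Basis I S N) (h : ∀ i, g (b i) = b' i) : IsBC g := by
  let k : (I →₀ R) →ₛₗ[f] (I →₀ S) :=
    { toFun := Finsupp.mapRange f (map_zero f)
      map_add' := fun a b => by ext; simp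
      map_smul' := fun a b => by ext; simp }
  let k' : M →ₛₗ[f] (I →₀ S) :=
    { toFun := fun m => k (b.repr m)
      map_add' := fun a b => by simp
      map_smul' := fun a b => by simp }
  have h1 : IsBC k' :=
    (IsBC.comp_iff (g := b.repr.toLinearMap) (f := RingHom.id R) (by simp)
      (isBC_of_bijective Function.bijective_id b.repr.bijective) (h := k) fun m => rfl).2
      (StalkMod.isBC_mapRange f fun _ _ => rfl)
  have h2 : b'.repr.symm.toLinearMap.comp k' = g := b.ext fun i => by
    change b'.repr.symm (Finsupp.mapRange f (map_zero f) (b.repr (b i))) = g (b i)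
    simp [h]
  exact h1.of_bijective (φ := b'.repr.symm.toLinearMap) (fun m => congr($h2 m)) b'.repr.symm.bijective

section Over

variable {X : AlgebraicGeometry.RingedSpace.{u, u}} {W : Opens X}

/-! ### Modules on an open subspace -/

/-- An open subset of `W` as an object of the site of `W`. -/
abbrev overObj {V : Opens X} (h : V ≤ W) : Over W := Over.mk (homOfLE h)

/-- An inclusion of open subsets of `W` as a morphism of the site of `W`. -/
abbrev overHom {U V : Opens X} (hV : V ≤ W) (h : U ≤ V) : overObj (h.trans hV) ⟶ overObj hV :=
  Over.homMk (homOfLE h)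

/-- Sections of a module on the open subspace `W`. -/
def osec (N : SheafOfModules.{u} ((ringSheaf X).over W)) {V : Opens X} (h : V ≤ W) : Type u :=
  N.val.obj (op (overObj h))

variable (N P : SheafOfModules.{u} ((ringSheaf X).over W)) {U V : Opens X}

instance (h : V ≤ W) : AddCommGroup (osec N h) :=
  inferInstanceAs (AddCommGroup (N.val.obj (op (overObj h))))

instance (h : V ≤ W) : Module (X.presheaf.obj (op V)) (osec N h) :=
  (N.val.obj (op (overObj h))).isModule

/-- The restriction of sections of a module on the open subspace `W`. -/
def osecRes (hV : V ≤ W) (h : U ≤ V) : osec N hV →ₛₗ[res X h] osec N (h.trans hV) where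
  toFun m := N.val.map (overHom hV h).op m
  map_add' := map_add (N.val.map (overHom hV h).op).hom
  map_smul' r m := N.val.map_smul (overHom hV h).op r m

variable {N P}

/-- The map on sections induced by a homomorphism of modules on the open subspace `W`. -/
def osecMap (f : N ⟶ P) (h : V ≤ W) : osec N h →ₗ[X.presheaf.obj (op V)] osec P h where
  toFun m := f.val.app (op (overObj h)) m
  map_add' := map_add (f.val.app (op (overObj h))).hom
  map_smul' r m := (f.val.app (op (overObj h))).hom.map_smul r m

lemma osecMap_osecRes (f : N ⟶ P) (hV : V ≤ W) (h : U ≤ V) (s : osec N hV) :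
    osecMap f (h.trans hV) (osecRes N hV h s) = osecRes P hV h (osecMap f hV s) :=
  PresheafOfModules.naturality_apply f.val (overHom hV h).op s

variable [Finite X]

/-- The basis of the sections of a free module over a minimal open set. -/
def osecBasis (I : Type u) {x : X} (hx : minOpen X x ≤ W) :
    Module.Basis I (stalkRing X x)
      (osec (SheafOfModules.free (R := (ringSheaf X).over W) I) hx) :=
  ((isLocalObject_minOpen x).over (homOfLE hx)).freeBasis (R := (ringSheaf X).over W) I

lemma osecBasis_apply (I : Type u) {x : X} (hx : minOpen X x ≤ W) (i : I) :
    osecBasis I hx i =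
      (SheafOfModules.freeSection (R := (ringSheaf X).over W) i).val (op (overObj hx)) :=
  ((isLocalObject_minOpen x).over (homOfLE hx)).freeBasis_apply (R := (ringSheaf X).over W) I i

lemma isBC_osecRes_free (I : Type u) {x y : X} (hx : minOpen X x ≤ W) (hy : y ∈ minOpen X x) :
    IsBC (osecRes (SheafOfModules.free (R := (ringSheaf X).over W) I) hx (minOpen_le hy)) := by
  refine isBC_of_basis (osecBasis I hx) (osecBasis I ((minOpen_le hy).trans hx)) fun i => ?_
  rw [osecBasis_apply, osecBasis_apply]
  exact PresheafOfModules.sections_property (SheafOfModules.freeSection (R := (ringSheaf X).over W) i)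
    (overHom hx (minOpen_le hy)).op

lemma surjective_osecMap (f : N ⟶ P) [Epi f] {x : X} (hx : minOpen X x ≤ W) :
    Function.Surjective (osecMap f hx) :=
  ((isLocalObject_minOpen x).over (homOfLE hx)).surjective_of_epi f

omit [Finite X] in
lemma exact_osecMap_kernel (f : N ⟶ P) (h : V ≤ W) :
    Function.Exact (osecMap (kernel.ι f) h) (osecMap f h) :=
  exact_kernel_app f (overObj h)

/-- Over minimal open sets the presentation is exact on sections, so `N` is there a cokernel of free
modules; the tautological bases restrict to each other and right exactness finishes. -/
lemma isBC_osecRes (p : N.Presentation) {x y : X} (hx : minOpen X x ≤ W) (hy : y ∈ minOpen X x) :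
    IsBC (osecRes N hx (minOpen_le hy)) := by
  let f := p.relations.π ≫ kernel.ι p.generators.π
  have hex {z : X} (hz : minOpen X z ≤ W) :
      Function.Exact (osecMap f hz) (osecMap p.generators.π hz) := by
    exact (Function.Surjective.comp_exact_iff_exact (f := osecMap (kernel.ι p.generators.π) hz)
      (surjective_osecMap p.relations.π hz)).2 (exact_osecMap_kernel p.generators.π hz)
  exact IsBC.of_right_exact (fun s => (osecMap_osecRes f hx (minOpen_le hy) s).symm)
    (fun s => (osecMap_osecRes p.generators.π hx (minOpen_le hy) s).symm)
    (isBC_osecRes_free _ hx hy) (isBC_osecRes_free _ hx hy) (hex hx)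
    (surjective_osecMap p.generators.π hx) (hex _) (surjective_osecMap p.generators.π _)

/-- The stalks of a quasi-coherent module. -/
lemma qc_ofSheaf (M : ModX X) (hM : M.IsQuasicoherent) : StalkMod.QC (StalkMod.ofSheaf M) := by
  intro x _ y hy
  obtain ⟨⟨q⟩⟩ := hM
  -- The cover carrying the presentations has a member containing all of `U_x`.
  have h := isLocalObject_minOpen x _ (q.coversTop (minOpen X x))
  obtain ⟨i, ⟨g⟩⟩ : Sieve.ofObjects q.X (minOpen X x) (𝟙 _) := by rw [h]; trivial
  exact isBC_osecRes (q.presentation i) (leOfHom g) hy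

end Over
end FiniteRingedSpace

end

/-! ### Presentations on minimal open sets from base change -/

noncomputable section

namespace FiniteRingedSpace
open Limits

section Over

variable {X : AlgebraicGeometry.RingedSpace.{u, u}} [Finite X] {W : Opens X}
  {N P : SheafOfModules.{u} ((ringSheaf X).over W)}

lemma epi_of_surjective_osecMap (f : N ⟶ P)
    (hf : ∀ y (hy : minOpen X y ≤ W), Function.Surjective (osecMap f hy)) : Epi f := by
  refine epi_of_surjective_of_local f fun c => ⟨fun d _ => ∃ y, ∃ hy : minOpen X y ≤ W,
    d = overObj hy, ?_, fun d _ hd => ?_⟩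
  · rw [GrothendieckTopology.mem_over_iff]
    intro x hx
    refine ⟨minOpen X x, homOfLE (minOpen_le hx), ?_, mem_minOpen x⟩
    rw [Sieve.overEquiv_iff]
    exact Sieve.le_generate _ _ _ ⟨x, (minOpen_le hx).trans (leOfHom c.hom), rfl⟩
  · obtain ⟨y, hy, rfl⟩ := hd
    exact hf y hy

/-- A section over the whole of `W` as a section of the sheaf. -/
def ofSection (s : osec N (le_refl W)) : N.sections :=
  PresheafOfModules.sectionsMk (fun c => osecRes N (le_refl W) (leOfHom c.unop.hom) s)
    fun c d g => by
      exact (N.val.map_comp_apply (overHom le_rfl (leOfHom c.unop.hom)).op g s).symm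

/-- A module on `W` whose stalks are generated by sections over `W` is generated by sections. -/
def generatingSections (h : ∀ y (hy : minOpen X y ≤ W),
    Submodule.span (stalkRing X y) (Set.range (osecRes N (le_refl W) hy)) = ⊤) :
    N.GeneratingSections where
  I := osec N (le_refl W)
  s := ofSection
  epi := by
    refine epi_of_surjective_osecMap _ fun y hy => ?_
    rw [← LinearMap.range_eq_top, eq_top_iff, ← h y hy, Submodule.span_le]
    rintro _ ⟨m, rfl⟩
    refine ⟨(SheafOfModules.freeSection (R := (ringSheaf X).over W) m).val (op (overObj hy)), ?_⟩
    exact congrArg (fun s => s.val (op (overObj hy)))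
      (SheafOfModules.sectionsMap_freeHomEquiv_symm_freeSection (ofSection (N := N)) m)

lemma isBC_osecRes_kernel (f : N ⟶ P) {x y : X} (hx : minOpen X x ≤ W) (hy : y ∈ minOpen X x)
    (hflat : (res X (minOpen_le hy)).Flat) (hN : IsBC (osecRes N hx (minOpen_le hy)))
    (hP : IsBC (osecRes P hx (minOpen_le hy))) :
    IsBC (osecRes (kernel f) hx (minOpen_le hy)) :=
  IsBC.of_left_exact hflat
    (fun s => (osecMap_osecRes (kernel.ι f) hx (minOpen_le hy) s).symm)
    (fun s => (osecMap_osecRes f hx (minOpen_le hy) s).symm) hN hP (exact_osecMap_kernel _ _)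
    (injective_app_of_mono (kernel.ι f) _) (exact_osecMap_kernel _ _)
    (injective_app_of_mono (kernel.ι f) _)

/-- A presentation of a quasi-coherent module on a minimal open set. -/
def presentation {x : X} (hx : IsAffineOpen X (minOpen X x))
    (N : SheafOfModules.{u} ((ringSheaf X).over (minOpen X x)))
    (h : ∀ y (hy : y ∈ minOpen X x), IsBC (osecRes N (le_refl _) (minOpen_le hy))) :
    N.Presentation where
  generators := generatingSections fun y hy => (h y (hy (mem_minOpen y))).span_range
  -- By flatness the kernel of the free cover is again compatible with base change, hence generated
  -- by its sections over `U_x`.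
  relations := generatingSections fun y hy => by
    have hy' := hy (mem_minOpen y)
    exact (isBC_osecRes_kernel _ le_rfl hy' (hx.flat hy') (isBC_osecRes_free _ le_rfl hy')
      (h y hy')).span_range

lemma isBC_osecRes_over {M : ModX X} {x y : X} (hx : minOpen X x ≤ W) (hy : y ∈ minOpen X x)
    (h : IsBC (secRes M (minOpen_le hy))) :
    IsBC (osecRes (SheafOfModules.over M W) hx (minOpen_le hy)) := h

namespace StalkMod

variable {F : StalkMod X}

/-- Under `Γ(U_x, F) = F_x`, restriction of sections from `U_x` to `U_y` is the specialization map.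
-/
lemma QC.isBC_secRes (hF : QC F) {x y : X} (hy : y ∈ minOpen X x) :
    IsBC (secRes F.toSheaf (minOpen_le hy)) := by
  have h1 : IsBC (Sec.ofObj (M := F) (le_refl (minOpen X y)) (minOpen_le hy)) :=
    (IsBC.comp_iff (res_comp_res X le_rfl (minOpen_le hy)).symm (hF x trivial y hy)
      (h := Sec.ofObj (le_refl (minOpen X y)) le_rfl)
      (m := Sec.ofObj (le_refl (minOpen X y)) (minOpen_le hy)) fun m => Sec.ext fun z hz => (F.map_map hy hz m).symm).2
      (isBC_of_bijective (res_bijective_of_le _ le_rfl) (Sec.bijective_ofObj _ _ (mem_minOpen y)))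
  exact (IsBC.comp_iff (res_comp_res X (minOpen_le hy) le_rfl).symm
    (isBC_of_bijective (g := Sec.ofObj (M := F) (le_refl (minOpen X x)) le_rfl)
      (res_bijective_of_le _ le_rfl) (Sec.bijective_ofObj _ _ (mem_minOpen x)))
      (h := secRes F.toSheaf (minOpen_le hy)) fun m => rfl).1 h1

/-- The sheaf of modules attached to a quasi-coherent module given by stalks is quasi-coherent. -/
lemma QC.isQuasicoherent (hX : ∀ x, IsAffineOpen X (minOpen X x)) (hF : QC F) :
    F.toSheaf.IsQuasicoherent := by
  have hc : (Opens.grothendieckTopology X).CoversTop (fun x : X => minOpen X x) := fun V x hx =>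
    ⟨minOpen X x, homOfLE (minOpen_le hx), ⟨x, ⟨𝟙 (minOpen X x)⟩⟩, mem_minOpen x⟩
  have p (x : X) : (SheafOfModules.over F.toSheaf (minOpen X x)).Presentation :=
    presentation (hX x) _ fun y hy => isBC_osecRes_over le_rfl hy (hF.isBC_secRes hy)
  exact (SheafOfModules.QuasicoherentData.mk (M := F.toSheaf) X (fun x : X => minOpen X x) hc
    p).isQuasicoherent

end StalkMod
end Over
end FiniteRingedSpace

end

/-! ### Comparison with sheaf cohomology and the individual implications -/

noncomputable section

namespace FiniteRingedSpace
open Limits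

section Comparison

variable {X : AlgebraicGeometry.RingedSpace.{u, u}} [Finite X]

namespace StalkMod

lemma isFlasque_godement (F : StalkMod X) :
    TopCat.Presheaf.IsFlasque (X := X.toPresheafedSpace.carrier)
      ((SheafOfModules.toSheaf (ringSheaf X)).obj (godement F).toSheaf).obj where
  epi {U V} i := by
    classical
    rw [AddCommGrpCat.epi_iff_surjective]
    intro s
    let s' : (godement F).Sec (le_refl V.unop) := s
    -- A discontinuous section extends by zero outside the smaller open set.
    let t : (godement F).Sec (le_refl U.unop) := Sec.mk _
      (fun _ _ => gmk fun y _ =>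
        if hy : y ∈ V.unop then gval (s'.val hy) (mem_minOpen y) else 0) fun _ _ _ _ => rfl
    refine ⟨t, Sec.ext (M := godement F) (h := le_refl V.unop) fun x hx => gext fun y hy => ?_⟩
    have hy' : y ∈ V.unop := minOpen_le hx hy
    have h1 : gval (s'.val hy') (mem_minOpen y) = gval (s'.val hx) hy := by
      rw [← s'.map_val hx hy, gval_map]
    exact (dif_pos hy').trans h1

/-- The Godement module is flasque, so derived-functor cohomology shifts along the cosyzygies
exactly as `VanishOn` does. -/
lemma subsingleton_H_of_vanishOn (n : ℕ) : ∀ F : StalkMod X, VanishOn n ⊤ F →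
    Subsingleton (H F.toSheaf (n + 1)) := by
  induction n with
  | zero =>
    intro F hF
    have hS := (shortExact_shortComplex (toGodement F) (toCosyzygy F) (exact_proj_range _)
      toGodement_injective (Sub.proj_surjective _)).map_of_exact
      (SheafOfModules.toSheaf (ringSheaf X))
    have := isFlasque_godement F
    have : Subsingleton (H (godement F).toSheaf 1) := subsingleton_H_of_isFlasque 0 _
    exact subsingleton_H_one (T := X.toPresheafedSpace.carrier) hS this hF
  | succ n ih =>
    intro F hF
    have hS := (shortExact_shortComplex (toGodement F) (toCosyzygy F) (exact_proj_range _)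
      toGodement_injective (Sub.proj_surjective _)).map_of_exact
      (SheafOfModules.toSheaf (ringSheaf X))
    have := isFlasque_godement F
    have : Subsingleton (H (godement F).toSheaf (n + 1 + 1)) := subsingleton_H_of_isFlasque _ _
    exact subsingleton_H_succ (T := X.toPresheafedSpace.carrier) hS this (ih _ hF)

end StalkMod

open StalkMod

lemma subsingleton_H_of_isAffine (hX : ∀ x, IsAffineOpen X (minOpen X x)) (h : IsAffine X)
    (M : ModX X) (hM : M.IsQuasicoherent) (n : ℕ) : Subsingleton (H M (n + 1)) := by
  have : Subsingleton (H (ofSheaf M).toSheaf (n + 1)) :=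
    subsingleton_H_of_vanishOn n _ (StalkMod.IsAffineOpen.vanishOn hX h (qc_ofSheaf M hM) n)
  let e := (Sheaf.functorH _ (n + 1)).mapIso
    ((SheafOfModules.toSheaf (ringSheaf X)).mapIso (asIso (sheafUnit M)))
  exact e.addCommGroupIsoToAddEquiv.toEquiv.subsingleton_congr.2 this

omit [Finite X] in
-- Left exactness is automatic, and the obstruction to lifting a global section lies in `H¹` of the
-- kernel term.
lemma globalSectionsExact_of_subsingleton_H
    (h : ∀ M : ModX X, M.IsQuasicoherent → Subsingleton (H M 1)) : GlobalSectionsExact X := by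
  intro S hS
  have hf : Mono S.f.hom := hS.mono_f
  have hf' : Mono (S.map (QcMod.incl X)).f := hf
  have hS' := hS.map_of_exact (SheafOfModules.toSheaf (ringSheaf X))
  exact
    { exact := (ShortComplex.ShortExact.moduleCat_exact_iff_function_exact _).2
        (exact_app_of_exact hS.exact (⊤ : Opens X))
      mono_f := (ModuleCat.mono_iff_injective _).2 (injective_app_of_mono S.f.hom (⊤ : Opens X))
      epi_g := (ModuleCat.epi_iff_surjective _).2
        (surjective_app_top (T := X.toPresheafedSpace.carrier) hS' (h _ S.X₁.property)) }

/-- A stalkwise surjection of quasi-coherent modules has quasi-coherent kernel, so it completes to a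
short exact sequence to which the exactness hypothesis applies. -/
lemma surjectiveOnSections_of_globalSectionsExact (hX : ∀ x, IsAffineOpen X (minOpen X x))
    (h : GlobalSectionsExact X) : SurjectiveOnSections X := by
  intro M N f hM hN hf
  have hK : QC f.ker.toMod := .ker hX f hM hN
  let S : ShortComplex (QcMod X) :=
    { X₁ := ⟨f.ker.toMod.toSheaf, QC.isQuasicoherent hX hK⟩
      X₂ := ⟨M.toSheaf, QC.isQuasicoherent hX hM⟩
      X₃ := ⟨N.toSheaf, QC.isQuasicoherent hX hN⟩
      f := ObjectProperty.homMk f.ker.incl.toSheaf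
      g := ObjectProperty.homMk f.toSheaf
      zero := by
        ext1
        exact (shortComplex f.ker.incl f (exact_incl_ker f)).zero }
  have hS : (S.map (QcMod.incl X)).ShortExact :=
    shortExact_shortComplex f.ker.incl f (exact_incl_ker f) f.ker.incl_injective hf
  exact (ModuleCat.epi_iff_surjective _).1 (h S hS).epi_g

end Comparison
end FiniteRingedSpace

end

/-! ### The equivalences -/

theorem mainTheorem4 (X : AlgebraicGeometry.RingedSpace.{u, u}) [Finite X]
    (hX : FiniteRingedSpace.IsSchematic X) :
    (FiniteRingedSpace.IsAffine X ↔ FiniteRingedSpace.GlobalSectionsExact X) ∧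
    (FiniteRingedSpace.IsAffine X ↔
      ∀ M : FiniteRingedSpace.ModX X, M.IsQuasicoherent →
        Subsingleton (FiniteRingedSpace.H M 1)) ∧
    (FiniteRingedSpace.IsAffine X ↔
      ∀ M : FiniteRingedSpace.ModX X, M.IsQuasicoherent →
        ∀ n : ℕ, 0 < n → Subsingleton (FiniteRingedSpace.H M n)) := by
  have hX' := hX.isAffineOpen_minOpen
  have h1 (h : FiniteRingedSpace.GlobalSectionsExact X) : FiniteRingedSpace.IsAffine X :=
    FiniteRingedSpace.StalkMod.isAffine_of_surjectiveOnSections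
      (FiniteRingedSpace.surjectiveOnSections_of_globalSectionsExact hX' h) hX'
  have h2 := FiniteRingedSpace.globalSectionsExact_of_subsingleton_H (X := X)
  have h3 := FiniteRingedSpace.subsingleton_H_of_isAffine hX'
  refine ⟨⟨fun h => h2 fun M hM => h3 h M hM 0, h1⟩,
    ⟨fun h M hM => h3 h M hM 0, fun h => h1 (h2 h)⟩, ⟨fun h M hM n hn => ?_, fun h =>
      h1 (h2 fun M hM => h M hM 1 one_pos)⟩⟩
  obtain ⟨n, rfl⟩ := Nat.exists_eq_succ_of_ne_zero hn.ne'
  exact h3 h M hM n
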